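/- **Theorem (Extended maximum principle).** *Setting.* Let $\Sigma$ be a closed manifold of dimension $2n-1$ with a smooth contact form $\alpha$, $\xi=\ker\alpha$, Reeb vector field $R$. On $S\Sigma=\Sigma\times(0,\infty)$ with coordinate $r$ on the second factor put $\lambda=r\alpha$ and $Y=r\partial_r$, and write $S\Sigma(\rho)=\Sigma\times(\rho,\infty)$. Let $(M,\omega)$ be a connected non-compact $2n$-dimensional symplectic manifold modelled on $\Sigma$ at infinity: there are $0<r_M<1$, a compact set $M_*\subset M$ and a symplectomorphism $(M\setminus M_*,\omega)\cong (S\Sigma(r_M),d\lambda)$, by which we regard $S\Sigma(r_M)$ as a subset of $M$, and for every $\rho>r_M$ the set $M_\rho=M\setminus S\Sigma(\rho)$ is a compact neighbourhood of $M_*$. Put $S^1=\mathbb R/\mathbb Z$. *Vector fields.* The Hamiltonian vector field $X_H$ of a function $H$ on $M$ is given by $\omega(X_H,\cdot)=-dH$. The contact vector field $X_h$ of a function $h$ on $\Sigma$ is given by $\alpha(X_h)=h$, $d\alpha(X_h,\cdot)=dh(R)\alpha-dh$. For time-dependent $H_t$, $h_t$ let $\phi_H^t$, $\varphi_h^t$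 denote the flows of $X_{H_t}$, $X_{h_t}$. *Hamiltonians.* $\mathcal H$ is the set of smooth $H:M\times S^1\to\mathbb R$ for which there are $r_M<r_H<1$, a constant $c_H$ and functions $h_t:\Sigma\to\mathbb R$ with $H_t(x,r)=r\,h_t(x)+c_H$ on $S\Sigma(r_H)$; no invariance of $h_t$ under the Reeb flow is assumed. $\mathcal H_\circ\subset\mathcal H$ is the set of those $H$ for which moreover $\varphi_h^1$ has no fixed points and all fixed points of $\phi_H^1$ are non-degenerate. A continuation homotopy of Hamiltonians is a smooth family $\mathbf H=(H^s)_{s\in\mathbb R}$ in $\mathcal H$ such that $H^s=H^0$ for $s\le 0$, $H^s=H^1$ for $s\ge1$, $H^0,H^1\in\mathcal H_\circ$ and $\partial_sH^s\ge0$. *Almost complex structures.* Given a positive smooth function $q$ on $\Sigma$ and a smooth almost complex structure $j$ on $\xi$ such that $d\alpha(j\cdot,\cdot)$ is symmetric and positive definite on $\xi$, put $Q=rq$, $X_Q=X_q-dq(R)Y$ and $\zeta_Q(v)=v-\frac{r\,dq(v)}{q}\partial_r$ for $v\in\xi$. The almost complex structure of twisted SFT-type $J_Q$ on $S\Sigma$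 determined by $(q,j)$ is $$J_Q(aX_Q+bY+\zeta_Q(v))=-bX_Q+aY+\zeta_Q(jv),\qquad a,b\in\mathbb R,\ v\in\xi .$$ $\mathcal J$ is the set of smooth families $J=(J_t)_{t\in S^1}$ of almost complex structures on $M$ such that $\omega(J_t\cdot,\cdot)$ is symmetric and positive definite, and for which there are $r_M<r_J<1$, a smooth family $(q_t)_{t\in S^1}$ of positive functions on $\Sigma$ and an almost complex structure $j$ on $\xi$ as above such that on $S\Sigma(r_J)$, $J_t$ is the almost complex structure of twisted SFT-type determined by $(q_t,j)$. A continuation homotopy of almost complex structures is a smooth family $\mathbf J=(J^s)_{s\in\mathbb R}$ in $\mathcal J$ with $J^s=J^0$ for $s\le0$ and $J^s=J^1$ for $s\ge1$. *Floer solutions.* For $E\ge0$ let $\mathcal M_{\mathbf H,\mathbf J}(E)$ be the set of smooth maps $u:\mathbb R\times S^1\to M$ with $$\partial_su+J^s_t(u)\bigl(\partial_tu-X_{H^s_t}(u)\bigr)=0,\qquad \int_{\mathbb R}\int_{S^1}\omega(J^s_t\partial_su,\partial_su)\,dt\,ds\le E .$$ *Claim.* For all continuation homotopies $\mathbf H$,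 $\mathbf J$ and all $E\ge0$ there is a constant $r_0=r_0(E,\mathbf H,\mathbf J)>0$ such that $$u(\mathbb R\times S^1)\cap S\Sigma(r_0)=\emptyset\qquad\text{for all }u\in\mathcal M_{\mathbf H,\mathbf J}(E).$$ -/

import Mathlib

open Set
open scoped Manifold ContDiff

noncomputable section

namespace FloerMax

/-! ## Tensor fields on manifolds -/

section Forms

variable {d : ℕ} {N : Type*} [TopologicalSpace N] [ChartedSpace (EuclideanSpace ℝ (Fin d)) N]

/-- One-forms (not yet assumed smooth) on a `d`-dimensional manifold `N`. -/
abbrev OneForm (d : ℕ) (N : Type*) [TopologicalSpace N]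
    [ChartedSpace (EuclideanSpace ℝ (Fin d)) N] : Type _ :=
  (x : N) → TangentSpace (𝓡 d) x →L[ℝ] ℝ

/-- Bilinear forms on the tangent spaces of `N`. -/
abbrev BilinField (d : ℕ) (N : Type*) [TopologicalSpace N]
    [ChartedSpace (EuclideanSpace ℝ (Fin d)) N] : Type _ :=
  (x : N) → TangentSpace (𝓡 d) x →L[ℝ] TangentSpace (𝓡 d) x →L[ℝ] ℝ

/-- Fields of endomorphisms of the tangent spaces of `N`. -/
abbrev EndField (d : ℕ) (N : Type*) [TopologicalSpace N]
    [ChartedSpace (EuclideanSpace ℝ (Fin d)) N] : Type _ :=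
  (x : N) → TangentSpace (𝓡 d) x →L[ℝ] TangentSpace (𝓡 d) x

/-- The differential of a real function, as a linear functional on the tangent space. -/
def dfun (f : N → ℝ) (x : N) : TangentSpace (𝓡 d) x →L[ℝ] ℝ :=
  mfderiv (𝓡 d) 𝓘(ℝ, ℝ) f x

/-- The vector field on the domain of the preferred chart at `x₀` that is constant and equal to `a`
in the coordinates of this chart, at the point with coordinates `y`. -/
def coordField (x₀ : N) (a y : EuclideanSpace ℝ (Fin d)) :
    TangentSpace (𝓡 d) ((extChartAt (𝓡 d) x₀).symm y) :=
  mfderiv 𝓘(ℝ, EuclideanSpace ℝ (Fin d)) (𝓡 d) (extChartAt (𝓡 d) x₀).symm y a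

/-- The exterior derivative `dα` of a one-form, `dα(v, w) = ∂_v (α(w)) - ∂_w (α(v))`, computed in
the preferred chart at `x`. (In Mathlib the space `TangentSpace (𝓡 d) x` is the model space, and a
vector of it is given by its coordinates in the preferred chart at `x`.) -/
def dOne (α : OneForm d N) (x : N) (v w : TangentSpace (𝓡 d) x) : ℝ :=
  fderiv ℝ (fun y : EuclideanSpace ℝ (Fin d) =>
      α ((extChartAt (𝓡 d) x).symm y) (coordField x w y)) (extChartAt (𝓡 d) x x) v
  - fderiv ℝ (fun y : EuclideanSpace ℝ (Fin d) =>
      α ((extChartAt (𝓡 d) x).symm y) (coordField x v y)) (extChartAt (𝓡 d) x x) w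

/-- In the preferred chart at `x`, the derivative in direction `a` of the coefficient
`Ω(b, c)` of a bilinear form. -/
def dCoeff (Ω : BilinField d N) (x : N) (a b c : TangentSpace (𝓡 d) x) : ℝ :=
  fderiv ℝ (fun y : EuclideanSpace ℝ (Fin d) =>
      Ω ((extChartAt (𝓡 d) x).symm y) (coordField x b y) (coordField x c y))
    (extChartAt (𝓡 d) x x) a

/-- `α` is a smooth contact form: it has no zeros and `dα` is nondegenerate on `ξ = ker α`. -/
structure IsContactForm [IsManifold (𝓡 d) ∞ N] (α : OneForm d N) : Prop where
  smooth : ContMDiff (𝓡 d) ((𝓡 d).prod 𝓘(ℝ, EuclideanSpace ℝ (Fin d) →L[ℝ] ℝ)) ∞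
    (fun x : N => (⟨x, α x⟩ : Bundle.TotalSpace (EuclideanSpace ℝ (Fin d) →L[ℝ] ℝ)
      (fun x : N => TangentSpace (𝓡 d) x →L[ℝ] ℝ)))
  ne_zero : ∀ x, α x ≠ 0
  nondegenerate : ∀ (x : N) (v : TangentSpace (𝓡 d) x), α x v = 0 →
    (∀ w : TangentSpace (𝓡 d) x, α x w = 0 → dOne α x v w = 0) → v = 0

/-- `Ω` is a symplectic form: a smooth, alternating, nondegenerate and closed two-form. -/
structure IsSymplecticForm [IsManifold (𝓡 d) ∞ N] (Ω : BilinField d N) : Prop where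
  smooth : ContMDiff (𝓡 d)
    ((𝓡 d).prod 𝓘(ℝ, EuclideanSpace ℝ (Fin d) →L[ℝ] EuclideanSpace ℝ (Fin d) →L[ℝ] ℝ)) ∞
    (fun x : N => (⟨x, Ω x⟩ : Bundle.TotalSpace
      (EuclideanSpace ℝ (Fin d) →L[ℝ] EuclideanSpace ℝ (Fin d) →L[ℝ] ℝ)
      (fun x : N => TangentSpace (𝓡 d) x →L[ℝ] TangentSpace (𝓡 d) x →L[ℝ] ℝ)))
  alternating : ∀ (x : N) (v : TangentSpace (𝓡 d) x), Ω x v v = 0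
  nondegenerate : ∀ (x : N) (v : TangentSpace (𝓡 d) x),
    (∀ w : TangentSpace (𝓡 d) x, Ω x v w = 0) → v = 0
  closed : ∀ (x : N) (a b c : TangentSpace (𝓡 d) x),
    dCoeff Ω x a b c + dCoeff Ω x b c a + dCoeff Ω x c a b = 0

/-- The Reeb vector field: `α(R) = 1` and `dα(R, ·) = 0`. -/
def reeb (α : OneForm d N) (x : N) : TangentSpace (𝓡 d) x :=
  Classical.epsilon fun v => α x v = 1 ∧ ∀ w : TangentSpace (𝓡 d) x, dOne α x v w = 0

/-- The contact vector field `X_h` of a function `h`: `α(X_h) = h` and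
`dα(X_h, ·) = dh(R) α - dh`. -/
def contactField (α : OneForm d N) (h : N → ℝ) (x : N) : TangentSpace (𝓡 d) x :=
  Classical.epsilon fun v => α x v = h x ∧ ∀ w : TangentSpace (𝓡 d) x,
    dOne α x v w = dfun h x (reeb α x) * α x w - dfun h x w

/-- The Hamiltonian vector field `X_H` of a function `H`: `Ω(X_H, ·) = -dH`. -/
def hamField (Ω : BilinField d N) (H : N → ℝ) (z : N) : TangentSpace (𝓡 d) z :=
  Classical.epsilon fun v => ∀ w : TangentSpace (𝓡 d) z, Ω z v w = - dfun H z w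

/-- `γ` solves `γ'(t) = X_t(γ(t))` for all real `t`. -/
def IsSolution (X : ℝ → (x : N) → TangentSpace (𝓡 d) x) (γ : ℝ → N) : Prop :=
  ∀ t : ℝ, HasMFDerivAt 𝓘(ℝ, ℝ) (𝓡 d) γ t
    ((1 : ℝ →L[ℝ] ℝ).smulRight (X t (γ t) : TangentSpace (𝓡 d) (γ t)))

open Classical in
/-- The flow of a time-dependent vector field: `flow X t x` is the value at time `t` of the solution
that starts at `x` at time `0`. (It is only used for vector fields whose solutions are unique and
exist for all times.) -/
def flow (X : ℝ → (x : N) → TangentSpace (𝓡 d) x) (t : ℝ) (x : N) : N :=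
  if h : ∃ γ : ℝ → N, IsSolution X γ ∧ γ 0 = x then h.choose t else x

end Forms

/-! ## The symplectisation `S × (0, ∞)` and almost complex structures of twisted SFT-type

A tangent vector of `S × ℝ` at `p = (x, r)` is a pair `(w, c)`, standing for `w + c ∂_r`. -/

section Symplectisation

variable {k : ℕ} {S : Type*} [TopologicalSpace S] [ChartedSpace (EuclideanSpace ℝ (Fin k)) S]

/-- The form `dλ = dr ∧ α + r dα`, where `λ = r α`. -/
def dLiouville (α : OneForm k S) (p : S × ℝ) (η η' : TangentSpace (𝓡 k) p.1 × ℝ) : ℝ :=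
  η.2 * α p.1 η'.1 - η'.2 * α p.1 η.1 + p.2 * dOne α p.1 η.1 η'.1

/-- The Liouville vector field `Y = r ∂_r`. -/
def liouvilleField (p : S × ℝ) : TangentSpace (𝓡 k) p.1 × ℝ := (0, p.2)

/-- The Hamiltonian vector field `X_Q = X_q - dq(R) Y` of `Q(x, r) = r q(x)`. -/
def fieldQ (α : OneForm k S) (q : S → ℝ) (p : S × ℝ) : TangentSpace (𝓡 k) p.1 × ℝ :=
  (contactField α q p.1, - (dfun q p.1 (reeb α p.1) * p.2))

/-- The lift `ζ_Q(v) = (v, - r dq(v) / q)` of `v ∈ ξ` to the symplectic complement of the span of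
`X_Q` and `Y`. -/
def zetaQ (q : S → ℝ) (p : S × ℝ) (v : TangentSpace (𝓡 k) p.1) : TangentSpace (𝓡 k) p.1 × ℝ :=
  (v, - (p.2 * dfun q p.1 v / q p.1))

/-- `j` is a smooth almost complex structure on `ξ = ker α` such that `dα(j ·, ·)` is symmetric and
positive definite on `ξ`. (It is given as a field of endomorphisms of the tangent spaces of which
only the restriction to `ξ` matters.) -/
structure IsCompatibleOnXi [IsManifold (𝓡 k) ∞ S] (α : OneForm k S) (j : EndField k S) :
    Prop where
  smooth : ContMDiff (𝓡 k)
    ((𝓡 k).prod 𝓘(ℝ, EuclideanSpace ℝ (Fin k) →L[ℝ] EuclideanSpace ℝ (Fin k))) ∞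
    (fun x : S => (⟨x, j x⟩ : Bundle.TotalSpace
      (EuclideanSpace ℝ (Fin k) →L[ℝ] EuclideanSpace ℝ (Fin k))
      (fun x : S => TangentSpace (𝓡 k) x →L[ℝ] TangentSpace (𝓡 k) x)))
  maps : ∀ (x : S) (v : TangentSpace (𝓡 k) x), α x v = 0 → α x (j x v) = 0
  sq : ∀ (x : S) (v : TangentSpace (𝓡 k) x), α x v = 0 → j x (j x v) = - v
  symm : ∀ (x : S) (v w : TangentSpace (𝓡 k) x), α x v = 0 → α x w = 0 →
    dOne α x (j x v) w = dOne α x (j x w) v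
  pos : ∀ (x : S) (v : TangentSpace (𝓡 k) x), α x v = 0 → v ≠ 0 → 0 < dOne α x (j x v) v

end Symplectisation

/-! ## Manifolds modelled on `S` at infinity -/

section Main

variable {k d : ℕ} {S M : Type*}
  [TopologicalSpace S] [ChartedSpace (EuclideanSpace ℝ (Fin k)) S] [IsManifold (𝓡 k) ∞ S]
  [TopologicalSpace M] [ChartedSpace (EuclideanSpace ℝ (Fin d)) M] [IsManifold (𝓡 d) ∞ M]

/-- The symplectic manifold `(M, Ω)` is modelled on `(S, α)` at infinity: outside of a compact
subset `core`, it is identified by a symplectomorphism `chart` with `S × (rM, ∞)`. The last two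
fields say that the core lies at the end `r = rM` of `S × (rM, ∞)`: the set `M_ρ` of all points that
are in the core or have `r ≤ ρ` is a compact neighbourhood of the core, for all `ρ > rM`. -/
structure ModelledAtInfinity (α : OneForm k S) (Ω : BilinField d M) where
  rM : ℝ
  rM_pos : 0 < rM
  rM_lt_one : rM < 1
  core : Set M
  isCompact_core : IsCompact core
  chart : OpenPartialHomeomorph M (S × ℝ)
  source_eq : chart.source = coreᶜ
  target_eq : chart.target = univ ×ˢ Ioi rM
  smooth_chart : ContMDiffOn (𝓡 d) ((𝓡 k).prod 𝓘(ℝ, ℝ)) ∞ chart chart.source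
  smooth_symm : ContMDiffOn ((𝓡 k).prod 𝓘(ℝ, ℝ)) (𝓡 d) ∞ chart.symm chart.target
  symplectic : ∀ z ∉ core, ∀ v w : TangentSpace (𝓡 d) z,
    dLiouville α (chart z)
      (mfderiv (𝓡 d) (𝓡 k) (fun z => (chart z).1) z v, dfun (fun z => (chart z).2) z v)
      (mfderiv (𝓡 d) (𝓡 k) (fun z => (chart z).1) z w, dfun (fun z => (chart z).2) z w) = Ω z v w
  isCompact_sublevel : ∀ ρ, rM < ρ → IsCompact {z | z ∈ core ∨ (chart z).2 ≤ ρ}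
  core_subset_interior : ∀ ρ, rM < ρ → core ⊆ interior {z | z ∈ core ∨ (chart z).2 ≤ ρ}

namespace ModelledAtInfinity

variable {α : OneForm k S} {Ω : BilinField d M}

/-- The subset `S × (ρ, ∞)` of `M`. -/
def endSet (D : ModelledAtInfinity α Ω) (ρ : ℝ) : Set M :=
  {z | z ∉ D.core ∧ ρ < (D.chart z).2}

/-- The differential of the identification with `S × (rM, ∞)`. -/
def dchart (D : ModelledAtInfinity α Ω) (z : M) (v : TangentSpace (𝓡 d) z) :
    TangentSpace (𝓡 k) (D.chart z).1 × ℝ :=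
  (mfderiv (𝓡 d) (𝓡 k) (fun z => (D.chart z).1) z v, dfun (fun z => (D.chart z).2) z v)

/-- `H_t(x, r) = r h_t(x) + c` on `S × (rH, ∞)`, for some `rM < rH < 1` and some constant `c`. -/
def HasSlope (D : ModelledAtInfinity α Ω) (H : ℝ → M → ℝ) (h : ℝ → S → ℝ) : Prop :=
  ∃ rH c : ℝ, D.rM < rH ∧ rH < 1 ∧ ∀ t : ℝ, ∀ z ∈ D.endSet rH,
    H t z = (D.chart z).2 * h t (D.chart z).1 + c

/-- The set of smooth time-dependent Hamiltonians, of period one in time, that are one-homogeneous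
at infinity up to a constant. -/
structure MemHam (D : ModelledAtInfinity α Ω) (H : ℝ → M → ℝ) : Prop where
  smooth : ContMDiff (𝓘(ℝ, ℝ).prod (𝓡 d)) 𝓘(ℝ, ℝ) ∞ (fun p : ℝ × M => H p.1 p.2)
  periodic : ∀ t z, H (t + 1) z = H t z
  slope : ∃ h : ℝ → S → ℝ, D.HasSlope H h

/-- The Hamiltonians in `MemHam` for which moreover the time-one map of the contact isotopy at
infinity has no fixed points and all fixed points of the time-one map of the Hamiltonian flow are
nondegenerate. -/
structure MemHamNondeg (D : ModelledAtInfinity α Ω) (H : ℝ → M → ℝ) : Prop where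
  memHam : D.MemHam H
  no_fixed : ∀ h : ℝ → S → ℝ, D.HasSlope H h →
    ∀ x : S, flow (fun t => contactField α (h t)) 1 x ≠ x
  nondegenerate : ∀ z : M, flow (fun t => hamField Ω (H t)) 1 z = z →
    ∀ v : TangentSpace (𝓡 d) z,
      mfderiv (𝓡 d) (𝓡 d) (flow (fun t => hamField Ω (H t)) 1) z v =
        (v : EuclideanSpace ℝ (Fin d)) → v = 0

/-- On `S × (rJ, ∞)`, the endomorphism field `J` is the almost complex structure `J_Q` of twisted
SFT-type of the pair `(q, j)`:
`J_Q (a X_Q + b Y + ζ_Q(v)) = - b X_Q + a Y + ζ_Q(j v)` for real `a`, `b` and `v ∈ ξ`. -/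
def IsTwistedSFT (D : ModelledAtInfinity α Ω) (rJ : ℝ) (q : S → ℝ) (j : EndField k S)
    (J : EndField d M) : Prop :=
  ∀ z ∈ D.endSet rJ, ∀ (η : TangentSpace (𝓡 d) z) (a b : ℝ)
    (v : TangentSpace (𝓡 k) (D.chart z).1), α (D.chart z).1 v = 0 →
    D.dchart z η = a • fieldQ α q (D.chart z) + b • liouvilleField (D.chart z)
      + zetaQ q (D.chart z) v →
    D.dchart z (J z η) = -(b • fieldQ α q (D.chart z)) + a • liouvilleField (D.chart z)
      + zetaQ q (D.chart z) (j (D.chart z).1 v)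

/-- The set of smooth families, of period one in time, of `Ω`-compatible almost complex structures
(`Ω(J ·, ·)` is symmetric and positive definite) that are of twisted SFT-type at infinity. -/
structure MemAcs (D : ModelledAtInfinity α Ω) (J : ℝ → EndField d M) : Prop where
  smooth : ContMDiff (𝓘(ℝ, ℝ).prod (𝓡 d))
    ((𝓡 d).prod 𝓘(ℝ, EuclideanSpace ℝ (Fin d) →L[ℝ] EuclideanSpace ℝ (Fin d))) ∞
    (fun p : ℝ × M => (⟨p.2, J p.1 p.2⟩ : Bundle.TotalSpace
      (EuclideanSpace ℝ (Fin d) →L[ℝ] EuclideanSpace ℝ (Fin d))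
      (fun z : M => TangentSpace (𝓡 d) z →L[ℝ] TangentSpace (𝓡 d) z)))
  periodic : ∀ t z, J (t + 1) z = J t z
  sq : ∀ t z (v : TangentSpace (𝓡 d) z), J t z (J t z v) = - v
  symm : ∀ t z (v w : TangentSpace (𝓡 d) z), Ω z (J t z v) w = Ω z (J t z w) v
  pos : ∀ t z (v : TangentSpace (𝓡 d) z), v ≠ 0 → 0 < Ω z (J t z v) v
  twisted : ∃ (rJ : ℝ) (q : ℝ → S → ℝ) (j : EndField k S), D.rM < rJ ∧ rJ < 1 ∧
    ContMDiff (𝓘(ℝ, ℝ).prod (𝓡 k)) 𝓘(ℝ, ℝ) ∞ (fun p : ℝ × S => q p.1 p.2) ∧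
    (∀ t x, q (t + 1) x = q t x) ∧ (∀ t x, 0 < q t x) ∧
    IsCompatibleOnXi α j ∧ ∀ t, D.IsTwistedSFT rJ (q t) j (J t)

/-- Continuation homotopies of Hamiltonians, `H s t = H^s_t`. -/
structure IsContinuationHam (D : ModelledAtInfinity α Ω) (H : ℝ → ℝ → M → ℝ) : Prop where
  smooth : ContMDiff (𝓘(ℝ, ℝ).prod (𝓘(ℝ, ℝ).prod (𝓡 d))) 𝓘(ℝ, ℝ) ∞
    (fun p : ℝ × ℝ × M => H p.1 p.2.1 p.2.2)
  memHam : ∀ s, D.MemHam (H s)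
  eq_of_nonpos : ∀ s ≤ 0, H s = H 0
  eq_of_one_le : ∀ s, 1 ≤ s → H s = H 1
  nondeg_zero : D.MemHamNondeg (H 0)
  nondeg_one : D.MemHamNondeg (H 1)
  monotone : ∀ s t z, 0 ≤ deriv (fun σ => H σ t z) s

/-- Continuation homotopies of almost complex structures, `J s t = J^s_t`. -/
structure IsContinuationAcs (D : ModelledAtInfinity α Ω) (J : ℝ → ℝ → EndField d M) : Prop where
  smooth : ContMDiff (𝓘(ℝ, ℝ).prod (𝓘(ℝ, ℝ).prod (𝓡 d)))
    ((𝓡 d).prod 𝓘(ℝ, EuclideanSpace ℝ (Fin d) →L[ℝ] EuclideanSpace ℝ (Fin d))) ∞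
    (fun p : ℝ × ℝ × M => (⟨p.2.2, J p.1 p.2.1 p.2.2⟩ : Bundle.TotalSpace
      (EuclideanSpace ℝ (Fin d) →L[ℝ] EuclideanSpace ℝ (Fin d))
      (fun z : M => TangentSpace (𝓡 d) z →L[ℝ] TangentSpace (𝓡 d) z)))
  memAcs : ∀ s, D.MemAcs (J s)
  eq_of_nonpos : ∀ s ≤ 0, J s = J 0
  eq_of_one_le : ∀ s, 1 ≤ s → J s = J 1

end ModelledAtInfinity

/-- The partial derivative `∂_s u`. -/
def partialS (u : ℝ × ℝ → M) (p : ℝ × ℝ) : TangentSpace (𝓡 d) (u p) :=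
  mfderiv 𝓘(ℝ, ℝ × ℝ) (𝓡 d) u p ((1, 0) : ℝ × ℝ)

/-- The partial derivative `∂_t u`. -/
def partialT (u : ℝ × ℝ → M) (p : ℝ × ℝ) : TangentSpace (𝓡 d) (u p) :=
  mfderiv 𝓘(ℝ, ℝ × ℝ) (𝓡 d) u p ((0, 1) : ℝ × ℝ)

/-- The energy `∫_ℝ ∫_{S¹} Ω(J^s_t ∂_s u, ∂_s u) dt ds`, possibly infinite. -/
def energy (Ω : BilinField d M) (J : ℝ → ℝ → EndField d M) (u : ℝ × ℝ → M) : ENNReal :=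
  ∫⁻ s : ℝ, ∫⁻ t in Ioc (0 : ℝ) 1,
    ENNReal.ofReal (Ω (u (s, t)) (J s t (u (s, t)) (partialS u (s, t))) (partialS u (s, t)))

/-- The space of all smooth maps `u : ℝ × S¹ → M` (given as maps on `ℝ × ℝ` of period one in the
second variable) of energy at most `E` that solve the Floer equation
`∂_s u + J^s_t(u) (∂_t u - X_{H^s_t}(u)) = 0`. -/
structure IsFloerSolution (Ω : BilinField d M) (H : ℝ → ℝ → M → ℝ) (J : ℝ → ℝ → EndField d M)
    (E : ℝ) (u : ℝ × ℝ → M) : Prop where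
  smooth : ContMDiff 𝓘(ℝ, ℝ × ℝ) (𝓡 d) ∞ u
  periodic : ∀ s t, u (s, t + 1) = u (s, t)
  floer : ∀ s t, partialS u (s, t) +
    J s t (u (s, t)) (partialT u (s, t) - hamField Ω (H s t) (u (s, t))) = 0
  energy_le : energy Ω J u ≤ ENNReal.ofReal E

end Main

end FloerMax

end

/-! Consider a Floer solution u at points where r > 1, and let g be the norm of ∂_s u. An almost
complex structure of twisted SFT-type satisfies dQ ∘ J = λ for Q = r q. Hence the Floer equation
expresses both first derivatives of Q(u) by λ(∂_t u), λ(∂_s u) and one-homogeneous functions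
(`fderiv_homogAlong_fst`, `fderiv_homogAlong_snd`). On differentiating again, the λ-terms combine by
Stokes to -ω(∂_s u, ∂_t u) = g² - dH(∂_s u). Squared norms are one-homogeneous in r and S is
compact, so every other term is bounded by a multiple of √r g or of r. The terms linear in g are
absorbed by g², and ΔQ(u) ≥ -C r (`exists_laplacian_ge`). The zero-order term has the wrong sign for
a global maximum principle, but one holds on strips that are thin in terms of C
(`IsProfile.le_of_strip`), provided that r is bounded on the boundary loops.

Such loops come from the energy bound. Every s-interval of length η contains a loop with ∫ g² dt ≤ E
/ η, and along it log r has bounded oscillation (`log_le_of_loop`); so it suffices to bound r at one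
of its points. As |∂_s √r| ≤ C g, averaging over t carries a bound of r from an entire loop at s₀ to
some point of each loop at s with |s - s₀| ≤ 2 (`exists_radius_le`). Suitable s₀ are found outside
(0, 1), where the Hamiltonian is H⁰ or H¹. If r were large along a loop of bounded ∫ g² there, the
projection to S would solve the equation of the contact flow up to an error of size g / √r. By
Gronwall and the absence of fixed points, it could not close up (`exists_le_integral_of_loop`,
`exists_cutRadius_le_of_loop`).

`IsProfile` collects what is needed about r, g and Q as functions on the plane, so that the final
bound (`IsProfile.exists_bound`) is pure analysis with constants independent of u. -/

noncomputable section

namespace FloerMax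

open Bundle Filter Topology

set_option linter.unusedSectionVars false

/-! ### Smoothness of tensor fields and vector fields along maps -/

section Smoothness

variable {EP : Type*} [NormedAddCommGroup EP] [NormedSpace ℝ EP] {HP : Type*} [TopologicalSpace HP]
  {IP : ModelWithCorners ℝ EP HP} {P : Type*} [TopologicalSpace P] [ChartedSpace HP P]
  {EN : Type*} [NormedAddCommGroup EN] [NormedSpace ℝ EN] {HN : Type*} [TopologicalSpace HN]
  {IN : ModelWithCorners ℝ EN HN} {N : Type*} [TopologicalSpace N] [ChartedSpace HN N]
  [IsManifold IN ∞ N]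
  {EN' : Type*} [NormedAddCommGroup EN'] [NormedSpace ℝ EN'] {HN' : Type*} [TopologicalSpace HN']
  {IN' : ModelWithCorners ℝ EN' HN'} {N' : Type*} [TopologicalSpace N'] [ChartedSpace HN' N']
  [IsManifold IN' ∞ N']

/-- The image of a smooth vector field along `b` under the differentials of a smooth family of maps
is smooth. -/
theorem contMDiffAt_mfderiv_apply [IsManifold IP ∞ P] {f : P → N → N'} {b : P → N}
    {X : ∀ p, TangentSpace IN (b p)} {p₀ : P}
    (hf : ContMDiffAt (IP.prod IN) IN' ∞ (Function.uncurry f) (p₀, b p₀))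
    (hX : ContMDiffAt IP IN.tangent ∞ (fun p => (⟨b p, X p⟩ : TangentBundle IN N)) p₀) :
    ContMDiffAt IP IN'.tangent ∞
      (fun p => (⟨f p (b p), mfderiv IN IN' (f p) (b p) (X p)⟩ : TangentBundle IN' N')) p₀ := by
  have hb : ContMDiffAt IP IN ∞ b p₀ := (contMDiffAt_totalSpace.1 hX).1
  have h1 := ContMDiffAt.mfderiv (m := ∞) f b hf hb (by simp)
  exact ContMDiffAt.clm_apply_of_inCoordinates h1 hX
    (hf.comp p₀ (contMDiffAt_id.prodMk hb))

/-- The real-valued case of `contMDiffAt_mfderiv_apply`. -/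
theorem contMDiffAt_mfderiv_apply_real [IsManifold IP ∞ P]
    {F : Type*} [NormedAddCommGroup F] [NormedSpace ℝ F] {f : P → N → F} {b : P → N}
    {X : ∀ p, TangentSpace IN (b p)} {p₀ : P}
    (hf : ContMDiffAt (IP.prod IN) 𝓘(ℝ, F) ∞ (Function.uncurry f) (p₀, b p₀))
    (hX : ContMDiffAt IP IN.tangent ∞ (fun p => (⟨b p, X p⟩ : TangentBundle IN N)) p₀) :
    ContMDiffAt IP 𝓘(ℝ, F) ∞
      (fun p => (mfderiv IN 𝓘(ℝ, F) (f p) (b p) (X p) : F)) p₀ := by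
  have := contMDiffAt_mfderiv_apply hf hX
  rw [contMDiffAt_totalSpace] at this
  simpa using this.2

/-- A smooth one-form applied to a smooth vector field along a map. -/
theorem contMDiffAt_oneForm_apply {d : ℕ} {M : Type*} [TopologicalSpace M]
    [ChartedSpace (EuclideanSpace ℝ (Fin d)) M] [IsManifold (𝓡 d) ∞ M]
    {b : P → M} {φ : ∀ p, TangentSpace (𝓡 d) (b p) →L[ℝ] ℝ} {X : ∀ p, TangentSpace (𝓡 d) (b p)}
    {p₀ : P}
    (hφ : ContMDiffAt IP ((𝓡 d).prod 𝓘(ℝ, EuclideanSpace ℝ (Fin d) →L[ℝ] ℝ)) ∞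
      (fun p => (⟨b p, φ p⟩ : Bundle.TotalSpace (EuclideanSpace ℝ (Fin d) →L[ℝ] ℝ)
        (fun x : M => TangentSpace (𝓡 d) x →L[ℝ] ℝ))) p₀)
    (hX : ContMDiffAt IP (𝓡 d).tangent ∞ (fun p => (⟨b p, X p⟩ : TangentBundle (𝓡 d) M)) p₀) :
    ContMDiffAt IP 𝓘(ℝ, ℝ) ∞ (fun p => φ p (X p)) p₀ := by
  have : ContMDiffAt IP ((𝓡 d).prod 𝓘(ℝ, ℝ)) ∞
      (fun p => TotalSpace.mk' ℝ (E := Bundle.Trivial M ℝ) (b p) (φ p (X p))) p₀ :=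
    ContMDiffAt.clm_bundle_apply (F₁ := EuclideanSpace ℝ (Fin d)) hφ hX
  rw [contMDiffAt_totalSpace] at this
  simpa using this.2

/-- A smooth bilinear form applied to smooth vector fields along a map. -/
theorem contMDiffAt_bilin_apply {d : ℕ} {M : Type*} [TopologicalSpace M]
    [ChartedSpace (EuclideanSpace ℝ (Fin d)) M] [IsManifold (𝓡 d) ∞ M]
    {b : P → M} {φ : ∀ p, TangentSpace (𝓡 d) (b p) →L[ℝ] TangentSpace (𝓡 d) (b p) →L[ℝ] ℝ}
    {X Y : ∀ p, TangentSpace (𝓡 d) (b p)} {p₀ : P}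
    (hφ : ContMDiffAt IP ((𝓡 d).prod
      𝓘(ℝ, EuclideanSpace ℝ (Fin d) →L[ℝ] EuclideanSpace ℝ (Fin d) →L[ℝ] ℝ)) ∞
      (fun p => (⟨b p, φ p⟩ : Bundle.TotalSpace
        (EuclideanSpace ℝ (Fin d) →L[ℝ] EuclideanSpace ℝ (Fin d) →L[ℝ] ℝ)
        (fun x : M => TangentSpace (𝓡 d) x →L[ℝ] TangentSpace (𝓡 d) x →L[ℝ] ℝ))) p₀)
    (hX : ContMDiffAt IP (𝓡 d).tangent ∞ (fun p => (⟨b p, X p⟩ : TangentBundle (𝓡 d) M)) p₀)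
    (hY : ContMDiffAt IP (𝓡 d).tangent ∞ (fun p => (⟨b p, Y p⟩ : TangentBundle (𝓡 d) M)) p₀) :
    ContMDiffAt IP 𝓘(ℝ, ℝ) ∞ (fun p => φ p (X p) (Y p)) p₀ := by
  have : ContMDiffAt IP ((𝓡 d).prod 𝓘(ℝ, ℝ)) ∞
      (fun p => TotalSpace.mk' ℝ (E := Bundle.Trivial M ℝ) (b p) (φ p (X p) (Y p))) p₀ :=
    ContMDiffAt.clm_bundle_apply₂ (F₁ := EuclideanSpace ℝ (Fin d))
      (F₂ := EuclideanSpace ℝ (Fin d)) hφ hX hY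
  rw [contMDiffAt_totalSpace] at this
  simpa using this.2

/-- A smooth field of endomorphisms applied to a smooth vector field along a map. -/
theorem contMDiffAt_endField_apply {d : ℕ} {M : Type*} [TopologicalSpace M]
    [ChartedSpace (EuclideanSpace ℝ (Fin d)) M] [IsManifold (𝓡 d) ∞ M]
    {b : P → M} {φ : ∀ p, TangentSpace (𝓡 d) (b p) →L[ℝ] TangentSpace (𝓡 d) (b p)}
    {X : ∀ p, TangentSpace (𝓡 d) (b p)} {p₀ : P}
    (hφ : ContMDiffAt IP ((𝓡 d).prod
      𝓘(ℝ, EuclideanSpace ℝ (Fin d) →L[ℝ] EuclideanSpace ℝ (Fin d))) ∞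
      (fun p => (⟨b p, φ p⟩ : Bundle.TotalSpace
        (EuclideanSpace ℝ (Fin d) →L[ℝ] EuclideanSpace ℝ (Fin d))
        (fun x : M => TangentSpace (𝓡 d) x →L[ℝ] TangentSpace (𝓡 d) x))) p₀)
    (hX : ContMDiffAt IP (𝓡 d).tangent ∞ (fun p => (⟨b p, X p⟩ : TangentBundle (𝓡 d) M)) p₀) :
    ContMDiffAt IP (𝓡 d).tangent ∞ (fun p => (⟨b p, φ p (X p)⟩ : TangentBundle (𝓡 d) M)) p₀ :=
  ContMDiffAt.clm_bundle_apply (F₁ := EuclideanSpace ℝ (Fin d))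
      (F₂ := EuclideanSpace ℝ (Fin d)) hφ hX

/-- Near every point of a manifold, the vectors of the model space extend to smooth vector fields
that represent the tangent vectors in the trivialization of the tangent bundle. -/
theorem contMDiffAt_trivialization_symm {d : ℕ} {M : Type*} [TopologicalSpace M]
    [ChartedSpace (EuclideanSpace ℝ (Fin d)) M] [IsManifold (𝓡 d) ∞ M] (z : M)
    (a : EuclideanSpace ℝ (Fin d)) :
    ContMDiffAt (𝓡 d) (𝓡 d).tangent ∞ (fun y => (⟨y,
      (trivializationAt (EuclideanSpace ℝ (Fin d)) (TangentSpace (𝓡 d) : M → Type _) z).symmL ℝ y a⟩ :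
        TangentBundle (𝓡 d) M)) z := by
  set e := trivializationAt (EuclideanSpace ℝ (Fin d)) (TangentSpace (𝓡 d) : M → Type _) z
  have hz : z ∈ e.baseSet := FiberBundle.mem_baseSet_trivializationAt' z
  rw [e.contMDiffAt_section_iff hz]
  refine (contMDiffAt_const (c := a)).congr_of_eventuallyEq ?_
  filter_upwards [e.open_baseSet.mem_nhds hz] with y hy
  rw [e.symmL_apply hy]
  exact congrArg Prod.snd (e.apply_mk_symm hy a)

/-- A family of linear maps on a finite-dimensional space is smooth if its values are. -/
theorem contMDiffAt_clm_of_apply {n : ℕ} {F : Type*} [NormedAddCommGroup F] [NormedSpace ℝ F]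
    {G : P → EuclideanSpace ℝ (Fin n) →L[ℝ] F} {p₀ : P}
    (h : ∀ a, ContMDiffAt IP 𝓘(ℝ, F) ∞ (fun p => G p a) p₀) :
    ContMDiffAt IP 𝓘(ℝ, EuclideanSpace ℝ (Fin n) →L[ℝ] F) ∞ G p₀ := by
  have hG : G = fun p => ∑ i : Fin n, ContinuousLinearMap.smulRightL ℝ
      (EuclideanSpace ℝ (Fin n)) F (EuclideanSpace.proj i) (G p (EuclideanSpace.single i 1)) := by
    funext p
    ext x
    conv_lhs => rw [← (EuclideanSpace.basisFun (Fin n) ℝ).sum_repr x]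
    simp [map_sum]
  rw [hG]
  refine ContMDiffAt.sum fun i _ => ?_
  exact (ContinuousLinearMap.contMDiff _).contMDiffAt.comp p₀ (h _)

theorem finrank_dual_euclidean (n : ℕ) :
    Module.finrank ℝ (EuclideanSpace ℝ (Fin n)) =
      Module.finrank ℝ (EuclideanSpace ℝ (Fin n) →L[ℝ] ℝ) :=
  (Subspace.dual_finrank_eq (K := ℝ) (V := EuclideanSpace ℝ (Fin n))).symm.trans
    (LinearMap.toContinuousLinearMap (𝕜 := ℝ) (E := EuclideanSpace ℝ (Fin n))
      (F' := ℝ)).finrank_eq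

theorem IsSymplecticForm.exists_dual {d : ℕ} {M : Type*} [TopologicalSpace M]
    [ChartedSpace (EuclideanSpace ℝ (Fin d)) M] [IsManifold (𝓡 d) ∞ M]
    {Ω : BilinField d M} (hΩ : IsSymplecticForm Ω) (z : M) (β : TangentSpace (𝓡 d) z →L[ℝ] ℝ) :
    ∃ v, Ω z v = β := by
  let A₀ : EuclideanSpace ℝ (Fin d) →L[ℝ] EuclideanSpace ℝ (Fin d) →L[ℝ] ℝ := Ω z
  let A : EuclideanSpace ℝ (Fin d) →ₗ[ℝ] (EuclideanSpace ℝ (Fin d) →L[ℝ] ℝ) := A₀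
  have hA : Function.Injective A := by
    rw [injective_iff_map_eq_zero]
    intro v hv
    exact hΩ.nondegenerate z v fun w => congrArg (fun l : EuclideanSpace ℝ (Fin d) →L[ℝ] ℝ => l w) hv
  exact (LinearMap.injective_iff_surjective_of_finrank_eq_finrank
    (finrank_dual_euclidean d)).1 hA β

/-- A vector field along a map is smooth if its pairings, by a symplectic form, with smooth vector
fields are smooth. -/
theorem contMDiffAt_of_pairing {d : ℕ} {M : Type*} [TopologicalSpace M]
    [ChartedSpace (EuclideanSpace ℝ (Fin d)) M] [IsManifold (𝓡 d) ∞ M]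
    {Ω : BilinField d M} (hΩ : IsSymplecticForm Ω)
    {b : P → M} {X : ∀ p, TangentSpace (𝓡 d) (b p)} {p₀ : P}
    (hb : ContMDiffAt IP (𝓡 d) ∞ b p₀)
    (h : ∀ W : ∀ y : M, TangentSpace (𝓡 d) y,
      ContMDiffAt (𝓡 d) (𝓡 d).tangent ∞ (fun y => (⟨y, W y⟩ : TangentBundle (𝓡 d) M)) (b p₀) →
      ContMDiffAt IP 𝓘(ℝ, ℝ) ∞ (fun p => Ω (b p) (X p) (W (b p))) p₀) :
    ContMDiffAt IP (𝓡 d).tangent ∞ (fun p => (⟨b p, X p⟩ : TangentBundle (𝓡 d) M)) p₀ := by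
  let E := EuclideanSpace ℝ (Fin d)
  set e := trivializationAt E (TangentSpace (𝓡 d) : M → Type _) (b p₀) with he
  have hz : b p₀ ∈ e.baseSet := FiberBundle.mem_baseSet_trivializationAt' (b p₀)
  have hev : ∀ᶠ p in 𝓝 p₀, b p ∈ e.baseSet :=
    hb.continuousAt.eventually (e.open_baseSet.mem_nhds hz)
  have hW (a : E) := (contMDiffAt_trivialization_symm (d := d) (M := M) (b p₀) a)
  have hWb (a : E) : ContMDiffAt IP (𝓡 d).tangent ∞
      (fun p => (⟨b p, e.symmL ℝ (b p) a⟩ : TangentBundle (𝓡 d) M)) p₀ := (hW a).comp p₀ hb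
  let T : P → E →L[ℝ] E := fun p => e.symmL ℝ (b p)
  -- In the trivialization, Ω becomes a family `G` of bilinear forms and the pairings with X a
  -- family `β` of covectors. So X is represented by `G⁻¹ β`, which is smooth because inversion is
  -- smooth at invertible maps.
  let G : P → E →L[ℝ] E →L[ℝ] ℝ := fun p =>
    (ContinuousLinearMap.compL ℝ E E ℝ).flip (T p) ∘L ((Ω (b p) : E →L[ℝ] E →L[ℝ] ℝ) ∘L (T p))
  have hGapp : ∀ p a c, G p a c = Ω (b p) (e.symmL ℝ (b p) a) (e.symmL ℝ (b p) c) := fun p a c => rfl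
  have hG : ContMDiffAt IP 𝓘(ℝ, E →L[ℝ] E →L[ℝ] ℝ) ∞ G p₀ := by
    refine contMDiffAt_clm_of_apply fun a => contMDiffAt_clm_of_apply fun c => ?_
    exact contMDiffAt_bilin_apply (φ := fun p => Ω (b p)) (X := fun p => e.symmL ℝ (b p) a)
      (Y := fun p => e.symmL ℝ (b p) c) ((hΩ.smooth (b p₀)).comp p₀ hb) (hWb a) (hWb c)
  let β : P → E →L[ℝ] ℝ := fun p => (Ω (b p) (X p) : E →L[ℝ] ℝ) ∘L (T p)
  have hβ : ContMDiffAt IP 𝓘(ℝ, E →L[ℝ] ℝ) ∞ β p₀ :=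
    contMDiffAt_clm_of_apply fun a => h _ (hW a)
  have hinj : ∀ p, b p ∈ e.baseSet → Function.Injective (G p) := by
    intro p hp
    rw [injective_iff_map_eq_zero]
    intro a ha
    have h0 : e.symm (b p) a = 0 := by
      refine hΩ.nondegenerate _ _ fun w => ?_
      have := congrArg (fun l => l ((e ⟨b p, w⟩).2)) ha
      simp only [hGapp] at this
      rwa [e.symmL_apply hp, e.symmL_apply hp, e.symm_apply_apply_mk hp] at this
    have h1 := e.apply_mk_symm hp a
    rw [h0] at h1
    have h2 : (e (⟨b p, (0 : TangentSpace (𝓡 d) (b p))⟩)).2 = (0 : E) := by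
      have := (e.continuousLinearEquivAt ℝ (b p) hp).map_zero
      simpa using this
    rw [h1] at h2
    exact h2
  let A : E ≃L[ℝ] (E →L[ℝ] ℝ) :=
    (LinearEquiv.ofInjectiveOfFinrankEq (G p₀ : E →ₗ[ℝ] (E →L[ℝ] ℝ)) (hinj p₀ hz)
      (finrank_dual_euclidean d)).toContinuousLinearEquiv
  have hA : (A : E →L[ℝ] (E →L[ℝ] ℝ)) = G p₀ := by ext a; rfl
  have hGev : ∀ᶠ p in 𝓝 p₀, (G p).inverse (β p) = (e ⟨b p, X p⟩).2 := by
    filter_upwards [hev, hG.continuousAt.eventually (by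
      have := A.nhds
      rwa [hA] at this)] with p hp ⟨B, hB⟩
    rw [← hB, ContinuousLinearMap.inverse_equiv]
    refine B.symm_apply_eq.2 ?_
    ext c
    rw [← B.coe_coe, hB, hGapp, e.symmL_apply hp, e.symmL_apply hp, e.symm_apply_apply_mk hp,
      ← e.symmL_apply (R := ℝ) hp]
    rfl
  rw [contMDiffAt_totalSpace]
  refine ⟨hb, ContMDiffAt.congr_of_eventuallyEq ?_ (hGev.mono fun p hp => hp.symm)⟩
  have h1 : ContDiffAt ℝ ∞ ContinuousLinearMap.inverse (G p₀) := hA ▸ contDiffAt_map_inverse A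
  exact (h1.contMDiffAt.comp p₀ hG).clm_apply hβ
end Smoothness

theorem two_le_infty : (2 : WithTop ℕ∞) ≤ ∞ := WithTop.coe_le_coe.2 le_top

/-! ### Naturality of the exterior derivative of a one-form -/

section Pullback

variable {d : ℕ} {N : Type*} [TopologicalSpace N] [ChartedSpace (EuclideanSpace ℝ (Fin d)) N]
  [IsManifold (𝓡 d) ∞ N]
  {V : Type*} [NormedAddCommGroup V] [NormedSpace ℝ V]

/-- The derivative of a smooth map on a vector space in a constant direction is a smooth vector
field along this map. -/
theorem contMDiffAt_mfderiv_const_apply {w : V → N} {p : V}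
    (hw : ContMDiffAt 𝓘(ℝ, V) (𝓡 d) ∞ w p) (a : V) :
    ContMDiffAt 𝓘(ℝ, V) (𝓡 d).tangent ∞
      (fun q => (⟨w q, mfderiv 𝓘(ℝ, V) (𝓡 d) w q a⟩ : TangentBundle (𝓡 d) N)) p := by
  refine contMDiffAt_mfderiv_apply (P := V) (N := V) (f := fun _ => w) (b := id)
    (X := fun _ => a) (hw.comp (p, p) contMDiffAt_snd) ?_
  exact contMDiffAt_vectorSpace_iff_contDiffAt.2 contDiffAt_const

/-- The coefficients of a one-form in the preferred chart at `x`. -/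
def coeffs (α : OneForm d N) (x : N) (y : EuclideanSpace ℝ (Fin d)) :
    EuclideanSpace ℝ (Fin d) →L[ℝ] ℝ :=
  (α ((extChartAt (𝓡 d) x).symm y)) ∘L
    (mfderiv 𝓘(ℝ, EuclideanSpace ℝ (Fin d)) (𝓡 d) (extChartAt (𝓡 d) x).symm y)

omit [IsManifold (𝓡 d) ∞ N] in
theorem coeffs_apply (α : OneForm d N) (x : N) (y a : EuclideanSpace ℝ (Fin d)) :
    coeffs α x y a = α ((extChartAt (𝓡 d) x).symm y) (coordField x a y) := rfl

theorem differentiableAt_coeffs {α : OneForm d N} (x : N)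
    (hα : ContMDiffAt (𝓡 d) ((𝓡 d).prod 𝓘(ℝ, EuclideanSpace ℝ (Fin d) →L[ℝ] ℝ)) ∞
      (fun x : N => (⟨x, α x⟩ : Bundle.TotalSpace (EuclideanSpace ℝ (Fin d) →L[ℝ] ℝ)
        (fun x : N => TangentSpace (𝓡 d) x →L[ℝ] ℝ))) x) :
    DifferentiableAt ℝ (coeffs α x) (extChartAt (𝓡 d) x x) := by
  have h1 : ContMDiffAt 𝓘(ℝ, EuclideanSpace ℝ (Fin d)) (𝓡 d) ∞ (extChartAt (𝓡 d) x).symm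
      (extChartAt (𝓡 d) x x) :=
    (contMDiffOn_extChartAt_symm x).contMDiffAt (extChartAt_target_mem_nhds x)
  have hx := extChartAt_to_inv (I := 𝓡 d) x
  have h2 : ContMDiffAt 𝓘(ℝ, EuclideanSpace ℝ (Fin d)) 𝓘(ℝ, EuclideanSpace ℝ (Fin d) →L[ℝ] ℝ) ∞
      (coeffs α x) (extChartAt (𝓡 d) x x) := by
    refine contMDiffAt_clm_of_apply fun a => ?_
    exact contMDiffAt_oneForm_apply (φ := fun y => α ((extChartAt (𝓡 d) x).symm y))
      (X := fun y => coordField x a y)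
      (ContMDiffAt.comp_of_eq hα h1 hx) (contMDiffAt_mfderiv_const_apply h1 a)
  exact h2.contDiffAt.differentiableAt (by simp)

/-- Evaluating at a fixed vector commutes with differentiation, so dα is the antisymmetrization of
one bilinear map. The linearity of dα in its arguments is read off from this form. -/
theorem dOne_eq_coeffs {α : OneForm d N} (x : N)
    (hα : ContMDiffAt (𝓡 d) ((𝓡 d).prod 𝓘(ℝ, EuclideanSpace ℝ (Fin d) →L[ℝ] ℝ)) ∞
      (fun x : N => (⟨x, α x⟩ : Bundle.TotalSpace (EuclideanSpace ℝ (Fin d) →L[ℝ] ℝ)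
        (fun x : N => TangentSpace (𝓡 d) x →L[ℝ] ℝ))) x) (v w : EuclideanSpace ℝ (Fin d)) :
    dOne α x v w = fderiv ℝ (coeffs α x) (extChartAt (𝓡 d) x x) v w
      - fderiv ℝ (coeffs α x) (extChartAt (𝓡 d) x x) w v := by
  have h := differentiableAt_coeffs x hα
  have h1 (a : EuclideanSpace ℝ (Fin d)) :
      fderiv ℝ (fun y => coeffs α x y a) (extChartAt (𝓡 d) x x)
        = (fderiv ℝ (coeffs α x) (extChartAt (𝓡 d) x x)).flip a := by
    rw [fderiv_clm_apply h (by fun_prop)]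
    ext; simp
  change fderiv ℝ (fun y => coeffs α x y w) _ v - fderiv ℝ (fun y => coeffs α x y v) _ w = _
  rw [h1, h1]
  rfl

theorem differentiableAt_oneForm_mfderiv {α : OneForm d N} {w : V → N} {p : V}
    (hα : ContMDiffAt (𝓡 d) ((𝓡 d).prod 𝓘(ℝ, EuclideanSpace ℝ (Fin d) →L[ℝ] ℝ)) ∞
      (fun x : N => (⟨x, α x⟩ : Bundle.TotalSpace (EuclideanSpace ℝ (Fin d) →L[ℝ] ℝ)
        (fun x : N => TangentSpace (𝓡 d) x →L[ℝ] ℝ))) (w p))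
    (hw : ContMDiffAt 𝓘(ℝ, V) (𝓡 d) ∞ w p) (a : V) :
    ContDiffAt ℝ ∞ (fun q => α (w q) (mfderiv 𝓘(ℝ, V) (𝓡 d) w q a)) p :=
  (contMDiffAt_oneForm_apply (φ := fun q => α (w q)) (hα.comp p hw)
    (contMDiffAt_mfderiv_const_apply hw a)).contDiffAt

omit [IsManifold (𝓡 d) ∞ N] in
theorem oneForm_congr (α : OneForm d N) {x y : N} (h : x = y) (v : EuclideanSpace ℝ (Fin d)) :
    α x v = α y v := by
  subst h; rfl

/-- The exterior derivative commutes with pullback by smooth maps from a vector space. -/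
theorem dOne_mfderiv {α : OneForm d N} {w : V → N} {p : V}
    (hα : ContMDiffAt (𝓡 d) ((𝓡 d).prod 𝓘(ℝ, EuclideanSpace ℝ (Fin d) →L[ℝ] ℝ)) ∞
      (fun x : N => (⟨x, α x⟩ : Bundle.TotalSpace (EuclideanSpace ℝ (Fin d) →L[ℝ] ℝ)
        (fun x : N => TangentSpace (𝓡 d) x →L[ℝ] ℝ))) (w p))
    (hw : ContMDiffAt 𝓘(ℝ, V) (𝓡 d) ∞ w p) (a b : V) :
    fderiv ℝ (fun q => α (w q) (mfderiv 𝓘(ℝ, V) (𝓡 d) w q b)) p a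
      - fderiv ℝ (fun q => α (w q) (mfderiv 𝓘(ℝ, V) (𝓡 d) w q a)) p b
    = dOne α (w p) (mfderiv 𝓘(ℝ, V) (𝓡 d) w p a) (mfderiv 𝓘(ℝ, V) (𝓡 d) w p b) := by
  set x := w p with hx
  set χ := extChartAt (𝓡 d) x with hχ
  let ŵ : V → EuclideanSpace ℝ (Fin d) := fun q => χ (w q)
  have hŵ : ContDiffAt ℝ ∞ ŵ p :=
    ((contMDiffAt_extChartAt (x := x)).comp_of_eq hw rfl).contDiffAt
  have hev : ∀ᶠ q in 𝓝 p, w q ∈ χ.source ∧ ContMDiffAt 𝓘(ℝ, V) (𝓡 d) 1 w q :=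
    (hw.continuousAt.eventually (extChartAt_source_mem_nhds x)).and
      ((contMDiffAt_iff_contMDiffAt_nhds (by simp)).1
        (ContMDiffAt.of_le (m := 1) hw (by simp)))
  -- Tangent vectors at `w p` are given by their coordinates in the chart preferred at this very
  -- point, so at `p` no change of charts enters.
  have hmf : mfderiv 𝓘(ℝ, V) (𝓡 d) w p = fderiv ℝ ŵ p := by
    rw [MDifferentiableAt.mfderiv (hw.mdifferentiableAt (by simp))]
    simp [writtenInExtChartAt, ŵ, hχ, hx, Function.comp_def, chartAt_self_eq]
    rfl
  -- At nearby points the preferred chart may be another one, so the pullback is written in the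
  -- fixed chart at `x` by factoring `w` through its inverse.
  have key : ∀ c : V, (fun q => α (w q) (mfderiv 𝓘(ℝ, V) (𝓡 d) w q c)) =ᶠ[𝓝 p]
      fun q => coeffs α x (ŵ q) (fderiv ℝ ŵ q c) := by
    intro c
    filter_upwards [hev.eventually_nhds] with q hq
    have hws := hq.self_of_nhds.1
    have hsymm : χ.symm (ŵ q) = w q := χ.left_inv hws
    have hwe : w =ᶠ[𝓝 q] χ.symm ∘ ŵ := by
      filter_upwards [hq] with q' hq'
      exact (χ.left_inv hq'.1).symm
    have hd1 : MDifferentiableAt 𝓘(ℝ, V) 𝓘(ℝ, EuclideanSpace ℝ (Fin d)) ŵ q := by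
      have h1 : MDifferentiableAt (𝓡 d) 𝓘(ℝ, EuclideanSpace ℝ (Fin d)) χ (w q) :=
        mdifferentiableAt_extChartAt (by simpa [hχ] using hws)
      exact h1.comp q (hq.self_of_nhds.2.mdifferentiableAt (by simp))
    have hd2 : MDifferentiableAt 𝓘(ℝ, EuclideanSpace ℝ (Fin d)) (𝓡 d) χ.symm (ŵ q) :=
      ((contMDiffOn_extChartAt_symm (n := ∞) x).contMDiffAt
        (extChartAt_target_mem_nhds' (χ.map_source hws))).mdifferentiableAt (by simp)
    have h2 : mfderiv 𝓘(ℝ, V) (𝓡 d) w q c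
        = mfderiv 𝓘(ℝ, EuclideanSpace ℝ (Fin d)) (𝓡 d) χ.symm (ŵ q) (fderiv ℝ ŵ q c) := by
      rw [hwe.mfderiv_eq, mfderiv_comp q hd2 hd1, mfderiv_eq_fderiv]
      rfl
    rw [coeffs_apply, coordField, h2]
    exact oneForm_congr α hsymm.symm _ 
  have hc := differentiableAt_coeffs x hα
  have hŵ2 : DifferentiableAt ℝ (fderiv ℝ ŵ) p :=
    (hŵ.fderiv_right (m := 1) (by rw [one_add_one_eq_two]; exact two_le_infty)).differentiableAt (by simp)
  have hcw : HasFDerivAt (fun q => coeffs α x (ŵ q))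
      ((fderiv ℝ (coeffs α x) (ŵ p)).comp (fderiv ℝ ŵ p)) p :=
    HasFDerivAt.comp p (f := ŵ) hc.hasFDerivAt (hŵ.differentiableAt (by simp)).hasFDerivAt
  have hder : ∀ c e : V, fderiv ℝ (fun q => α (w q) (mfderiv 𝓘(ℝ, V) (𝓡 d) w q c)) p e
      = fderiv ℝ (coeffs α x) (ŵ p) (fderiv ℝ ŵ p e) (fderiv ℝ ŵ p c)
        + coeffs α x (ŵ p) (fderiv ℝ (fderiv ℝ ŵ) p e c) := by
    intro c e
    have h3 : HasFDerivAt (fun q => fderiv ℝ ŵ q c) ((fderiv ℝ (fderiv ℝ ŵ) p).flip c) p := by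
      have := hŵ2.hasFDerivAt.clm_apply (hasFDerivAt_const c p)
      simpa using this
    rw [(key c).fderiv_eq, (hcw.clm_apply h3).fderiv]
    simp [add_comm]
  -- The second derivative of `ŵ` is the only term that is not the pullback of dα; being symmetric,
  -- it cancels in the difference.
  have hsym : fderiv ℝ (fderiv ℝ ŵ) p a b = fderiv ℝ (fderiv ℝ ŵ) p b a := by
    have := hŵ.isSymmSndFDerivAt (by simpa using two_le_infty)
    exact this a b
  have hd : dOne α x (fderiv ℝ ŵ p a) (fderiv ℝ ŵ p b)
      = dOne α x (mfderiv 𝓘(ℝ, V) (𝓡 d) w p a) (mfderiv 𝓘(ℝ, V) (𝓡 d) w p b) :=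
    congrArg (fun l : V →L[ℝ] EuclideanSpace ℝ (Fin d) => dOne α x (l a) (l b)) hmf.symm
  rw [hder, hder, hsym, ← hd, dOne_eq_coeffs x hα, add_sub_add_right_eq_sub]
end Pullback

/-! ### Pointwise algebra of Ω, α and dα -/

section ModelFibre

/-! Tangent spaces are the model space by definition. The following versions of the tensor fields are
stated on the model space. -/

variable {k : ℕ} {S : Type*} [TopologicalSpace S] [ChartedSpace (EuclideanSpace ℝ (Fin k)) S]

/-- The value of a one-form, on the model space. -/
def formAt (α : OneForm k S) (x : S) : EuclideanSpace ℝ (Fin k) →L[ℝ] ℝ := α x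

/-- The value of a bilinear form, on the model space. -/
def bilinAt (Ω : BilinField k S) (x : S) :
    EuclideanSpace ℝ (Fin k) →L[ℝ] EuclideanSpace ℝ (Fin k) →L[ℝ] ℝ := Ω x

/-- The value of an endomorphism field, on the model space. -/
def endAt (J : EndField k S) (x : S) :
    EuclideanSpace ℝ (Fin k) →L[ℝ] EuclideanSpace ℝ (Fin k) := J x

/-- The exterior derivative of a one-form, on the model space. -/
def extAt (α : OneForm k S) (x : S) (v w : EuclideanSpace ℝ (Fin k)) : ℝ := dOne α x v w

/-- The differential of a function, on the model space. -/
def diffAt (f : S → ℝ) (x : S) : EuclideanSpace ℝ (Fin k) →L[ℝ] ℝ := dfun f x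

/-- The Reeb vector field, in the model space. -/
def reebAt (α : OneForm k S) (x : S) : EuclideanSpace ℝ (Fin k) := reeb α x

/-- The contact vector field of a function, in the model space. -/
def contactAt (α : OneForm k S) (h : S → ℝ) (x : S) : EuclideanSpace ℝ (Fin k) :=
  contactField α h x

/-- The Hamiltonian vector field of a function, in the model space. -/
def hamAt (Ω : BilinField k S) (H : S → ℝ) (x : S) : EuclideanSpace ℝ (Fin k) := hamField Ω H x

theorem extAt_self (α : OneForm k S) (x : S) (v : EuclideanSpace ℝ (Fin k)) : extAt α x v v = 0 :=
  sub_self _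

theorem extAt_swap (α : OneForm k S) (x : S) (v w : EuclideanSpace ℝ (Fin k)) :
    extAt α x v w = - extAt α x w v :=
  (neg_sub _ _).symm

variable [IsManifold (𝓡 k) ∞ S]

theorem IsSymplecticForm.exists_bilinAt {Ω : BilinField k S} (hΩ : IsSymplecticForm Ω) (z : S)
    (β : EuclideanSpace ℝ (Fin k) →L[ℝ] ℝ) :
    ∃ v : EuclideanSpace ℝ (Fin k), ∀ w, bilinAt Ω z v w = β w := by
  obtain ⟨v, hv⟩ := hΩ.exists_dual z β
  exact ⟨v, fun w => DFunLike.congr_fun hv w⟩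

theorem IsSymplecticForm.bilinAt_hamAt {Ω : BilinField k S} (hΩ : IsSymplecticForm Ω) (H : S → ℝ)
    (z : S) (w : EuclideanSpace ℝ (Fin k)) : bilinAt Ω z (hamAt Ω H z) w = - diffAt H z w := by
  obtain ⟨v, hv⟩ := hΩ.exists_dual z (-(dfun H z))
  exact Classical.epsilon_spec (p := fun v : TangentSpace (𝓡 k) z =>
    ∀ w : TangentSpace (𝓡 k) z, Ω z v w = - dfun H z w) ⟨v, fun w => DFunLike.congr_fun hv w⟩ w

theorem IsSymplecticForm.eq_of_bilinAt_eq {Ω : BilinField k S} (hΩ : IsSymplecticForm Ω) {z : S}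
    {v v' : EuclideanSpace ℝ (Fin k)} (h : ∀ w, bilinAt Ω z v w = bilinAt Ω z v' w) : v = v' :=
  eq_of_sub_eq_zero (hΩ.nondegenerate z (v - v') fun (w : EuclideanSpace ℝ (Fin k)) => by
    change bilinAt Ω z (v - v') w = 0
    rw [map_sub, sub_apply, h, sub_self])

theorem IsSymplecticForm.bilinAt_swap {Ω : BilinField k S} (hΩ : IsSymplecticForm Ω) (z : S)
    (v w : EuclideanSpace ℝ (Fin k)) : bilinAt Ω z v w = - bilinAt Ω z w v := by
  have h0 (v : EuclideanSpace ℝ (Fin k)) : bilinAt Ω z v v = 0 := hΩ.alternating z v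
  have := h0 (v + w)
  simp only [map_add, add_apply, h0] at this
  linarith

variable {α : OneForm k S} (hα : IsContactForm α)
include hα

theorem IsContactForm.extAt_eq (x : S) (v w : EuclideanSpace ℝ (Fin k)) :
    extAt α x v w = fderiv ℝ (coeffs α x) (extChartAt (𝓡 k) x x) v w
      - fderiv ℝ (coeffs α x) (extChartAt (𝓡 k) x x) w v :=
  dOne_eq_coeffs x (hα.smooth x) v w

theorem IsContactForm.extAt_smul_left (x : S) (c : ℝ) (v w : EuclideanSpace ℝ (Fin k)) :
    extAt α x (c • v) w = c * extAt α x v w := by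
  simp only [hα.extAt_eq, map_smul, smul_apply, smul_eq_mul]
  ring

theorem IsContactForm.extAt_zero_left (x : S) (w : EuclideanSpace ℝ (Fin k)) :
    extAt α x 0 w = 0 := by
  have := hα.extAt_smul_left x 0 0 w
  simpa using this

theorem IsContactForm.extAt_zero_right (x : S) (w : EuclideanSpace ℝ (Fin k)) :
    extAt α x w 0 = 0 := by
  rw [extAt_swap, hα.extAt_zero_left, neg_zero]

end ModelFibre

/-! ### The end S × (rM, ∞): coordinates, Reeb field and contact fields -/

namespace ModelledAtInfinity

variable {k d : ℕ} {S M : Type*}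
  [TopologicalSpace S] [ChartedSpace (EuclideanSpace ℝ (Fin k)) S] [IsManifold (𝓡 k) ∞ S]
  [TopologicalSpace M] [ChartedSpace (EuclideanSpace ℝ (Fin d)) M] [IsManifold (𝓡 d) ∞ M]
  {α : OneForm k S} {Ω : BilinField d M} (D : ModelledAtInfinity α Ω)

/-- The first component of the identification with `S × (rM, ∞)`. -/
def base (z : M) : S := (D.chart z).1

/-- The second component of the identification with `S × (rM, ∞)`. -/
def radius (z : M) : ℝ := (D.chart z).2

/-- The point of `M` that corresponds to `(x, r)`. -/
def lift (x : S) (r : ℝ) : M := D.chart.symm (x, r)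

/-- The differential of `base`. -/
def dbase (z : M) : EuclideanSpace ℝ (Fin d) →L[ℝ] EuclideanSpace ℝ (Fin k) :=
  mfderiv (𝓡 d) (𝓡 k) (fun z => (D.chart z).1) z

/-- The differential of `radius`. -/
def dradius (z : M) : EuclideanSpace ℝ (Fin d) →L[ℝ] ℝ := dfun (fun z => (D.chart z).2) z

theorem isOpen_compl_core : IsOpen D.coreᶜ := D.source_eq ▸ D.chart.open_source

theorem contMDiffAt_chart {z : M} (hz : z ∉ D.core) :
    ContMDiffAt (𝓡 d) ((𝓡 k).prod 𝓘(ℝ, ℝ)) ∞ D.chart z :=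
  D.smooth_chart.contMDiffAt (D.chart.open_source.mem_nhds (D.source_eq ▸ hz))

theorem contMDiffAt_base {z : M} (hz : z ∉ D.core) : ContMDiffAt (𝓡 d) (𝓡 k) ∞ D.base z :=
  contMDiffAt_fst.comp z (D.contMDiffAt_chart hz)

theorem contMDiffAt_radius {z : M} (hz : z ∉ D.core) :
    ContMDiffAt (𝓡 d) 𝓘(ℝ, ℝ) ∞ D.radius z :=
  contMDiffAt_snd.comp z (D.contMDiffAt_chart hz)

theorem mem_target {x : S} {r : ℝ} (hr : D.rM < r) : (x, r) ∈ D.chart.target := by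
  rw [D.target_eq]; exact ⟨mem_univ _, hr⟩

theorem chart_lift {r : ℝ} (hr : D.rM < r) (x : S) : D.chart (D.lift x r) = (x, r) :=
  D.chart.right_inv (D.mem_target hr)

theorem base_lift {r : ℝ} (hr : D.rM < r) (x : S) : D.base (D.lift x r) = x := by
  rw [base, D.chart_lift hr]

theorem radius_lift {r : ℝ} (hr : D.rM < r) (x : S) : D.radius (D.lift x r) = r := by
  rw [radius, D.chart_lift hr]

theorem lift_notMem_core {r : ℝ} (hr : D.rM < r) (x : S) : D.lift x r ∉ D.core := by
  have := D.chart.map_target (D.mem_target (x := x) hr)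
  rwa [D.source_eq] at this

theorem lift_base_radius {z : M} (hz : z ∉ D.core) : D.lift (D.base z) (D.radius z) = z :=
  D.chart.left_inv (D.source_eq ▸ hz)

theorem rM_lt_radius {z : M} (hz : z ∉ D.core) : D.rM < D.radius z := by
  have := D.chart.map_source (D.source_eq ▸ hz : z ∈ D.chart.source)
  rw [D.target_eq] at this
  exact this.2

theorem contMDiffAt_lift {r : ℝ} (hr : D.rM < r) (x : S) :
    ContMDiffAt ((𝓡 k).prod 𝓘(ℝ, ℝ)) (𝓡 d) ∞ D.chart.symm (x, r) :=
  D.smooth_symm.contMDiffAt (D.chart.open_target.mem_nhds (D.mem_target hr))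

/-- Differentiating `chart ∘ chart.symm = id` gives a right inverse of the differential of the
chart. -/
theorem exists_dbase_dradius_lift {r : ℝ} (hr : D.rM < r) (x : S)
    (w : EuclideanSpace ℝ (Fin k)) (c : ℝ) :
    ∃ v, D.dbase (D.lift x r) v = w ∧ D.dradius (D.lift x r) v = c := by
  have h1 : MDifferentiableAt ((𝓡 k).prod 𝓘(ℝ, ℝ)) (𝓡 d) D.chart.symm (x, r) :=
    (D.contMDiffAt_lift hr _).mdifferentiableAt (by simp)
  have hz := D.lift_notMem_core hr x
  have h2 : MDifferentiableAt (𝓡 d) (𝓡 k) D.base (D.chart.symm (x, r)) :=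
    (D.contMDiffAt_base hz).mdifferentiableAt (by simp)
  have h3 : MDifferentiableAt (𝓡 d) 𝓘(ℝ, ℝ) D.radius (D.chart.symm (x, r)) :=
    (D.contMDiffAt_radius hz).mdifferentiableAt (by simp)
  have ht := D.chart.open_target.mem_nhds (D.mem_target (x := x) hr)
  have h4 : (D.base ∘ D.chart.symm) =ᶠ[𝓝 (x, r)] Prod.fst := by
    filter_upwards [ht] with p hp
    exact congrArg Prod.fst (D.chart.right_inv hp)
  have h5 : (D.radius ∘ D.chart.symm) =ᶠ[𝓝 (x, r)] Prod.snd := by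
    filter_upwards [ht] with p hp
    exact congrArg Prod.snd (D.chart.right_inv hp)
  have h6 := mfderiv_comp (x, r) h2 h1
  have h7 := mfderiv_comp (x, r) h3 h1
  rw [h4.mfderiv_eq, mfderiv_fst] at h6
  rw [h5.mfderiv_eq, mfderiv_snd] at h7
  exact ⟨mfderiv ((𝓡 k).prod 𝓘(ℝ, ℝ)) (𝓡 d) D.chart.symm (x, r)
      ((w, c) : EuclideanSpace ℝ (Fin k) × ℝ),
    (DFunLike.congr_fun h6 ((w, c) : EuclideanSpace ℝ (Fin k) × ℝ)).symm,
    (DFunLike.congr_fun h7 ((w, c) : EuclideanSpace ℝ (Fin k) × ℝ)).symm⟩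

theorem exists_dbase_dradius {z : M} (hz : z ∉ D.core) (w : EuclideanSpace ℝ (Fin k)) (c : ℝ) :
    ∃ v, D.dbase z v = w ∧ D.dradius z v = c := by
  rw [← D.lift_base_radius hz]
  exact D.exists_dbase_dradius_lift (D.rM_lt_radius hz) _ w c

/-- The base point is a separate variable because the base of `D.lift x r` is `x` only up to a
proof, while tangent vectors depend on the point in their type. -/
theorem bilinAt_eq {z : M} (hz : z ∉ D.core) {x : S} (hx : D.base z = x)
    (v w : EuclideanSpace ℝ (Fin d)) :
    bilinAt Ω z v w = D.dradius z v * formAt α x (D.dbase z w)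
      - D.dradius z w * formAt α x (D.dbase z v)
      + D.radius z * extAt α x (D.dbase z v) (D.dbase z w) := by
  subst hx
  exact (D.symplectic z hz v w).symm

section ContactField

variable (hα : IsContactForm α) (hΩ : IsSymplecticForm Ω)
include D hα hΩ

/-- The Hamiltonian vector field of the function r, at a point with r = 2, projects to the Reeb
field. Existence thus comes from the nondegeneracy of Ω: testing against ∂_r gives α = 1, and
testing against horizontal vectors gives the condition on dα once the radial component is seen to
vanish. -/
theorem exists_reeb (x : S) : ∃ v, formAt α x v = 1 ∧ ∀ w, extAt α x v w = 0 := by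
  have hr : D.rM < 2 := by linarith [D.rM_lt_one]
  have hz := D.lift_notMem_core hr x
  have hx := D.base_lift hr x
  obtain ⟨v, hv'⟩ := hΩ.exists_bilinAt (D.lift x 2) (-(D.dradius (D.lift x 2)))
  simp only [D.bilinAt_eq hz hx, D.radius_lift hr, neg_apply] at hv'
  have h1 : formAt α x (D.dbase (D.lift x 2) v) = 1 := by
    obtain ⟨u, hu1, hu2⟩ := D.exists_dbase_dradius hz 0 1
    have := hv' u
    rw [hu1, hu2, map_zero, hα.extAt_zero_right] at this
    linarith
  have h2 : ∀ w, D.dradius (D.lift x 2) v * formAt α x w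
      + 2 * extAt α x (D.dbase (D.lift x 2) v) w = 0 := by
    intro w
    obtain ⟨u, hu1, hu2⟩ := D.exists_dbase_dradius hz w 0
    have := hv' u
    rw [hu1, hu2] at this
    linarith
  have h3 : D.dradius (D.lift x 2) v = 0 := by
    have := h2 (D.dbase (D.lift x 2) v)
    rw [extAt_self, h1] at this
    linarith
  refine ⟨D.dbase (D.lift x 2) v, h1, fun w => ?_⟩
  have := h2 w
  rw [h3] at this
  linarith

theorem reebAt_spec (x : S) :
    formAt α x (reebAt α x) = 1 ∧ ∀ w, extAt α x (reebAt α x) w = 0 :=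
  Classical.epsilon_spec (p := fun v : TangentSpace (𝓡 k) x => α x v = 1 ∧
    ∀ w : TangentSpace (𝓡 k) x, dOne α x v w = 0) (D.exists_reeb hα hΩ x)

/-- As for the Reeb field: the required vector is the projection of the Hamiltonian vector field of
r h at r = 2. Only the value `c` of h and its differential `η` enter. -/
theorem exists_contact (c : ℝ) (x : S) (η : EuclideanSpace ℝ (Fin k) →L[ℝ] ℝ) :
    ∃ v, formAt α x v = c ∧ ∀ w, extAt α x v w = η (reebAt α x) * formAt α x w - η w := by
  have hr : D.rM < 2 := by linarith [D.rM_lt_one]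
  have hz := D.lift_notMem_core hr x
  have hx := D.base_lift hr x
  obtain ⟨v, hv⟩ := hΩ.exists_bilinAt (D.lift x 2)
    (-(c • D.dradius (D.lift x 2) + (2 : ℝ) • (η ∘L D.dbase (D.lift x 2))))
  have hv' (w : EuclideanSpace ℝ (Fin d)) : bilinAt Ω (D.lift x 2) v w
      = -(c * D.dradius (D.lift x 2) w + 2 * η (D.dbase (D.lift x 2) w)) :=
    hv w
  simp only [D.bilinAt_eq hz hx, D.radius_lift hr] at hv'
  have h1 : formAt α x (D.dbase (D.lift x 2) v) = c := by
    obtain ⟨u, hu1, hu2⟩ := D.exists_dbase_dradius hz 0 1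
    have := hv' u
    rw [hu1, hu2, map_zero, map_zero, hα.extAt_zero_right] at this
    linarith
  have h2 : ∀ w, D.dradius (D.lift x 2) v * formAt α x w
      + 2 * extAt α x (D.dbase (D.lift x 2) v) w = - (2 * η w) := by
    intro w
    obtain ⟨u, hu1, hu2⟩ := D.exists_dbase_dradius hz w 0
    have := hv' u
    rw [hu1, hu2] at this
    linarith
  obtain ⟨hR1, hR2⟩ := D.reebAt_spec hα hΩ x
  have h3 : D.dradius (D.lift x 2) v = - (2 * η (reebAt α x)) := by
    have := h2 (reebAt α x)
    rw [extAt_swap, hR2, hR1] at this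
    linarith
  refine ⟨D.dbase (D.lift x 2) v, h1, fun w => ?_⟩
  have := h2 w
  rw [h3] at this
  linarith

theorem contactAt_spec (h : S → ℝ) (x : S) :
    formAt α x (contactAt α h x) = h x ∧ ∀ w, extAt α x (contactAt α h x) w
      = diffAt h x (reebAt α x) * formAt α x w - diffAt h x w :=
  Classical.epsilon_spec (p := fun v : TangentSpace (𝓡 k) x => α x v = h x ∧
    ∀ w : TangentSpace (𝓡 k) x, dOne α x v w = dfun h x (reeb α x) * α x w - dfun h x w)
    (D.exists_contact hα hΩ (h x) x (diffAt h x))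

/-- Insert X_h into its own defining equation; dα(X_h, X_h) = 0. -/
theorem diffAt_contactAt_self (h : S → ℝ) (x : S) :
    diffAt h x (contactAt α h x) = diffAt h x (reebAt α x) * h x := by
  obtain ⟨h3, h4⟩ := D.contactAt_spec hα hΩ h x
  have := h4 (contactAt α h x)
  rw [extAt_self, h3] at this
  linarith

end ContactField

/-- The differential of `radius * φ ∘ base`. -/
theorem diffAt_homogeneous {φ : S → ℝ} {z : M} (hz : z ∉ D.core) {x : S} (hx : D.base z = x)
    (hφ : MDifferentiableAt (𝓡 k) 𝓘(ℝ, ℝ) φ x) (v : EuclideanSpace ℝ (Fin d)) :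
    diffAt (fun z => D.radius z * φ (D.base z)) z v
      = D.dradius z v * φ x + D.radius z * diffAt φ x (D.dbase z v) := by
  subst hx
  have h1 : MDifferentiableAt (𝓡 d) (𝓡 k) D.base z :=
    (D.contMDiffAt_base hz).mdifferentiableAt (by simp)
  have h2 : MDifferentiableAt (𝓡 d) 𝓘(ℝ, ℝ) D.radius z :=
    (D.contMDiffAt_radius hz).mdifferentiableAt (by simp)
  have h3 : HasMFDerivAt (𝓡 d) 𝓘(ℝ, ℝ) (φ ∘ D.base) z _ := hφ.hasMFDerivAt.comp z h1.hasMFDerivAt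
  have h4 := (h2.hasMFDerivAt.mul h3).mfderiv
  have h5 := DFunLike.congr_fun h4 v
  refine Eq.trans h5 ?_
  change D.radius z * diffAt φ (D.base z) (D.dbase z v) + φ (D.base z) * D.dradius z v = _
  ring

end ModelledAtInfinity

/-! ### Hamiltonian fields and twisted SFT-type structures on the end -/

namespace ModelledAtInfinity

variable {k d : ℕ} {S M : Type*}
  [TopologicalSpace S] [ChartedSpace (EuclideanSpace ℝ (Fin k)) S] [IsManifold (𝓡 k) ∞ S]
  [TopologicalSpace M] [ChartedSpace (EuclideanSpace ℝ (Fin d)) M] [IsManifold (𝓡 d) ∞ M]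
  {α : OneForm k S} {Ω : BilinField d M} (D : ModelledAtInfinity α Ω)

theorem radius_pos {z : M} (hz : z ∉ D.core) : 0 < D.radius z :=
  D.rM_pos.trans (D.rM_lt_radius hz)

section Hamiltonian

variable (hα : IsContactForm α) (hΩ : IsSymplecticForm Ω)
include hα hΩ

/-- The lift X_h - dh(R) Y has the required pairings with all vectors, so nondegeneracy of Ω
identifies it with X_H. The hypothesis concerns only dH, so that an additive constant in H plays no
role. -/
theorem dbase_dradius_hamAt {H : M → ℝ} {h : S → ℝ} {z : M} (hz : z ∉ D.core) {x : S}
    (hx : D.base z = x)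
    (hH : ∀ v, diffAt H z v = D.dradius z v * h x + D.radius z * diffAt h x (D.dbase z v)) :
    D.dbase z (hamAt Ω H z) = contactAt α h x ∧
      D.dradius z (hamAt Ω H z) = - (diffAt h x (reebAt α x) * D.radius z) := by
  obtain ⟨u, hu1, hu2⟩ := D.exists_dbase_dradius hz (contactAt α h x)
    (- (diffAt h x (reebAt α x) * D.radius z))
  obtain ⟨h3, h4⟩ := D.contactAt_spec hα hΩ h x
  have : u = hamAt Ω H z := by
    refine hΩ.eq_of_bilinAt_eq (z := z) fun w => ?_
    rw [hΩ.bilinAt_hamAt, hH, D.bilinAt_eq hz hx, hu1, hu2, h3, h4]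
    ring
  rw [← this]
  exact ⟨hu1, hu2⟩

end Hamiltonian

/-- The first component of the almost complex structure of twisted SFT-type, applied to the vector
with first component `w` and logarithmic second component `c`. -/
def twistBase (α : OneForm k S) (q : S → ℝ) (j : EndField k S) (x : S)
    (w : EuclideanSpace ℝ (Fin k)) (c : ℝ) : EuclideanSpace ℝ (Fin k) :=
  let a := formAt α x w / q x
  let w₀ := w - a • contactAt α q x
  let b := c + a * diffAt q x (reebAt α x) + diffAt q x w₀ / q x
  endAt j x w₀ - b • contactAt α q x

/-- The logarithmic second component of the almost complex structure of twisted SFT-type, applied to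
the vector with first component `w` and logarithmic second component `c`. -/
def twistRadius (α : OneForm k S) (q : S → ℝ) (j : EndField k S) (x : S)
    (w : EuclideanSpace ℝ (Fin k)) (c : ℝ) : ℝ :=
  let a := formAt α x w / q x
  let w₀ := w - a • contactAt α q x
  let b := c + a * diffAt q x (reebAt α x) + diffAt q x w₀ / q x
  b * diffAt q x (reebAt α x) + a - diffAt q x (endAt j x w₀) / q x

section Twisted

variable (hα : IsContactForm α) (hΩ : IsSymplecticForm Ω)
  {rJ : ℝ} {q : S → ℝ} {j : EndField k S} {J : EndField d M}
  (hJ : D.IsTwistedSFT rJ q j J)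
  {z : M} (hz : z ∈ D.endSet rJ) {x : S} (hx : D.base z = x) (hq : 0 < q x)
include hα hΩ hJ hz hx hq

/-- Decompose a vector into X_Q, Y and ζ_Q(ξ): since α(X_q) = q, the coefficient of X_Q is α(w) / q,
the rest of the horizontal part lies in ξ, and the radial component determines the coefficient of Y.
Expressed by dr / r instead of dr, the result does not depend on r. -/
theorem twisted_apply (v : EuclideanSpace ℝ (Fin d)) :
    D.dbase z (endAt J z v) = twistBase α q j x (D.dbase z v) (D.dradius z v / D.radius z) ∧
    D.dradius z (endAt J z v)
      = D.radius z * twistRadius α q j x (D.dbase z v) (D.dradius z v / D.radius z) := by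
  subst hx
  have hR := D.radius_pos hz.1
  obtain ⟨h3, h4⟩ := D.contactAt_spec hα hΩ q (D.base z)
  set x := D.base z with hx
  let a := formAt α x (D.dbase z v) / q x
  let w₀ := D.dbase z v - a • contactAt α q x
  let b := D.dradius z v / D.radius z + a * diffAt q x (reebAt α x) + diffAt q x w₀ / q x
  have h0 : formAt α x w₀ = 0 := by
    simp only [w₀, map_sub, map_smul, h3, a, smul_eq_mul]
    field_simp
    ring
  have key := hJ z hz v a b w₀ h0 (by
    refine Prod.ext ?_ ?_
    · change D.dbase z v = a • contactAt α q x + b • (0 : EuclideanSpace ℝ (Fin k)) + w₀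
      simp [w₀]
    · change D.dradius z v = a * (-(diffAt q x (reebAt α x) * D.radius z)) + b * D.radius z
        + -(D.radius z * diffAt q x w₀ / q x)
      simp only [b]
      field_simp
      ring)
  have k1 := congrArg Prod.fst key
  have k2 := congrArg Prod.snd key
  constructor
  · change D.dbase z (endAt J z v) = -(b • contactAt α q x) + a • (0 : EuclideanSpace ℝ (Fin k))
      + endAt j x w₀ at k1
    rw [k1, smul_zero, add_zero, neg_add_eq_sub]
    rfl
  · change D.dradius z (endAt J z v) = -(b * (-(diffAt q x (reebAt α x) * D.radius z)))
      + a * D.radius z + -(D.radius z * diffAt q x (endAt j x w₀) / q x) at k2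
    rw [k2]
    change _ = D.radius z * (b * diffAt q x (reebAt α x) + a - diffAt q x (endAt j x w₀) / q x)
    field_simp
    ring

/-- The differential of `Q = r q` satisfies `dQ ∘ J = r α`. -/
theorem diff_comp_twisted (v : EuclideanSpace ℝ (Fin d)) :
    D.dradius z (endAt J z v) * q x + D.radius z * diffAt q x (D.dbase z (endAt J z v))
      = D.radius z * formAt α x (D.dbase z v) := by
  obtain ⟨h1, h2⟩ := D.twisted_apply hα hΩ hJ hz hx hq v
  rw [h1, h2]
  simp only [twistBase, twistRadius, map_sub, map_smul, smul_eq_mul,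
    D.diffAt_contactAt_self hα hΩ]
  field_simp
  ring

/-- The square of the norm of the Liouville vector field is `r q`. -/
theorem bilinAt_twisted_liouville {v : EuclideanSpace ℝ (Fin d)} (hv1 : D.dbase z v = 0)
    (hv2 : D.dradius z v = D.radius z) :
    bilinAt Ω z (endAt J z v) v = D.radius z * q x := by
  have hR := D.radius_pos hz.1
  obtain ⟨h1, h2⟩ := D.twisted_apply hα hΩ hJ hz hx hq v
  rw [D.bilinAt_eq hz.1 hx, h1, h2, hv1, hv2, div_self hR.ne']
  simp [twistBase, hα.extAt_zero_right, (D.contactAt_spec hα hΩ q x).1]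

/-- The square of the norm of a vector is one-homogeneous in the radius. -/
theorem bilinAt_twisted (v : EuclideanSpace ℝ (Fin d)) :
    bilinAt Ω z (endAt J z v) v = D.radius z *
      (twistRadius α q j x (D.dbase z v) (D.dradius z v / D.radius z) * formAt α x (D.dbase z v)
      - D.dradius z v / D.radius z
        * formAt α x (twistBase α q j x (D.dbase z v) (D.dradius z v / D.radius z))
      + extAt α x (twistBase α q j x (D.dbase z v) (D.dradius z v / D.radius z))
        (D.dbase z v)) := by
  have hR := D.radius_pos hz.1
  obtain ⟨h1, h2⟩ := D.twisted_apply hα hΩ hJ hz hx hq v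
  rw [D.bilinAt_eq hz.1 hx, h1, h2]
  field_simp

end Twisted

end ModelledAtInfinity

/-! ### Families that depend on s and t -/

/-- The model of `ℝ × ℝ × N`, for a manifold `N` modelled on `ℝⁿ`. -/
abbrev paramModel (n : ℕ) := 𝓘(ℝ, ℝ).prod (𝓘(ℝ, ℝ).prod (𝓡 n))

/-- A family depending on `s` and `t` that is one-periodic in `t` and does not depend on `s` for
`s < 0` and for `1 < s`. -/
structure Tame {X : Type*} (φ : ℝ → ℝ → X) : Prop where
  neg : ∀ s < 0, ∀ t, φ s t = φ (-1) t
  pos : ∀ s, 1 < s → ∀ t, φ s t = φ 2 t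
  periodic : ∀ s t, φ s (t + 1) = φ s t

/-- The parameter in `[-1, 2]` at which a tame family takes the same value as at `s`. -/
def clampParam (s : ℝ) : ℝ := if s < 0 then -1 else if 1 < s then 2 else s

theorem clampParam_mem (s : ℝ) : clampParam s ∈ Icc (-1 : ℝ) 2 := by
  unfold clampParam
  split_ifs <;> constructor <;> linarith

namespace Tame

variable {X Y Z : Type*} {φ : ℝ → ℝ → X} {ψ : ℝ → ℝ → Y}

/-- This replaces the noncompact range of (s, t) by [-1, 2] × [0, 1]. -/
theorem eq_clamp (hφ : Tame φ) (s t : ℝ) : φ s t = φ (clampParam s) (Int.fract t) := by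
  have h1 : φ s t = φ (clampParam s) t := by
    unfold clampParam
    split_ifs with h h'
    · exact hφ.neg s h t
    · exact hφ.pos s h' t
    · rfl
  have h2 : Function.Periodic (φ (clampParam s)) 1 := hφ.periodic _
  have h3 := h2.sub_int_mul_eq (x := t) ⌊t⌋
  rw [mul_one, Int.self_sub_floor] at h3
  rw [h1, h3]

theorem map₂ (hφ : Tame φ) (hψ : Tame ψ) (G : X → Y → Z) : Tame fun s t => G (φ s t) (ψ s t) where
  neg s hs t := by rw [hφ.neg s hs, hψ.neg s hs]
  pos s hs t := by rw [hφ.pos s hs, hψ.pos s hs]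
  periodic s t := by rw [hφ.periodic, hψ.periodic]

theorem map (hφ : Tame φ) (G : X → Z) : Tame fun s t => G (φ s t) := hφ.map₂ hφ fun x _ => G x

theorem const (x : X) : Tame fun _ _ => x := ⟨fun _ _ _ => rfl, fun _ _ _ => rfl, fun _ _ => rfl⟩

theorem of_const {φ : ℝ → ℝ → X} (h0 : ∀ s ≤ 0, φ s = φ 0) (h1 : ∀ s, 1 ≤ s → φ s = φ 1)
    (hp : ∀ s t, φ s (t + 1) = φ s t) : Tame φ where
  neg s hs t := by rw [h0 s hs.le, h0 (-1) (by norm_num)]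
  pos s hs t := by rw [h1 s hs.le, h1 2 (by norm_num)]
  periodic := hp

variable {S : Type*}

/-- For s < 0 and for s > 1 the family is locally constant in s, so the derivative vanishes there.
The strict inequalities in `Tame`, with the reference parameters -1 and 2, make the class stable
under ∂_s without an argument at s = 0 and s = 1. -/
theorem deriv_fst {φ : ℝ → ℝ → S → ℝ} (hφ : Tame φ) :
    Tame fun s t x => deriv (fun σ => φ σ t x) s := by
  have hneg : ∀ s < 0, ∀ t x, deriv (fun σ => φ σ t x) s = 0 := fun s hs t x => by
    have : (fun σ => φ σ t x) =ᶠ[𝓝 s] fun _ => φ (-1) t x := by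
      filter_upwards [Iio_mem_nhds hs] with σ hσ
      rw [hφ.neg σ hσ]
    rw [this.deriv_eq, deriv_const]
  have hpos : ∀ s, 1 < s → ∀ t x, deriv (fun σ => φ σ t x) s = 0 := fun s hs t x => by
    have : (fun σ => φ σ t x) =ᶠ[𝓝 s] fun _ => φ 2 t x := by
      filter_upwards [Ioi_mem_nhds hs] with σ hσ
      rw [hφ.pos σ hσ]
    rw [this.deriv_eq, deriv_const]
  refine ⟨fun s hs t => ?_, fun s hs t => ?_, fun s t => ?_⟩
  · funext x; rw [hneg s hs, hneg (-1) (by norm_num)]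
  · funext x; rw [hpos s hs, hpos 2 (by norm_num)]
  · funext x; simp only [hφ.periodic]

theorem deriv_snd {φ : ℝ → ℝ → S → ℝ} (hφ : Tame φ) :
    Tame fun s t x => deriv (fun τ => φ s τ x) t := by
  refine ⟨fun s hs t => ?_, fun s hs t => ?_, fun s t => ?_⟩
  · funext x; simp only [hφ.neg s hs]
  · funext x; simp only [hφ.pos s hs]
  · funext x
    rw [← deriv_comp_add_const]
    simp only [hφ.periodic]

theorem exists_bound [TopologicalSpace S] [CompactSpace S] {φ : ℝ → ℝ → S → ℝ} (hφ : Tame φ)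
    (hc : Continuous fun p : ℝ × ℝ × S => φ p.1 p.2.1 p.2.2) :
    ∃ C : ℝ, 0 < C ∧ ∀ s t x, |φ s t x| ≤ C := by
  obtain ⟨C, hC⟩ := ((isCompact_Icc (a := (-1 : ℝ)) (b := 2)).prod
    ((isCompact_Icc (a := (0 : ℝ)) (b := 1)).prod (isCompact_univ (X := S)))).exists_bound_of_continuousOn
    hc.continuousOn
  refine ⟨max C 1, by positivity, fun s t x => ?_⟩
  rw [hφ.eq_clamp s t]
  exact (hC (clampParam s, Int.fract t, x) ⟨clampParam_mem s,
    ⟨Int.fract_nonneg t, (Int.fract_lt_one t).le⟩, mem_univ _⟩).trans (le_max_left _ _)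

end Tame

section ParamSmooth

variable {n : ℕ} {S : Type*} [TopologicalSpace S] [ChartedSpace (EuclideanSpace ℝ (Fin n)) S]
  [IsManifold (𝓡 n) ∞ S]

/-- Smooth families of functions, depending on two parameters. -/
def SmoothFamily (n : ℕ) {S : Type*} [TopologicalSpace S]
    [ChartedSpace (EuclideanSpace ℝ (Fin n)) S] (φ : ℝ → ℝ → S → ℝ) : Prop :=
  ContMDiff (paramModel n) 𝓘(ℝ, ℝ) ∞ fun p : ℝ × ℝ × S => φ p.1 p.2.1 p.2.2

namespace SmoothFamily

variable {φ ψ : ℝ → ℝ → S → ℝ}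

theorem continuous (hφ : SmoothFamily n φ) : Continuous fun p : ℝ × ℝ × S => φ p.1 p.2.1 p.2.2 :=
  ContMDiff.continuous hφ

theorem add (hφ : SmoothFamily n φ) (hψ : SmoothFamily n ψ) :
    SmoothFamily n fun s t x => φ s t x + ψ s t x := ContMDiff.add hφ hψ

theorem slice (hφ : SmoothFamily n φ) (s t : ℝ) : ContMDiff (𝓡 n) 𝓘(ℝ, ℝ) ∞ (φ s t) :=
  ContMDiff.comp (g := fun p : ℝ × ℝ × S => φ p.1 p.2.1 p.2.2) (f := fun x : S => (s, t, x)) hφ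
    (contMDiff_const.prodMk (contMDiff_const.prodMk contMDiff_id))

theorem deriv_fst (hφ : SmoothFamily n φ) : SmoothFamily n fun s t x => deriv (fun σ => φ σ t x) s := by
  intro p₀
  have h := contMDiffAt_mfderiv_apply_real (IP := paramModel n) (P := ℝ × ℝ × S) (N := ℝ)
    (IN := 𝓘(ℝ, ℝ)) (f := fun p σ => φ σ p.2.1 p.2.2) (b := fun p => p.1) (X := fun _ => (1 : ℝ))
    (p₀ := p₀) ?_ ?_
  · simp only [mfderiv_eq_fderiv] at h
    exact h
  · have h1 : ContMDiff ((paramModel n).prod 𝓘(ℝ, ℝ)) (paramModel n) ∞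
        (fun p : (ℝ × ℝ × S) × ℝ => ((p.2, p.1.2.1, p.1.2.2) : ℝ × ℝ × S)) :=
      contMDiff_snd.prodMk (contMDiff_snd.comp contMDiff_fst)
    exact (ContMDiff.comp hφ h1).contMDiffAt
  · rw [contMDiffAt_totalSpace]
    exact ⟨contMDiffAt_fst, by simpa using contMDiffAt_const⟩

theorem deriv_snd (hφ : SmoothFamily n φ) : SmoothFamily n fun s t x => deriv (fun τ => φ s τ x) t := by
  intro p₀
  have h := contMDiffAt_mfderiv_apply_real (IP := paramModel n) (P := ℝ × ℝ × S) (N := ℝ)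
    (IN := 𝓘(ℝ, ℝ)) (f := fun p τ => φ p.1 τ p.2.2) (b := fun p => p.2.1) (X := fun _ => (1 : ℝ))
    (p₀ := p₀) ?_ ?_
  · simp only [mfderiv_eq_fderiv] at h
    exact h
  · have h1 : ContMDiff ((paramModel n).prod 𝓘(ℝ, ℝ)) (paramModel n) ∞
        (fun p : (ℝ × ℝ × S) × ℝ => ((p.1.1, p.2, p.1.2.2) : ℝ × ℝ × S)) :=
      (contMDiff_fst.comp contMDiff_fst).prodMk
        (contMDiff_snd.prodMk (contMDiff_snd.comp (contMDiff_snd.comp contMDiff_fst)))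
    exact (ContMDiff.comp hφ h1).contMDiffAt
  · rw [contMDiffAt_totalSpace]
    exact ⟨contMDiffAt_fst.comp p₀ contMDiffAt_snd, by simpa using contMDiffAt_const⟩

end SmoothFamily

end ParamSmooth

/-! ### Smoothness of Hamiltonian vector fields -/

section SmoothHam

variable {d : ℕ} {M : Type*}
  [TopologicalSpace M] [ChartedSpace (EuclideanSpace ℝ (Fin d)) M] [IsManifold (𝓡 d) ∞ M]
  {Ω : BilinField d M}

/-- The Hamiltonian vector fields of a smooth family of functions are smooth. -/
theorem IsSymplecticForm.contMDiffAt_hamField (hΩ : IsSymplecticForm Ω) {F : ℝ → ℝ → M → ℝ}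
    {p₀ : ℝ × ℝ × M}
    (hF : ContMDiffAt (paramModel d) 𝓘(ℝ, ℝ) ∞ (fun p : ℝ × ℝ × M => F p.1 p.2.1 p.2.2) p₀) :
    ContMDiffAt (paramModel d) (𝓡 d).tangent ∞ (fun p : ℝ × ℝ × M =>
      (⟨p.2.2, hamField Ω (F p.1 p.2.1) p.2.2⟩ : TangentBundle (𝓡 d) M)) p₀ := by
  have hb : ContMDiffAt (paramModel d) (𝓡 d) ∞ (fun p : ℝ × ℝ × M => p.2.2) p₀ :=
    contMDiffAt_snd.comp p₀ contMDiffAt_snd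
  refine contMDiffAt_of_pairing hΩ hb fun W hW => ?_
  have h1 := contMDiffAt_mfderiv_apply_real (IP := paramModel d) (P := ℝ × ℝ × M) (N := M)
    (IN := 𝓡 d) (f := fun p z => F p.1 p.2.1 z) (b := fun p => p.2.2) (X := fun p => W p.2.2)
    (p₀ := p₀) ?_ (hW.comp p₀ hb)
  · refine (ContMDiffAt.neg h1).congr_of_eventuallyEq (Eventually.of_forall fun p => ?_)
    exact hΩ.bilinAt_hamAt (F p.1 p.2.1) p.2.2 (W p.2.2)
  · have h2 : ContMDiff ((paramModel d).prod (𝓡 d)) (paramModel d) ∞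
        (fun p : (ℝ × ℝ × M) × M => ((p.1.1, p.1.2.1, p.2) : ℝ × ℝ × M)) :=
      (contMDiff_fst.comp contMDiff_fst).prodMk
        ((contMDiff_fst.comp (contMDiff_snd.comp contMDiff_fst)).prodMk contMDiff_snd)
    exact ContMDiffAt.comp (p₀, p₀.2.2) (g := fun p : ℝ × ℝ × M => F p.1 p.2.1 p.2.2) hF
      h2.contMDiffAt

end SmoothHam

/-! ### Recovering h and q as smooth families -/

namespace ModelledAtInfinity

variable {k d : ℕ} {S M : Type*}
  [TopologicalSpace S] [ChartedSpace (EuclideanSpace ℝ (Fin k)) S] [IsManifold (𝓡 k) ∞ S]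
  [TopologicalSpace M] [ChartedSpace (EuclideanSpace ℝ (Fin d)) M] [IsManifold (𝓡 d) ∞ M]
  {α : OneForm k S} {Ω : BilinField d M} (D : ModelledAtInfinity α Ω)

/-- The Liouville vector field, outside of the core. -/
def liouvilleAt (z : M) : EuclideanSpace ℝ (Fin d) :=
  Classical.epsilon fun v => D.dbase z v = 0 ∧ D.dradius z v = D.radius z

theorem liouvilleAt_spec {z : M} (hz : z ∉ D.core) :
    D.dbase z (D.liouvilleAt z) = 0 ∧ D.dradius z (D.liouvilleAt z) = D.radius z :=
  Classical.epsilon_spec (p := fun v => D.dbase z v = 0 ∧ D.dradius z v = D.radius z)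
    (D.exists_dbase_dradius hz 0 (D.radius z))

/-- The function `h` for which `H(x, r) = r h(x) + c` at infinity. -/
def slopeAt (H : M → ℝ) (x : S) : ℝ := H (D.lift x 3) - H (D.lift x 2)

/-- The function `q` that determines an almost complex structure of twisted SFT-type. -/
def twistAt (J : EndField d M) (x : S) : ℝ :=
  bilinAt Ω (D.lift x 2) (endAt J (D.lift x 2) (D.liouvilleAt (D.lift x 2)))
    (D.liouvilleAt (D.lift x 2)) / 2

theorem lift_mem_endSet {r : ℝ} (hr : 1 < r) (x : S) : D.lift x r ∈ D.endSet 1 := by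
  have h := D.rM_lt_one.trans hr
  refine ⟨D.lift_notMem_core h x, ?_⟩
  change 1 < D.radius _
  rwa [D.radius_lift h]

theorem endSet_anti {a b : ℝ} (h : a ≤ b) : D.endSet b ⊆ D.endSet a :=
  fun _ hz => ⟨hz.1, h.trans_lt hz.2⟩

theorem isOpen_endSet_one : IsOpen (D.endSet 1) := by
  have h : ContinuousOn D.radius D.coreᶜ := fun z hz =>
    (D.contMDiffAt_radius hz).continuousAt.continuousWithinAt
  exact h.isOpen_inter_preimage D.isOpen_compl_core isOpen_Ioi

theorem contMDiff_lift {r : ℝ} (hr : D.rM < r) :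
    ContMDiff (𝓡 k) (𝓡 d) ∞ fun x => D.lift x r := fun x =>
  (D.contMDiffAt_lift hr x).comp x (contMDiffAt_id.prodMk contMDiffAt_const)

section Contact

variable (hα : IsContactForm α) (hΩ : IsSymplecticForm Ω)
include hα hΩ

theorem contMDiffAt_liouvilleAt {z : M} (hz : z ∉ D.core) :
    ContMDiffAt (𝓡 d) (𝓡 d).tangent ∞
      (fun z => (⟨z, D.liouvilleAt z⟩ : TangentBundle (𝓡 d) M)) z := by
  refine contMDiffAt_of_pairing (b := id) (X := fun z => D.liouvilleAt z) hΩ contMDiffAt_id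
    fun W hW => ?_
  have h0 : ContMDiffAt (𝓡 d) (𝓡 k).tangent ∞
      (fun z => (⟨D.base z, D.dbase z (W z)⟩ : TangentBundle (𝓡 k) S)) z :=
    contMDiffAt_mfderiv_apply (P := M) (N := M) (N' := S) (f := fun _ => D.base) (b := id)
      (X := W) ((D.contMDiffAt_base hz).comp (z, z) contMDiffAt_snd) hW
  have h1 : ContMDiffAt (𝓡 d) 𝓘(ℝ, ℝ) ∞
      (fun z => D.radius z * formAt α (D.base z) (D.dbase z (W z))) z := by
    refine (D.contMDiffAt_radius hz).mul ?_
    exact contMDiffAt_oneForm_apply (b := D.base) (φ := fun z => α (D.base z))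
      ((hα.smooth (D.base z)).comp z (D.contMDiffAt_base hz)) h0
  refine h1.congr_of_eventuallyEq ?_
  filter_upwards [D.isOpen_compl_core.mem_nhds hz] with z' hz'
  obtain ⟨h2, h3⟩ := D.liouvilleAt_spec hz'
  change bilinAt Ω z' (D.liouvilleAt z') (W z') = _
  erw [D.bilinAt_eq hz' rfl, h2, h3, hα.extAt_zero_left, map_zero]
  ring

/-- The squared norm of Y is r q, which is 2 q at r = 2. -/
theorem twistAt_eq {J : EndField d M} {rJ : ℝ} (hrJ : rJ ≤ 1) {q : S → ℝ} {j : EndField k S}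
    (hq : ∀ x, 0 < q x) (hJ : D.IsTwistedSFT rJ q j J) : D.twistAt J = q := by
  funext x
  have hr : D.rM < 2 := by linarith [D.rM_lt_one]
  have hz := D.lift_mem_endSet (one_lt_two) x
  obtain ⟨h2, h3⟩ := D.liouvilleAt_spec hz.1
  rw [twistAt, D.bilinAt_twisted_liouville hα hΩ hJ (D.endSet_anti hrJ hz) (D.base_lift hr x) (hq x)
    h2 h3, D.radius_lift hr]
  ring

end Contact

/-- Families of Hamiltonians and almost complex structures that, on `S × (1, ∞)`, are given by
smooth families of functions `h` and `q` on `S`. -/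
structure EndGeometry (H : ℝ → ℝ → M → ℝ) (J : ℝ → ℝ → EndField d M) (h q : ℝ → ℝ → S → ℝ) :
    Prop where
  ham : ∀ s, ∃ c, ∀ t, ∀ z ∈ D.endSet 1, H s t z = D.radius z * h s t (D.base z) + c
  twisted : ∀ s t, ∃ j, D.IsTwistedSFT 1 (q s t) j (J s t)
  q_pos : ∀ s t x, 0 < q s t x
  tame_h : Tame h
  tame_q : Tame q
  smooth_h : SmoothFamily k h
  smooth_q : SmoothFamily k q

theorem IsContinuationHam.tame {D : ModelledAtInfinity α Ω} {H : ℝ → ℝ → M → ℝ}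
    (hH : D.IsContinuationHam H) : Tame H :=
  Tame.of_const hH.eq_of_nonpos hH.eq_of_one_le fun s t => funext ((hH.memHam s).periodic t)

theorem IsContinuationAcs.tame {D : ModelledAtInfinity α Ω} {J : ℝ → ℝ → EndField d M}
    (hJ : D.IsContinuationAcs J) : Tame J :=
  Tame.of_const hJ.eq_of_nonpos hJ.eq_of_one_le fun s t => funext ((hJ.memAcs s).periodic t)

/-- The difference of the values at r = 3 and r = 2 removes the constant and leaves (3 - 2) h. -/
theorem HasSlope.eq_slopeAt {D : ModelledAtInfinity α Ω} {H : ℝ → M → ℝ} {h : ℝ → S → ℝ}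
    (hH : D.HasSlope H h) : h = fun t => D.slopeAt (H t) := by
  obtain ⟨rH, c, -, h1, h2⟩ := hH
  funext t x
  have h3 : D.rM < 3 := by linarith [D.rM_lt_one]
  have h4 : D.rM < 2 := by linarith [D.rM_lt_one]
  rw [slopeAt, h2 t _ (D.endSet_anti h1.le (D.lift_mem_endSet (by norm_num) x)),
    h2 t _ (D.endSet_anti h1.le (D.lift_mem_endSet (by norm_num) x))]
  rw [D.chart_lift h3, D.chart_lift h4]
  ring

/-- The hypotheses provide h and q for each s separately, without regularity in s. They are
determined by H and J through evaluation at r = 2 and r = 3, and hence inherit smoothness,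
periodicity and stationarity from H and J. All radii r_H and r_J are below 1, so r > 1 is a common
domain. -/
theorem endGeometry (hα : IsContactForm α) (hΩ : IsSymplecticForm Ω) {H : ℝ → ℝ → M → ℝ}
    {J : ℝ → ℝ → EndField d M} (hH : D.IsContinuationHam H) (hJ : D.IsContinuationAcs J) :
    D.EndGeometry H J (fun s t => D.slopeAt (H s t)) (fun s t => D.twistAt (J s t)) := by
  have hr : D.rM < 2 := by linarith [D.rM_lt_one]
  have hr3 : D.rM < 3 := by linarith [D.rM_lt_one]
  have hq : ∀ s t, ∃ q : S → ℝ, (∀ x, 0 < q x) ∧ D.twistAt (J s t) = q ∧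
      ∃ j, D.IsTwistedSFT 1 q j (J s t) := by
    intro s t
    obtain ⟨rJ, q, j, -, h1, -, -, h2, -, h3⟩ := (hJ.memAcs s).twisted
    exact ⟨q t, h2 t, D.twistAt_eq hα hΩ h1.le (h2 t) (h3 t), j, fun z hz =>
      h3 t z (D.endSet_anti h1.le hz)⟩
  refine ⟨fun s => ?_, fun s t => ?_, fun s t => ?_, ?_, ?_, ?_, ?_⟩
  · obtain ⟨h, hh⟩ := (hH.memHam s).slope
    obtain rfl := hh.eq_slopeAt
    obtain ⟨rH, c, -, h1, h2⟩ := hh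
    exact ⟨c, fun t z hz => h2 t z (D.endSet_anti h1.le hz)⟩
  · obtain ⟨q, h1, h2, h3⟩ := hq s t
    simpa only [h2] using h3
  · obtain ⟨q, h1, h2, h3⟩ := hq s t
    rw [h2]; exact h1
  · exact hH.tame.map D.slopeAt
  · exact hJ.tame.map D.twistAt
  · have h1 {r : ℝ} (hr : D.rM < r) : ContMDiff (paramModel k) 𝓘(ℝ, ℝ) ∞
        fun p : ℝ × ℝ × S => H p.1 p.2.1 (D.lift p.2.2 r) :=
      hH.smooth.comp (contMDiff_fst.prodMk ((contMDiff_fst.comp contMDiff_snd).prodMk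
        ((D.contMDiff_lift hr).comp (contMDiff_snd.comp contMDiff_snd))))
    exact ContMDiff.sub (h1 hr3) (h1 hr)
  · intro p₀
    have hb : ContMDiff (paramModel k) (𝓡 d) ∞ fun p : ℝ × ℝ × S => D.lift p.2.2 2 :=
      (D.contMDiff_lift hr).comp (contMDiff_snd.comp contMDiff_snd)
    have hY : ContMDiffAt (paramModel k) (𝓡 d).tangent ∞ (fun p : ℝ × ℝ × S =>
        (⟨D.lift p.2.2 2, D.liouvilleAt (D.lift p.2.2 2)⟩ : TangentBundle (𝓡 d) M)) p₀ :=
      (D.contMDiffAt_liouvilleAt hα hΩ (D.lift_notMem_core hr _)).comp p₀ hb.contMDiffAt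
    have hJb : ContMDiffAt (paramModel k)
        ((𝓡 d).prod 𝓘(ℝ, EuclideanSpace ℝ (Fin d) →L[ℝ] EuclideanSpace ℝ (Fin d))) ∞
        (fun p : ℝ × ℝ × S => (⟨D.lift p.2.2 2, J p.1 p.2.1 (D.lift p.2.2 2)⟩ : Bundle.TotalSpace
          (EuclideanSpace ℝ (Fin d) →L[ℝ] EuclideanSpace ℝ (Fin d))
          (fun z : M => TangentSpace (𝓡 d) z →L[ℝ] TangentSpace (𝓡 d) z))) p₀ :=
      (hJ.smooth.comp (contMDiff_fst.prodMk ((contMDiff_fst.comp contMDiff_snd).prodMk hb))) p₀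
    have h1 := contMDiffAt_bilin_apply ((hΩ.smooth _).comp p₀ hb.contMDiffAt)
      (contMDiffAt_endField_apply hJb hY) hY
    exact h1.div_const 2

end ModelledAtInfinity

/-! ### The metric Ω(J ·, ·) and its homogeneity -/

/-- The square of the norm of a tangent vector, with respect to the metric `Ω(J ·, ·)`. -/
def normSqAt {d : ℕ} {M : Type*} [TopologicalSpace M] [ChartedSpace (EuclideanSpace ℝ (Fin d)) M]
    (Ω : BilinField d M) (J : EndField d M) (z : M) (v : EuclideanSpace ℝ (Fin d)) : ℝ :=
  bilinAt Ω z (endAt J z v) v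

namespace ModelledAtInfinity

variable {k d : ℕ} {S M : Type*}
  [TopologicalSpace S] [ChartedSpace (EuclideanSpace ℝ (Fin k)) S] [IsManifold (𝓡 k) ∞ S]
  [TopologicalSpace M] [ChartedSpace (EuclideanSpace ℝ (Fin d)) M] [IsManifold (𝓡 d) ∞ M]
  {α : OneForm k S} {Ω : BilinField d M} {D : ModelledAtInfinity α Ω}

section Metric

variable {J : ℝ → EndField d M} (hJ : D.MemAcs J)
include hJ

theorem MemAcs.endAt_endAt (t : ℝ) (z : M) (v : EuclideanSpace ℝ (Fin d)) :
    endAt (J t) z (endAt (J t) z v) = -v := hJ.sq t z v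

theorem MemAcs.normSqAt_nonneg (t : ℝ) (z : M) (v : EuclideanSpace ℝ (Fin d)) :
    0 ≤ normSqAt Ω (J t) z v := by
  by_cases hv : v = 0
  · simp [normSqAt, hv]
  · exact (hJ.pos t z v hv).le

theorem MemAcs.normSqAt_endAt (hΩ : IsSymplecticForm Ω) (t : ℝ) (z : M)
    (v : EuclideanSpace ℝ (Fin d)) : normSqAt Ω (J t) z (endAt (J t) z v) = normSqAt Ω (J t) z v := by
  rw [normSqAt, normSqAt, hJ.endAt_endAt, map_neg, neg_apply, hΩ.bilinAt_swap, neg_neg]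

/-- Cauchy–Schwarz for the symmetric form Ω(J ·, ·), from the nonnegativity of the quadratic form on
the span of the two vectors. -/
theorem MemAcs.bilinAt_endAt_sq_le (t : ℝ) (z : M) (v w : EuclideanSpace ℝ (Fin d)) :
    bilinAt Ω z (endAt (J t) z v) w ^ 2 ≤ normSqAt Ω (J t) z v * normSqAt Ω (J t) z w := by
  have hs : bilinAt Ω z (endAt (J t) z w) v = bilinAt Ω z (endAt (J t) z v) w := hJ.symm t z w v
  have key : ∀ a b : ℝ, 0 ≤ a ^ 2 * normSqAt Ω (J t) z v
      + 2 * a * b * bilinAt Ω z (endAt (J t) z v) w + b ^ 2 * normSqAt Ω (J t) z w := by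
    intro a b
    have := hJ.normSqAt_nonneg t z (a • v + b • w)
    simp only [normSqAt, map_add, map_smul, add_apply, smul_apply, smul_eq_mul, hs] at this ⊢
    linarith
  have h1 := hJ.normSqAt_nonneg t z v
  have h2 := hJ.normSqAt_nonneg t z w
  set A := normSqAt Ω (J t) z v
  set B := normSqAt Ω (J t) z w
  set c := bilinAt Ω z (endAt (J t) z v) w
  have h3 := key B (-c)
  rcases h2.eq_or_lt with h | h
  · have h4 := key (-c) (A + 1)
    have h5 := key (-c) 1
    rw [← h] at h4 h5 ⊢
    nlinarith [sq_nonneg c]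
  · have : 0 ≤ B * (A * B - c ^ 2) := by nlinarith
    have := nonneg_of_mul_nonneg_right this h
    linarith

/-- Up to sign, Ω(v, w) is the inner product of J v and w, and J is an isometry. -/
theorem MemAcs.bilinAt_sq_le (hΩ : IsSymplecticForm Ω) (t : ℝ) (z : M)
    (v w : EuclideanSpace ℝ (Fin d)) :
    bilinAt Ω z v w ^ 2 ≤ normSqAt Ω (J t) z v * normSqAt Ω (J t) z w := by
  have := hJ.bilinAt_endAt_sq_le t z (endAt (J t) z v) w
  rwa [hJ.endAt_endAt, map_neg, neg_apply, neg_sq, hJ.normSqAt_endAt hΩ] at this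

end Metric

section Bounds

variable (hα : IsContactForm α) (hΩ : IsSymplecticForm Ω)
  {H : ℝ → ℝ → M → ℝ} {J : ℝ → ℝ → EndField d M} (hJ : D.IsContinuationAcs J)

include hα hΩ in
/-- The square of the norm is one-homogeneous. -/
theorem EndGeometry.normSqAt_scale {h q : ℝ → ℝ → S → ℝ} (hG : D.EndGeometry H J h q) (s t : ℝ)
    {z z' : M} (hz : z ∈ D.endSet 1) (hz' : z' ∈ D.endSet 1) (hb : D.base z' = D.base z)
    {v v' : EuclideanSpace ℝ (Fin d)} (h1 : D.dbase z' v' = D.dbase z v)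
    (h2 : D.dradius z' v' / D.radius z' = D.dradius z v / D.radius z) :
    normSqAt Ω (J s t) z' v' * D.radius z = D.radius z' * normSqAt Ω (J s t) z v := by
  obtain ⟨j, hj⟩ := hG.twisted s t
  rw [normSqAt, normSqAt, D.bilinAt_twisted hα hΩ hj hz rfl (hG.q_pos s t _),
    D.bilinAt_twisted hα hΩ hj hz' hb (hG.q_pos s t _), h1, h2]
  ring

/-- The function `radius * φ ∘ base`. -/
def homog (D : ModelledAtInfinity α Ω) (φ : S → ℝ) (z : M) : ℝ := D.radius z * φ (D.base z)

theorem contMDiffAt_homog {φ : ℝ → ℝ → S → ℝ} (hφ : SmoothFamily k φ) {p₀ : ℝ × ℝ × M}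
    (hp : p₀.2.2 ∉ D.core) : ContMDiffAt (paramModel d) 𝓘(ℝ, ℝ) ∞
      (fun p : ℝ × ℝ × M => D.homog (φ p.1 p.2.1) p.2.2) p₀ := by
  have h0 : ContMDiffAt (paramModel d) (𝓡 d) ∞ (fun p : ℝ × ℝ × M => p.2.2) p₀ :=
    contMDiffAt_snd.comp p₀ contMDiffAt_snd
  have h1 : ContMDiffAt (paramModel d) (paramModel k) ∞
      (fun p : ℝ × ℝ × M => ((p.1, p.2.1, D.base p.2.2) : ℝ × ℝ × S)) p₀ :=
    contMDiffAt_fst.prodMk ((contMDiffAt_fst.comp p₀ contMDiffAt_snd).prodMk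
      (ContMDiffAt.comp p₀ (g := D.base) (D.contMDiffAt_base hp) h0))
  have h2 : ContMDiffAt (paramModel d) 𝓘(ℝ, ℝ) ∞ (fun p : ℝ × ℝ × M => D.radius p.2.2) p₀ :=
    ContMDiffAt.comp p₀ (g := D.radius) (D.contMDiffAt_radius hp) h0
  exact h2.mul ((hφ _).comp p₀ h1)

include hα hΩ hJ in
/-- The differentials of one-homogeneous functions are bounded by the square root of the radius. -/
theorem EndGeometry.exists_diffAt_homog_sq_le [CompactSpace S] {h q : ℝ → ℝ → S → ℝ}
    (hG : D.EndGeometry H J h q) {φ : ℝ → ℝ → S → ℝ} (hφ : SmoothFamily k φ) (hφt : Tame φ) :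
    ∃ C : ℝ, 0 < C ∧ ∀ s t, ∀ z ∈ D.endSet 1, ∀ v,
      diffAt (D.homog (φ s t)) z v ^ 2 ≤ C * D.radius z * normSqAt Ω (J s t) z v := by
  have hr : D.rM < 2 := by linarith [D.rM_lt_one]
  -- The squared norm of the Hamiltonian field of r φ on the slice r = 2, where compactness bounds
  -- it uniformly in s and t.
  let n : ℝ → ℝ → S → ℝ := fun s t x =>
    normSqAt Ω (J s t) (D.lift x 2) (hamAt Ω (D.homog (φ s t)) (D.lift x 2))
  have hn : Tame n := hφt.map₂ hJ.tame fun φ J x =>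
    normSqAt Ω J (D.lift x 2) (hamAt Ω (D.homog φ) (D.lift x 2))
  have hnc : ContMDiff (paramModel k) 𝓘(ℝ, ℝ) ∞ fun p : ℝ × ℝ × S => n p.1 p.2.1 p.2.2 := by
    intro p₀
    have hl : ContMDiff (paramModel k) (𝓡 d) ∞ fun p : ℝ × ℝ × S => D.lift p.2.2 2 :=
      (D.contMDiff_lift hr).comp (contMDiff_snd.comp contMDiff_snd)
    have hb : ContMDiff (paramModel k) (paramModel d) ∞
        fun p : ℝ × ℝ × S => ((p.1, p.2.1, D.lift p.2.2 2) : ℝ × ℝ × M) :=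
      contMDiff_fst.prodMk ((contMDiff_fst.comp contMDiff_snd).prodMk hl)
    have hX : ContMDiffAt (paramModel k) (𝓡 d).tangent ∞ (fun p : ℝ × ℝ × S =>
        (⟨D.lift p.2.2 2, hamField Ω (D.homog (φ p.1 p.2.1)) (D.lift p.2.2 2)⟩ :
          TangentBundle (𝓡 d) M)) p₀ :=
      ContMDiffAt.comp p₀ (hΩ.contMDiffAt_hamField (F := fun s t => D.homog (φ s t))
        (p₀ := (p₀.1, p₀.2.1, D.lift p₀.2.2 2)) (contMDiffAt_homog hφ (D.lift_notMem_core hr _))) (hb p₀)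
    exact contMDiffAt_bilin_apply ((hΩ.smooth _).comp p₀ hl.contMDiffAt)
      (contMDiffAt_endField_apply ((hJ.smooth.comp hb) p₀) hX) hX
  obtain ⟨C, hC, hCn⟩ := hn.exists_bound hnc.continuous
  refine ⟨C, hC, fun s t z hz v => ?_⟩
  have hR := D.radius_pos hz.1
  have hz₀ := D.lift_mem_endSet one_lt_two (D.base z)
  set z₀ := D.lift (D.base z) 2 with hz₀'
  have hb : D.base z₀ = D.base z := D.base_lift hr _
  have hR₀ : D.radius z₀ = 2 := D.radius_lift hr _
  -- The vector is moved to the slice by a radial dilation, which keeps dr / r fixed. This scales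
  -- both d(r φ) and the squared norm linearly in r.
  obtain ⟨v₀, h1, h2⟩ := D.exists_dbase_dradius hz₀.1 (D.dbase z v) (2 * D.dradius z v / D.radius z)
  have hsc := hG.normSqAt_scale hα hΩ s t hz hz₀ hb h1 (by rw [h2, hR₀]; ring)
  have hms : MDifferentiableAt (𝓡 k) 𝓘(ℝ, ℝ) (φ s t) (D.base z) :=
    ((hφ.slice s t) _).mdifferentiableAt (by simp)
  have hd : diffAt (D.homog (φ s t)) z v = D.radius z / 2 * diffAt (D.homog (φ s t)) z₀ v₀ := by
    have e1 := D.diffAt_homogeneous hz.1 rfl hms v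
    have e2 := D.diffAt_homogeneous hz₀.1 hb hms v₀
    unfold homog
    rw [e1, e2, h1, h2, hR₀]
    field_simp
  -- On the slice, d(r φ) is the pairing with the Hamiltonian field, so Cauchy–Schwarz applies.
  have hcs := (hJ.memAcs s).bilinAt_sq_le hΩ t z₀ (hamAt Ω (D.homog (φ s t)) z₀) v₀
  rw [hΩ.bilinAt_hamAt, neg_sq] at hcs
  have hN : normSqAt Ω (J s t) z₀ (hamAt Ω (D.homog (φ s t)) z₀) ≤ C :=
    (le_abs_self _).trans (hCn s t (D.base z))
  have hN0 := (hJ.memAcs s).normSqAt_nonneg t z₀ v₀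
  have hNz := (hJ.memAcs s).normSqAt_nonneg t z v
  rw [hR₀] at hsc
  have hle : diffAt (D.homog (φ s t)) z₀ v₀ ^ 2 ≤ C * normSqAt Ω (J s t) z₀ v₀ :=
    hcs.trans (mul_le_mul_of_nonneg_right hN hN0)
  rw [hd, mul_pow]
  calc (D.radius z / 2) ^ 2 * diffAt (D.homog (φ s t)) z₀ v₀ ^ 2
      ≤ (D.radius z / 2) ^ 2 * (C * normSqAt Ω (J s t) z₀ v₀) := by gcongr
    _ = C * D.radius z / 4 * (normSqAt Ω (J s t) z₀ v₀ * D.radius z) := by ring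
    _ = C * D.radius z / 2 * normSqAt Ω (J s t) z v := by rw [hsc]; ring
    _ ≤ C * D.radius z * normSqAt Ω (J s t) z v := by
      apply mul_le_mul_of_nonneg_right _ hNz
      nlinarith [mul_pos hC hR]

theorem EndGeometry.diffAt_ham {h q : ℝ → ℝ → S → ℝ} (hG : D.EndGeometry H J h q) (s t : ℝ)
    {z : M} (hz : z ∈ D.endSet 1) :
    diffAt (k := d) (H s t) z = diffAt (D.homog (h s t)) z := by
  obtain ⟨c, hc⟩ := hG.ham s
  have hev : H s t =ᶠ[𝓝 z] fun z => D.homog (h s t) z + c := by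
    filter_upwards [D.isOpen_endSet_one.mem_nhds hz] with z' hz'
    exact hc t z' hz'
  have hm : MDifferentiableAt (𝓡 d) 𝓘(ℝ, ℝ) (D.homog (h s t)) z := by
    have h1 : ContMDiffAt (𝓡 d) 𝓘(ℝ, ℝ) ∞ (D.homog (h s t)) z :=
      (D.contMDiffAt_radius hz.1).mul
        (((hG.smooth_h.slice s t) _).comp z (D.contMDiffAt_base hz.1))
    exact h1.mdifferentiableAt (by simp)
  have h2 := (hm.hasMFDerivAt.add (hasMFDerivAt_const c z)).mfderiv
  ext v
  change mfderiv (𝓡 d) 𝓘(ℝ, ℝ) (H s t) z v = mfderiv (𝓡 d) 𝓘(ℝ, ℝ) (D.homog (h s t)) z v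
  rw [hev.mfderiv_eq]
  refine (DFunLike.congr_fun h2 v).trans ?_
  exact add_zero (diffAt (D.homog (h s t)) z v)

include hα hΩ hJ in
-- The squared norm of X = X_H is dH(J X). The bound of the differential of r h at J X therefore
-- reads |X|⁴ ≤ C r |X|².
theorem EndGeometry.exists_normSqAt_hamAt_le [CompactSpace S] {h q : ℝ → ℝ → S → ℝ}
    (hG : D.EndGeometry H J h q) :
    ∃ C : ℝ, 0 < C ∧ ∀ s t, ∀ z ∈ D.endSet 1,
      normSqAt Ω (J s t) z (hamAt Ω (H s t) z) ≤ C * D.radius z := by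
  obtain ⟨C, hC, hb⟩ := hG.exists_diffAt_homog_sq_le hα hΩ hJ hG.smooth_h hG.tame_h
  refine ⟨C, hC, fun s t z hz => ?_⟩
  have h1 := hb s t z hz (endAt (J s t) z (hamAt Ω (H s t) z))
  rw [(hJ.memAcs s).normSqAt_endAt hΩ, ← hG.diffAt_ham s t hz] at h1
  have h2 : diffAt (H s t) z (endAt (J s t) z (hamAt Ω (H s t) z))
      = normSqAt Ω (J s t) z (hamAt Ω (H s t) z) := by
    have := hΩ.bilinAt_hamAt (H s t) z (endAt (J s t) z (hamAt Ω (H s t) z))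
    rw [normSqAt, hΩ.bilinAt_swap, this, neg_neg]
  rw [h2] at h1
  have h3 := (hJ.memAcs s).normSqAt_nonneg t z (hamAt Ω (H s t) z)
  by_contra! hlt
  nlinarith [mul_pos hC (D.radius_pos hz.1)]

end Bounds

end ModelledAtInfinity

/-! ### One-homogeneous functions and λ along maps from the plane -/

namespace ModelledAtInfinity

variable {k d : ℕ} {S M : Type*}
  [TopologicalSpace S] [ChartedSpace (EuclideanSpace ℝ (Fin k)) S] [IsManifold (𝓡 k) ∞ S]
  [TopologicalSpace M] [ChartedSpace (EuclideanSpace ℝ (Fin d)) M] [IsManifold (𝓡 d) ∞ M]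
  {α : OneForm k S} {Ω : BilinField d M} {D : ModelledAtInfinity α Ω}

/-- The differential of a map from the plane, as a map between the model spaces. -/
def planeDiff (u : ℝ × ℝ → M) (p : ℝ × ℝ) : ℝ × ℝ →L[ℝ] EuclideanSpace ℝ (Fin d) :=
  mfderiv 𝓘(ℝ, ℝ × ℝ) (𝓡 d) u p

/-- A one-homogeneous family of functions, along a map from the plane. -/
def homogAlong (D : ModelledAtInfinity α Ω) (φ : ℝ → ℝ → S → ℝ) (u : ℝ × ℝ → M) (p : ℝ × ℝ) : ℝ :=
  D.homog (φ p.1 p.2) (u p)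

/-- The form `λ = r α`, applied to a partial derivative of a map from the plane. -/
def liouvilleAlong (D : ModelledAtInfinity α Ω) (u : ℝ × ℝ → M) (e p : ℝ × ℝ) : ℝ :=
  D.radius (u p) * formAt α (D.base (u p)) (D.dbase (u p) (planeDiff u p e))

section Along

variable {u : ℝ × ℝ → M} (hu : ContMDiff 𝓘(ℝ, ℝ × ℝ) (𝓡 d) ∞ u) {p : ℝ × ℝ} (hp : u p ∉ D.core)
include hu hp

theorem contMDiffAt_base_comp : ContMDiffAt 𝓘(ℝ, ℝ × ℝ) (𝓡 k) ∞ (fun p => D.base (u p)) p :=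
  (D.contMDiffAt_base hp).comp p (hu p)

theorem contDiffAt_radius_comp : ContDiffAt ℝ ∞ (fun p => D.radius (u p)) p :=
  ((D.contMDiffAt_radius hp).comp p (hu p)).contDiffAt

theorem fderiv_radius_comp (e : ℝ × ℝ) :
    fderiv ℝ (fun p => D.radius (u p)) p e = D.dradius (u p) (planeDiff u p e) := by
  have h := mfderiv_comp p ((D.contMDiffAt_radius hp).mdifferentiableAt (by simp))
    ((hu p).mdifferentiableAt (by simp))
  rw [mfderiv_eq_fderiv] at h
  exact DFunLike.congr_fun h e

theorem mfderiv_base_comp (e : ℝ × ℝ) :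
    mfderiv 𝓘(ℝ, ℝ × ℝ) (𝓡 k) (fun p => D.base (u p)) p e = D.dbase (u p) (planeDiff u p e) :=
  DFunLike.congr_fun (mfderiv_comp p ((D.contMDiffAt_base hp).mdifferentiableAt (by simp))
    ((hu p).mdifferentiableAt (by simp))) e

theorem contDiffAt_homogAlong {φ : ℝ → ℝ → S → ℝ} (hφ : SmoothFamily k φ) :
    ContDiffAt ℝ ∞ (D.homogAlong φ u) p := by
  have h1 : ContMDiffAt 𝓘(ℝ, ℝ × ℝ) (paramModel d) ∞
      (fun p : ℝ × ℝ => ((p.1, p.2, u p) : ℝ × ℝ × M)) p :=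
    (contDiffAt_fst.contMDiffAt).prodMk ((contDiffAt_snd.contMDiffAt).prodMk (hu p))
  exact (ContMDiffAt.comp p (contMDiffAt_homog (p₀ := (p.1, p.2, u p)) hφ hp) h1).contDiffAt

/-- The chain rule is applied to a function `G` in which s, t and the point of the plane at which u
is evaluated are independent variables, restricted to the diagonal. -/
theorem fderiv_homogAlong {φ : ℝ → ℝ → S → ℝ} (hφ : SmoothFamily k φ) (e : ℝ × ℝ) :
    fderiv ℝ (D.homogAlong φ u) p e
      = e.1 * (D.radius (u p) * deriv (fun σ => φ σ p.2 (D.base (u p))) p.1)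
        + e.2 * (D.radius (u p) * deriv (fun τ => φ p.1 τ (D.base (u p))) p.2)
        + diffAt (k := d) (D.homog (φ p.1 p.2)) (u p) (planeDiff u p e) := by
  let G : ℝ × ℝ × (ℝ × ℝ) → ℝ := fun x => D.homog (φ x.1 x.2.1) (u x.2.2)
  let x₀ : ℝ × ℝ × (ℝ × ℝ) := (p.1, p.2, p)
  have hG : DifferentiableAt ℝ G x₀ := by
    have h1 : ContMDiffAt 𝓘(ℝ, ℝ × ℝ × (ℝ × ℝ)) (paramModel d) ∞
        (fun x : ℝ × ℝ × (ℝ × ℝ) => ((x.1, x.2.1, u x.2.2) : ℝ × ℝ × M)) x₀ := by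
      refine (contDiffAt_fst.contMDiffAt).prodMk (ContMDiffAt.prodMk ?_ ?_)
      · exact (contDiff_fst.comp contDiff_snd).contDiffAt.contMDiffAt
      · have h2 : ContMDiffAt 𝓘(ℝ, ℝ × ℝ × (ℝ × ℝ)) 𝓘(ℝ, ℝ × ℝ) ∞
            (fun x : ℝ × ℝ × (ℝ × ℝ) => x.2.2) x₀ :=
          (contDiff_snd.comp contDiff_snd).contDiffAt.contMDiffAt
        exact ContMDiffAt.comp x₀ (hu p) h2
    have h2 := ContMDiffAt.comp x₀ (contMDiffAt_homog (p₀ := (p.1, p.2, u p)) hφ hp) h1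
    exact h2.contDiffAt.differentiableAt (by simp)
  have hcomp : HasFDerivAt (D.homogAlong φ u) ((fderiv ℝ G x₀).comp
      ((ContinuousLinearMap.fst ℝ ℝ ℝ).prod ((ContinuousLinearMap.snd ℝ ℝ ℝ).prod
        (ContinuousLinearMap.id ℝ (ℝ × ℝ))))) p :=
    HasFDerivAt.comp p (f := fun p : ℝ × ℝ => (p.1, p.2, p)) hG.hasFDerivAt
      (hasFDerivAt_fst.prodMk (hasFDerivAt_snd.prodMk (hasFDerivAt_id p)))
  have h1 : fderiv ℝ G x₀ (1, 0, 0)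
      = D.radius (u p) * deriv (fun σ => φ σ p.2 (D.base (u p))) p.1 := by
    have := hG.hasFDerivAt.comp_hasDerivAt_of_eq p.1 (f := fun σ : ℝ => (σ, p.2, p))
      (HasDerivAt.prodMk (hasDerivAt_id' p.1) ((hasDerivAt_const p.1 p.2).prodMk (hasDerivAt_const p.1 p))) rfl
    rw [← this.deriv]
    exact deriv_const_mul_field (D.radius (u p))
  have h2 : fderiv ℝ G x₀ (0, 1, 0)
      = D.radius (u p) * deriv (fun τ => φ p.1 τ (D.base (u p))) p.2 := by
    have := hG.hasFDerivAt.comp_hasDerivAt_of_eq p.2 (f := fun τ : ℝ => (p.1, τ, p))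
      ((hasDerivAt_const p.2 p.1).prodMk (HasDerivAt.prodMk (hasDerivAt_id' p.2) (hasDerivAt_const p.2 p))) rfl
    rw [← this.deriv]
    exact deriv_const_mul_field (D.radius (u p))
  have h3 : fderiv ℝ G x₀ (0, 0, e) = diffAt (k := d) (D.homog (φ p.1 p.2)) (u p) (planeDiff u p e) := by
    have h4 : HasFDerivAt (fun p' : ℝ × ℝ => G (p.1, p.2, p')) ((fderiv ℝ G x₀).comp
        ((0 : ℝ × ℝ →L[ℝ] ℝ).prod ((0 : ℝ × ℝ →L[ℝ] ℝ).prod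
        (ContinuousLinearMap.id ℝ (ℝ × ℝ))))) p :=
      HasFDerivAt.comp p (f := fun p' : ℝ × ℝ => (p.1, p.2, p')) hG.hasFDerivAt
        ((hasFDerivAt_const p.1 p).prodMk ((hasFDerivAt_const p.2 p).prodMk (hasFDerivAt_id p)))
    have h5 : MDifferentiableAt (𝓡 d) 𝓘(ℝ, ℝ) (D.homog (φ p.1 p.2)) (u p) := by
      have h6 : ContMDiffAt (𝓡 d) 𝓘(ℝ, ℝ) ∞ (D.homog (φ p.1 p.2)) (u p) :=
        (D.contMDiffAt_radius hp).mul
          (((hφ.slice p.1 p.2) _).comp _ (D.contMDiffAt_base hp))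
      exact h6.mdifferentiableAt (by simp)
    have h7 := mfderiv_comp p h5 ((hu p).mdifferentiableAt (by simp))
    rw [mfderiv_eq_fderiv] at h7
    have h8 := DFunLike.congr_fun h7 e
    rw [show (D.homog (φ p.1 p.2) ∘ u) = fun p' : ℝ × ℝ => G (p.1, p.2, p') from rfl,
      h4.fderiv] at h8
    exact h8
  rw [hcomp.fderiv, ← h1, ← h2, ← h3, ← smul_eq_mul, ← smul_eq_mul, ← map_smul, ← map_smul,
    ← map_add, ← map_add]
  simp

theorem differentiableAt_liouvilleAlong (hα : IsContactForm α) (e : ℝ × ℝ) :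
    DifferentiableAt ℝ (D.liouvilleAlong u e) p ∧
    DifferentiableAt ℝ (fun p => formAt α (D.base (u p)) (D.dbase (u p) (planeDiff u p e))) p := by
  have h1 := differentiableAt_oneForm_mfderiv (hα.smooth _) (contMDiffAt_base_comp hu hp) e
  have h2 : (fun p => formAt α (D.base (u p)) (D.dbase (u p) (planeDiff u p e))) =ᶠ[𝓝 p]
      fun p => α (D.base (u p)) (mfderiv 𝓘(ℝ, ℝ × ℝ) (𝓡 k) (fun p => D.base (u p)) p e) := by
    filter_upwards [hu.continuous.continuousAt.eventually (D.isOpen_compl_core.mem_nhds hp)]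
      with p' hp'
    rw [mfderiv_base_comp hu hp']
    rfl
  have h3 : DifferentiableAt ℝ
      (fun p => formAt α (D.base (u p)) (D.dbase (u p) (planeDiff u p e))) p :=
    h2.differentiableAt_iff.2 (h1.differentiableAt (by simp))
  exact ⟨((contDiffAt_radius_comp hu hp).differentiableAt (by simp)).mul h3, h3⟩

/-- Stokes' formula for `λ = r α`, in infinitesimal form. -/
theorem fderiv_liouvilleAlong (hα : IsContactForm α) (a b : ℝ × ℝ) :
    fderiv ℝ (D.liouvilleAlong u b) p a - fderiv ℝ (D.liouvilleAlong u a) p b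
      = bilinAt Ω (u p) (planeDiff u p a) (planeDiff u p b) := by
  have hev (e : ℝ × ℝ) : (fun p => formAt α (D.base (u p)) (D.dbase (u p) (planeDiff u p e))) =ᶠ[𝓝 p]
      fun p => α (D.base (u p)) (mfderiv 𝓘(ℝ, ℝ × ℝ) (𝓡 k) (fun p => D.base (u p)) p e) := by
    filter_upwards [hu.continuous.continuousAt.eventually (D.isOpen_compl_core.mem_nhds hp)]
      with p' hp'
    rw [mfderiv_base_comp hu hp']
    rfl
  have hst := dOne_mfderiv (hα.smooth _) (contMDiffAt_base_comp hu hp) a b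
  rw [← (hev a).fderiv_eq, ← (hev b).fderiv_eq, mfderiv_base_comp hu hp,
    mfderiv_base_comp hu hp] at hst
  have hmul (e e' : ℝ × ℝ) : fderiv ℝ (D.liouvilleAlong u e) p e'
      = D.radius (u p) * fderiv ℝ
          (fun p => formAt α (D.base (u p)) (D.dbase (u p) (planeDiff u p e))) p e'
        + formAt α (D.base (u p)) (D.dbase (u p) (planeDiff u p e))
          * D.dradius (u p) (planeDiff u p e') := by
    rw [← fderiv_radius_comp hu hp]
    have h := ((contDiffAt_radius_comp hu hp).differentiableAt (by simp)).hasFDerivAt.mul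
      (differentiableAt_liouvilleAlong hu hp hα e).2.hasFDerivAt
    exact DFunLike.congr_fun h.fderiv e'
  change _ = extAt α (D.base (u p)) (D.dbase (u p) (planeDiff u p a))
    (D.dbase (u p) (planeDiff u p b)) at hst
  rw [hmul, hmul, D.bilinAt_eq hp rfl, ← hst]
  ring

end Along

end ModelledAtInfinity

/-! ### First derivatives of Q along Floer solutions -/

namespace ModelledAtInfinity

variable {k d : ℕ} {S M : Type*}
  [TopologicalSpace S] [ChartedSpace (EuclideanSpace ℝ (Fin k)) S] [IsManifold (𝓡 k) ∞ S]
  [TopologicalSpace M] [ChartedSpace (EuclideanSpace ℝ (Fin d)) M] [IsManifold (𝓡 d) ∞ M]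
  {α : OneForm k S} {Ω : BilinField d M} {D : ModelledAtInfinity α Ω}

/-- The function `b` on `S` such that `d(r q)` maps the Hamiltonian vector field of `r h` to
`r b`. -/
def bracketAt (α : OneForm k S) (h q : S → ℝ) (x : S) : ℝ :=
  diffAt q x (contactAt α h x) - q x * diffAt h x (reebAt α x)

section Bracket

variable (hα : IsContactForm α) (hΩ : IsSymplecticForm Ω)
include hα hΩ

theorem diffAt_homog_hamAt {G : M → ℝ} {h q : S → ℝ} {z : M} (hz : z ∉ D.core) {x : S}
    (hx : D.base z = x) (hh : MDifferentiableAt (𝓡 k) 𝓘(ℝ, ℝ) h x)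
    (hq : MDifferentiableAt (𝓡 k) 𝓘(ℝ, ℝ) q x) (hG : diffAt (k := d) G z = diffAt (D.homog h) z) :
    diffAt (D.homog q) z (hamAt Ω G z) = D.radius z * bracketAt α h q x := by
  have h1 (v : EuclideanSpace ℝ (Fin d)) : diffAt G z v
      = D.dradius z v * h x + D.radius z * diffAt h x (D.dbase z v) := by
    rw [hG]
    exact D.diffAt_homogeneous hz hx hh v
  obtain ⟨h2, h3⟩ := D.dbase_dradius_hamAt hα hΩ hz hx h1
  have h4 := D.diffAt_homogeneous hz hx hq (hamAt Ω G z)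
  unfold homog bracketAt
  rw [h4, h2, h3]
  ring

omit hα in
theorem contMDiff_hamField_lift {φ : ℝ → ℝ → S → ℝ} (hφ : SmoothFamily k φ) :
    ContMDiff (paramModel k) (𝓡 d).tangent ∞ (fun p : ℝ × ℝ × S =>
        (⟨D.lift p.2.2 2, hamField Ω (D.homog (φ p.1 p.2.1)) (D.lift p.2.2 2)⟩ :
          TangentBundle (𝓡 d) M)) := by
  intro p₀
  have hr : D.rM < 2 := by linarith [D.rM_lt_one]
  have hb : ContMDiff (paramModel k) (paramModel d) ∞
      fun p : ℝ × ℝ × S => ((p.1, p.2.1, D.lift p.2.2 2) : ℝ × ℝ × M) :=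
    contMDiff_fst.prodMk ((contMDiff_fst.comp contMDiff_snd).prodMk
      ((D.contMDiff_lift hr).comp (contMDiff_snd.comp contMDiff_snd)))
  exact ContMDiffAt.comp p₀ (hΩ.contMDiffAt_hamField (F := fun s t => D.homog (φ s t))
    (p₀ := (p₀.1, p₀.2.1, D.lift p₀.2.2 2)) (contMDiffAt_homog hφ (D.lift_notMem_core hr _))) (hb p₀)

/-- On the slice r = 2 the function is half of d(r ψ) applied to the Hamiltonian field of r φ. This
route needs no separate proof that Reeb and contact fields are smooth. -/
theorem smoothFamily_bracketAt (D : ModelledAtInfinity α Ω) {φ ψ : ℝ → ℝ → S → ℝ}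
    (hφ : SmoothFamily k φ) (hψ : SmoothFamily k ψ) :
    SmoothFamily k fun s t => bracketAt α (φ s t) (ψ s t) := by
  have hr : D.rM < 2 := by linarith [D.rM_lt_one]
  intro p₀
  have h1 := contMDiffAt_mfderiv_apply_real (IP := paramModel k) (P := ℝ × ℝ × S) (N := M)
    (IN := 𝓡 d) (f := fun p z => D.homog (ψ p.1 p.2.1) z) (b := fun p => D.lift p.2.2 2)
    (X := fun p => hamField Ω (D.homog (φ p.1 p.2.1)) (D.lift p.2.2 2))
    (p₀ := p₀) ?_ (contMDiff_hamField_lift hΩ hφ p₀)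
  · refine (ContMDiffAt.mul (contMDiffAt_const (c := (1 / 2 : ℝ))) h1).congr_of_eventuallyEq
      (Eventually.of_forall fun p => ?_)
    have h2 := diffAt_homog_hamAt (D := D) hα hΩ (G := D.homog (φ p.1 p.2.1))
      (h := φ p.1 p.2.1) (q := ψ p.1 p.2.1) (D.lift_notMem_core hr p.2.2)
      (D.base_lift hr p.2.2) (((hφ.slice p.1 p.2.1) _).mdifferentiableAt (by simp))
      (((hψ.slice p.1 p.2.1) _).mdifferentiableAt (by simp)) rfl
    rw [D.radius_lift hr] at h2
    change bracketAt α (φ p.1 p.2.1) (ψ p.1 p.2.1) p.2.2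
      = 1 / 2 * diffAt (D.homog (ψ p.1 p.2.1)) (D.lift p.2.2 2)
        (hamAt Ω (D.homog (φ p.1 p.2.1)) (D.lift p.2.2 2))
    rw [h2]
    ring
  · have h2 : ContMDiff ((paramModel k).prod (𝓡 d)) (paramModel d) ∞
        (fun p : (ℝ × ℝ × S) × M => ((p.1.1, p.1.2.1, p.2) : ℝ × ℝ × M)) :=
      (contMDiff_fst.comp contMDiff_fst).prodMk
        ((contMDiff_fst.comp (contMDiff_snd.comp contMDiff_fst)).prodMk contMDiff_snd)
    exact ContMDiffAt.comp (p₀, D.lift p₀.2.2 2)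
      (g := fun p : ℝ × ℝ × M => D.homog (ψ p.1 p.2.1) p.2.2)
      (contMDiffAt_homog hψ (D.lift_notMem_core hr _)) h2.contMDiffAt

end Bracket

section Floer

variable {H : ℝ → ℝ → M → ℝ} {J : ℝ → ℝ → EndField d M} {h q : ℝ → ℝ → S → ℝ} {E : ℝ}
  {u : ℝ × ℝ → M}

/-- The norm of `∂_s u`. -/
def gradNorm (Ω : BilinField d M) (J : ℝ → ℝ → EndField d M) (u : ℝ × ℝ → M) (p : ℝ × ℝ) : ℝ :=
  √(normSqAt Ω (J p.1 p.2) (u p) (planeDiff u p (1, 0)))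

theorem continuous_normSqAt (hΩ : IsSymplecticForm Ω) (hJ : D.IsContinuationAcs J)
    (hu : IsFloerSolution Ω H J E u) :
    Continuous fun p => normSqAt Ω (J p.1 p.2) (u p) (planeDiff u p (1, 0)) := by
  have h1 : ContMDiff 𝓘(ℝ, ℝ × ℝ) 𝓘(ℝ, ℝ) ∞
      fun p => normSqAt Ω (J p.1 p.2) (u p) (planeDiff u p (1, 0)) := by
    intro p
    have hb : ContMDiff 𝓘(ℝ, ℝ × ℝ) (paramModel d) ∞
        fun p : ℝ × ℝ => ((p.1, p.2, u p) : ℝ × ℝ × M) :=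
      (contDiff_fst.contMDiff).prodMk ((contDiff_snd.contMDiff).prodMk hu.smooth)
    have hX := contMDiffAt_mfderiv_const_apply (hu.smooth p) (1, 0)
    exact contMDiffAt_bilin_apply ((hΩ.smooth _).comp p (hu.smooth p))
      (contMDiffAt_endField_apply ((hJ.smooth.comp hb) p) hX) hX
  exact h1.continuous

theorem gradNorm_sq (hJ : D.IsContinuationAcs J) (p : ℝ × ℝ) :
    gradNorm Ω J u p ^ 2 = normSqAt Ω (J p.1 p.2) (u p) (planeDiff u p (1, 0)) :=
  Real.sq_sqrt ((hJ.memAcs p.1).normSqAt_nonneg p.2 _ _)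

theorem continuous_gradNorm (hΩ : IsSymplecticForm Ω) (hJ : D.IsContinuationAcs J)
    (hu : IsFloerSolution Ω H J E u) : Continuous (gradNorm Ω J u) :=
  (continuous_normSqAt hΩ hJ hu).sqrt

/-- The Floer equation solved for J ∂_s u. As J is an isometry, g controls ∂_t u up to the
Hamiltonian vector field. -/
theorem endAt_planeDiff (hJ : D.IsContinuationAcs J) (hu : IsFloerSolution Ω H J E u) (p : ℝ × ℝ) :
    endAt (J p.1 p.2) (u p) (planeDiff u p (1, 0))
      = planeDiff u p (0, 1) - hamAt Ω (H p.1 p.2) (u p) := by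
  have h1 : planeDiff u p (1, 0) + endAt (J p.1 p.2) (u p)
      (planeDiff u p (0, 1) - hamAt Ω (H p.1 p.2) (u p)) = 0 := hu.floer p.1 p.2
  rw [eq_neg_of_add_eq_zero_left h1, map_neg, (hJ.memAcs p.1).endAt_endAt, neg_neg]

variable (hα : IsContactForm α) (hΩ : IsSymplecticForm Ω) (hJ : D.IsContinuationAcs J)
  (hG : D.EndGeometry H J h q) (hu : IsFloerSolution Ω H J E u)

include hα hΩ hJ hG hu

/-- Apply dQ ∘ J = λ to J ∂_s u = ∂_t u - X_H: this gives -dQ(∂_s u) = λ(∂_t u) - r h, because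
λ(X_H) = r h. The explicit dependence of q on s contributes r ∂_s q. -/
theorem fderiv_homogAlong_fst {p : ℝ × ℝ} (hp : u p ∈ D.endSet 1) :
    fderiv ℝ (D.homogAlong q u) p (1, 0)
      = D.homogAlong (fun s t x => deriv (fun σ => q σ t x) s + h s t x) u p
        - D.liouvilleAlong u (0, 1) p := by
  obtain ⟨j, hj⟩ := hG.twisted p.1 p.2
  have hqm : MDifferentiableAt (𝓡 k) 𝓘(ℝ, ℝ) (q p.1 p.2) (D.base (u p)) :=
    ((hG.smooth_q.slice p.1 p.2) _).mdifferentiableAt (by simp)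
  have hhm : MDifferentiableAt (𝓡 k) 𝓘(ℝ, ℝ) (h p.1 p.2) (D.base (u p)) :=
    ((hG.smooth_h.slice p.1 p.2) _).mdifferentiableAt (by simp)
  have h1 := D.diff_comp_twisted hα hΩ hj hp rfl (hG.q_pos p.1 p.2 _)
    (planeDiff u p (0, 1) - hamAt Ω (H p.1 p.2) (u p))
  rw [← endAt_planeDiff hJ hu p, (hJ.memAcs p.1).endAt_endAt,
    ← D.diffAt_homogeneous hp.1 rfl hqm, endAt_planeDiff hJ hu p, map_neg, map_sub, map_sub,
    (D.dbase_dradius_hamAt hα hΩ hp.1 rfl (h := h p.1 p.2) fun v => by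
      rw [hG.diffAt_ham p.1 p.2 hp]
      exact D.diffAt_homogeneous hp.1 rfl hhm v).1, (D.contactAt_spec hα hΩ _ _).1] at h1
  change -(diffAt (D.homog (q p.1 p.2)) (u p) (planeDiff u p (1, 0))) = _ at h1
  rw [fderiv_homogAlong hu.smooth hp.1 hG.smooth_q]
  simp only [homogAlong, homog, liouvilleAlong] at h1 ⊢
  linear_combination -h1

/-- Here dQ ∘ J = λ is applied to ∂_s u. It gives dQ(∂_t u) - dQ(X_H) = λ(∂_s u), and dQ(X_H) is r
times `bracketAt`. -/
theorem fderiv_homogAlong_snd {p : ℝ × ℝ} (hp : u p ∈ D.endSet 1) :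
    fderiv ℝ (D.homogAlong q u) p (0, 1)
      = D.homogAlong (fun s t x => deriv (fun τ => q s τ x) t + bracketAt α (h s t) (q s t) x) u p
        + D.liouvilleAlong u (1, 0) p := by
  obtain ⟨j, hj⟩ := hG.twisted p.1 p.2
  have hqm : MDifferentiableAt (𝓡 k) 𝓘(ℝ, ℝ) (q p.1 p.2) (D.base (u p)) :=
    ((hG.smooth_q.slice p.1 p.2) _).mdifferentiableAt (by simp)
  have hhm : MDifferentiableAt (𝓡 k) 𝓘(ℝ, ℝ) (h p.1 p.2) (D.base (u p)) :=
    ((hG.smooth_h.slice p.1 p.2) _).mdifferentiableAt (by simp)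
  have h1 := D.diff_comp_twisted hα hΩ hj hp rfl (hG.q_pos p.1 p.2 _) (planeDiff u p (1, 0))
  rw [← D.diffAt_homogeneous hp.1 rfl hqm, endAt_planeDiff hJ hu p] at h1
  have h2 := diffAt_homog_hamAt (D := D) hα hΩ (G := H p.1 p.2) hp.1 rfl hhm hqm
    (hG.diffAt_ham p.1 p.2 hp)
  change diffAt (D.homog (q p.1 p.2)) (u p) _ = _ at h1
  rw [map_sub, h2] at h1
  rw [fderiv_homogAlong hu.smooth hp.1 hG.smooth_q]
  simp only [homogAlong, homog, liouvilleAlong] at h1 ⊢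
  linear_combination h1

end Floer

end ModelledAtInfinity

/-! ### Differential inequalities along Floer solutions -/

namespace ModelledAtInfinity

variable {k d : ℕ} {S M : Type*}
  [TopologicalSpace S] [ChartedSpace (EuclideanSpace ℝ (Fin k)) S] [IsManifold (𝓡 k) ∞ S]
  [TopologicalSpace M] [ChartedSpace (EuclideanSpace ℝ (Fin d)) M] [IsManifold (𝓡 d) ∞ M]
  [CompactSpace S]
  {α : OneForm k S} {Ω : BilinField d M} {D : ModelledAtInfinity α Ω}
  {H : ℝ → ℝ → M → ℝ} {J : ℝ → ℝ → EndField d M} {h q : ℝ → ℝ → S → ℝ}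

theorem abs_le_of_sq_le_mul_sq {x C R n : ℝ} (hC : 1 ≤ C) (hR : 0 ≤ R) (hn : 0 ≤ n)
    (h : x ^ 2 ≤ C * R * n ^ 2) : |x| ≤ C * (√R * n) := by
  refine abs_le_of_sq_le_sq (h.trans ?_) (by positivity)
  rw [mul_pow, mul_pow, Real.sq_sqrt hR]
  nlinarith [mul_nonneg hR (sq_nonneg n), mul_nonneg (mul_nonneg hR (sq_nonneg n)) (sub_nonneg.2 hC)]

variable (hα : IsContactForm α) (hΩ : IsSymplecticForm Ω) (hJ : D.IsContinuationAcs J)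
  (hG : D.EndGeometry H J h q)

include hα hΩ hJ hG

/-- Bounds for the derivatives of one-homogeneous functions along Floer solutions. -/
theorem exists_diffAt_homog_planeDiff_le {φ : ℝ → ℝ → S → ℝ} (hφ : SmoothFamily k φ)
    (hφt : Tame φ) : ∃ C : ℝ, 0 < C ∧ ∀ E u, IsFloerSolution Ω H J E u → ∀ p, u p ∈ D.endSet 1 →
      |diffAt (k := d) (D.homog (φ p.1 p.2)) (u p) (planeDiff u p (1, 0))|
        ≤ C * (√(D.radius (u p)) * gradNorm Ω J u p) ∧
      |diffAt (k := d) (D.homog (φ p.1 p.2)) (u p) (endAt (J p.1 p.2) (u p) (planeDiff u p (1, 0)))|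
        ≤ C * (√(D.radius (u p)) * gradNorm Ω J u p) ∧
      |diffAt (k := d) (D.homog (φ p.1 p.2)) (u p) (hamAt Ω (H p.1 p.2) (u p))| ≤ C * D.radius (u p) := by
  obtain ⟨C₀, hC₀, hb⟩ := hG.exists_diffAt_homog_sq_le hα hΩ hJ hφ hφt
  obtain ⟨C₁, hC₁, hX⟩ := hG.exists_normSqAt_hamAt_le hα hΩ hJ
  refine ⟨(C₀ + 1) * (C₁ + 1), by positivity, fun E u hu p hp => ?_⟩
  have hR := (D.radius_pos hp.1).le
  have hg : 0 ≤ gradNorm Ω J u p := Real.sqrt_nonneg _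
  have hgs := gradNorm_sq (u := u) hJ p
  have hC : C₀ ≤ (C₀ + 1) * (C₁ + 1) := by nlinarith [mul_pos hC₀ hC₁]
  have hC1 : 1 ≤ (C₀ + 1) * (C₁ + 1) := by nlinarith [mul_pos hC₀ hC₁]
  have key : ∀ v, normSqAt Ω (J p.1 p.2) (u p) v = gradNorm Ω J u p ^ 2 →
      |diffAt (k := d) (D.homog (φ p.1 p.2)) (u p) v|
        ≤ (C₀ + 1) * (C₁ + 1) * (√(D.radius (u p)) * gradNorm Ω J u p) := fun v hv => by
    refine abs_le_of_sq_le_mul_sq hC1 hR hg ((hb p.1 p.2 _ hp v).trans ?_)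
    rw [hv]
    gcongr
  refine ⟨key _ hgs.symm, key _ ?_, ?_⟩
  · rw [(hJ.memAcs p.1).normSqAt_endAt hΩ, hgs]
  · refine abs_le_of_sq_le_sq ((hb p.1 p.2 _ hp _).trans ?_) (by positivity)
    calc C₀ * D.radius (u p) * normSqAt Ω (J p.1 p.2) (u p) (hamAt Ω (H p.1 p.2) (u p))
        ≤ C₀ * D.radius (u p) * (C₁ * D.radius (u p)) := by
          gcongr; exact hX p.1 p.2 _ hp
      _ = C₀ * C₁ * D.radius (u p) ^ 2 := by ring
      _ ≤ ((C₀ + 1) * (C₁ + 1) * D.radius (u p)) ^ 2 := by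
          rw [mul_pow]
          gcongr
          nlinarith [mul_pos hC₀ hC₁]

/-- Bounds for the derivatives of the radius along Floer solutions. -/
theorem exists_fderiv_radius_le : ∃ C : ℝ, 0 < C ∧ ∀ E u, IsFloerSolution Ω H J E u →
    ∀ p, u p ∈ D.endSet 1 →
      |fderiv ℝ (fun p => D.radius (u p)) p (1, 0)|
        ≤ C * (√(D.radius (u p)) * gradNorm Ω J u p) ∧
      |fderiv ℝ (fun p => D.radius (u p)) p (0, 1)|
        ≤ C * (√(D.radius (u p)) * gradNorm Ω J u p) + C * D.radius (u p) := by
  obtain ⟨C, hC, hb⟩ := exists_diffAt_homog_planeDiff_le hα hΩ hJ hG (φ := fun _ _ _ => 1)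
    contMDiff_const (Tame.const _)
  refine ⟨C, hC, fun E u hu p hp => ?_⟩
  have h1 (v : EuclideanSpace ℝ (Fin d)) :
      diffAt (D.homog fun _ => 1) (u p) v = D.dradius (u p) v := by
    have : D.homog (fun _ => (1 : ℝ)) = D.radius := funext fun z => mul_one _
    rw [this]
    rfl
  obtain ⟨h2, h3, h4⟩ := hb E u hu p hp
  rw [h1] at h2 h3 h4
  rw [fderiv_radius_comp hu.smooth hp.1, fderiv_radius_comp hu.smooth hp.1]
  refine ⟨h2, ?_⟩
  have h5 : planeDiff u p (0, 1) = endAt (J p.1 p.2) (u p) (planeDiff u p (1, 0))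
      + hamAt Ω (H p.1 p.2) (u p) := by rw [endAt_planeDiff hJ hu p, sub_add_cancel]
  rw [h5, map_add]
  exact (abs_add_le _ _).trans (add_le_add h3 h4)

/-- The function `Q = r q` along Floer solutions has a Laplacian that is bounded below. -/
theorem exists_laplacian_ge : ∃ C : ℝ, 0 < C ∧ ∀ E u, IsFloerSolution Ω H J E u →
    ∀ p, u p ∈ D.endSet 1 → -(C * D.radius (u p)) ≤
      fderiv ℝ (fun p' => fderiv ℝ (D.homogAlong q u) p' (1, 0)) p (1, 0)
      + fderiv ℝ (fun p' => fderiv ℝ (D.homogAlong q u) p' (0, 1)) p (0, 1) := by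
  set A : ℝ → ℝ → S → ℝ := fun s t x => deriv (fun σ => q σ t x) s + h s t x with hAdef
  set B : ℝ → ℝ → S → ℝ := fun s t x =>
    deriv (fun τ => q s τ x) t + bracketAt α (h s t) (q s t) x with hBdef
  have hA : SmoothFamily k A := hG.smooth_q.deriv_fst.add hG.smooth_h
  have hB : SmoothFamily k B := hG.smooth_q.deriv_snd.add
    (smoothFamily_bracketAt hα hΩ D hG.smooth_h hG.smooth_q)
  have hAt : Tame A := hG.tame_q.deriv_fst.map₂ hG.tame_h fun a b x => a x + b x
  have hBt : Tame B := hG.tame_q.deriv_snd.map₂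
    (hG.tame_h.map₂ hG.tame_q fun h q => bracketAt α h q) fun a b x => a x + b x
  obtain ⟨C₁, hC₁, hb₁⟩ := hAt.deriv_fst.exists_bound hA.deriv_fst.continuous
  obtain ⟨C₂, hC₂, hb₂⟩ := hBt.deriv_snd.exists_bound hB.deriv_snd.continuous
  obtain ⟨C₃, hC₃, hb₃⟩ := exists_diffAt_homog_planeDiff_le hα hΩ hJ hG hA hAt
  obtain ⟨C₄, hC₄, hb₄⟩ := exists_diffAt_homog_planeDiff_le hα hΩ hJ hG hB hBt
  obtain ⟨C₅, hC₅, hb₅⟩ := exists_diffAt_homog_planeDiff_le hα hΩ hJ hG hG.smooth_h hG.tame_h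
  -- C₁, C₂ and C₄ bound the terms of order r: the explicit s- and t-derivatives, and the derivative
  -- of r B along X_H. The square comes from Young's inequality, which absorbs into g² the terms of
  -- order √r g; these come from A, from B and from dH(∂_s u).
  refine ⟨C₁ + C₂ + C₄ + (C₃ + C₄ + C₅) ^ 2, by positivity, fun E u hu p hp => ?_⟩
  have hR := D.radius_pos hp.1
  have hev : ∀ᶠ p' in 𝓝 p, u p' ∈ D.endSet 1 :=
    hu.smooth.continuous.continuousAt.eventually (D.isOpen_endSet_one.mem_nhds hp)
  have e1 : (fun p' => fderiv ℝ (D.homogAlong q u) p' (1, 0)) =ᶠ[𝓝 p]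
      fun p' => D.homogAlong A u p' - D.liouvilleAlong u (0, 1) p' := by
    filter_upwards [hev] with p' hp'
    exact fderiv_homogAlong_fst hα hΩ hJ hG hu hp'
  have e2 : (fun p' => fderiv ℝ (D.homogAlong q u) p' (0, 1)) =ᶠ[𝓝 p]
      fun p' => D.homogAlong B u p' + D.liouvilleAlong u (1, 0) p' := by
    filter_upwards [hev] with p' hp'
    exact fderiv_homogAlong_snd hα hΩ hJ hG hu hp'
  have dA := (contDiffAt_homogAlong hu.smooth hp.1 hA).differentiableAt (by simp)
  have dB := (contDiffAt_homogAlong hu.smooth hp.1 hB).differentiableAt (by simp)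
  have dL (e : ℝ × ℝ) := (differentiableAt_liouvilleAlong hu.smooth hp.1 hα e).1
  -- The λ-terms of the two first-order identities enter the Laplacian exactly as minus the
  -- left-hand side of this formula.
  have hst := fderiv_liouvilleAlong hu.smooth hp.1 hα (1, 0) (0, 1)
  rw [e1.fderiv_eq, e2.fderiv_eq, fderiv_fun_sub dA (dL _), fderiv_fun_add dB (dL _)]
  simp only [sub_apply, add_apply]
  rw [fderiv_homogAlong hu.smooth hp.1 hA, fderiv_homogAlong hu.smooth hp.1 hB]
  have h5 : planeDiff u p (0, 1) = endAt (J p.1 p.2) (u p) (planeDiff u p (1, 0))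
      + hamAt Ω (H p.1 p.2) (u p) := by rw [endAt_planeDiff hJ hu p, sub_add_cancel]
  -- With ∂_t u = J ∂_s u + X_H, the area term ω(∂_s u, ∂_t u) becomes -g² + dH(∂_s u).
  rw [h5, map_add, hΩ.bilinAt_swap, hΩ.bilinAt_swap (u p) (planeDiff u p (1, 0)) (hamAt _ _ _),
    hΩ.bilinAt_hamAt, hG.diffAt_ham p.1 p.2 hp] at hst
  rw [h5, map_add]
  have hN : bilinAt Ω (u p) (endAt (J p.1 p.2) (u p) (planeDiff u p (1, 0)))
      (planeDiff u p (1, 0)) = gradNorm Ω J u p ^ 2 := (gradNorm_sq hJ p).symm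
  rw [hN] at hst
  obtain ⟨a1, -, -⟩ := hb₃ E u hu p hp
  obtain ⟨-, b1, b2⟩ := hb₄ E u hu p hp
  obtain ⟨c1, -, -⟩ := hb₅ E u hu p hp
  have a0 := hb₁ p.1 p.2 (D.base (u p))
  have b0 := hb₂ p.1 p.2 (D.base (u p))
  have a0' := mul_le_mul_of_nonneg_left (abs_le.1 a0).1 hR.le
  have b0' := mul_le_mul_of_nonneg_left (abs_le.1 b0).1 hR.le
  have a1' := (abs_le.1 a1).1
  have b1' := (abs_le.1 b1).1
  have b2' := (abs_le.1 b2).1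
  have c1' := (abs_le.1 c1).2
  have hsq : √(D.radius (u p)) ^ 2 = D.radius (u p) := Real.sq_sqrt hR.le
  have young := sq_nonneg (gradNorm Ω J u p - (C₃ + C₄ + C₅) * √(D.radius (u p)))
  have young2 := mul_nonneg (sq_nonneg (C₃ + C₄ + C₅)) hR.le
  have young3 := sq_nonneg (gradNorm Ω J u p)
  have hexp : (gradNorm Ω J u p - (C₃ + C₄ + C₅) * √(D.radius (u p))) ^ 2
      = gradNorm Ω J u p ^ 2 - 2 * ((C₃ + C₄ + C₅) * (√(D.radius (u p)) * gradNorm Ω J u p))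
        + (C₃ + C₄ + C₅) ^ 2 * D.radius (u p) := by
    rw [← hsq, Real.sqrt_sq (Real.sqrt_nonneg _)]
    ring
  rw [hexp] at young
  simp only [one_mul, zero_mul, add_zero, zero_add]
  nlinarith

end ModelledAtInfinity

/-! ### One-variable estimates -/

section Growth

/-- A function that is differentiable where it is larger than `m`, with derivative bounded by `k`,
grows at most by the integral of `k`. -/
theorem le_add_integral_of_hasDerivAt {w κ : ℝ → ℝ} {m a b : ℝ} (hab : a ≤ b)
    (hw : Continuous w) (hκ : Continuous κ) (hκ0 : ∀ x, 0 ≤ κ x)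
    (hd : ∀ x ∈ Icc a b, m < w x → ∃ δ, HasDerivAt w δ x ∧ |δ| ≤ κ x) (ha : m ≤ w a) :
    w b ≤ w a + ∫ x in a..b, κ x := by
  have hint : ∀ x y, IntervalIntegrable κ MeasureTheory.volume x y := fun x y =>
    hκ.intervalIntegrable x y
  have hK : IsCompact (Icc a b ∩ {x | w x ≤ w a}) :=
    isCompact_Icc.inter_right (isClosed_le hw continuous_const)
  -- `c` is the last point at which w ≤ w a. Behind it w stays above m, so that the derivative bound
  -- is available up to b.
  obtain ⟨c, ⟨hc, hwc⟩, hmax⟩ := hK.exists_isGreatest ⟨a, ⟨le_rfl, hab⟩, le_refl (w a)⟩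
  have hdd : ∀ x ∈ Ioo c b, ∃ δ, HasDerivAt w δ x ∧ |δ| ≤ κ x := fun x hx => by
    refine hd x ⟨hc.1.trans hx.1.le, hx.2.le⟩ (ha.trans_lt ?_)
    by_contra! h
    exact absurd (hmax ⟨⟨hc.1.trans hx.1.le, hx.2.le⟩, h⟩) (not_le.2 hx.1)
  have hI : ∀ x, HasDerivAt (fun y => ∫ z in c..y, κ z) (κ x) x := fun x =>
    (hκ.integral_hasStrictDerivAt c x).hasDerivAt
  have hanti : AntitoneOn (fun x => w x - ∫ z in c..x, κ z) (Icc c b) := by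
    refine antitoneOn_of_deriv_nonpos (convex_Icc c b) ?_ ?_ ?_
    · exact (hw.sub (continuous_iff_continuousAt.2 fun x => (hI x).continuousAt)).continuousOn
    · rw [interior_Icc]
      intro x hx
      obtain ⟨δ, h1, -⟩ := hdd x hx
      exact (h1.sub (hI x)).differentiableAt.differentiableWithinAt
    · rw [interior_Icc]
      intro x hx
      obtain ⟨δ, h1, h2⟩ := hdd x hx
      rw [(h1.fun_sub (hI x)).deriv]
      linarith [le_abs_self δ]
  have h1 := hanti ⟨le_rfl, hc.2⟩ ⟨hc.2, le_rfl⟩ hc.2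
  simp only [intervalIntegral.integral_same, sub_zero] at h1
  have h2 := intervalIntegral.integral_add_adjacent_intervals (hint a c) (hint c b)
  have h3 : 0 ≤ ∫ x in a..c, κ x := intervalIntegral.integral_nonneg hc.1 fun x _ => hκ0 x
  have h4 : w c ≤ w a := hwc
  linarith

/-- The growth estimate, applied to w and to its reflection x ↦ w (-x). -/
theorem abs_sub_le_integral_of_hasDerivAt {w κ : ℝ → ℝ} {m a b : ℝ} (hab : a ≤ b)
    (hw : Continuous w) (hκ : Continuous κ) (hκ0 : ∀ x, 0 ≤ κ x) (hm : ∀ x, m ≤ w x)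
    (hd : ∀ x, m < w x → ∃ δ, HasDerivAt w δ x ∧ |δ| ≤ κ x) :
    |w b - w a| ≤ ∫ x in a..b, κ x := by
  have h1 := le_add_integral_of_hasDerivAt hab hw hκ hκ0 (fun x _ => hd x) (hm a)
  have h2 := le_add_integral_of_hasDerivAt (w := fun x => w (-x)) (κ := fun x => κ (-x)) (m := m)
    (neg_le_neg hab) (hw.comp continuous_neg) (hκ.comp continuous_neg) (fun x => hκ0 _)
    (fun x _ hx => by
      obtain ⟨δ, h3, h4⟩ := hd (-x) hx
      refine ⟨-δ, ?_, by rwa [abs_neg]⟩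
      have h5 : HasDerivAt (fun x => w (-x)) (δ * -1) x := h3.comp x (hasDerivAt_neg x)
      rwa [mul_neg_one] at h5) (hm _)
  simp only [neg_neg, intervalIntegral.integral_comp_neg] at h2
  rw [abs_le]
  constructor <;> linarith

/-- A continuous function takes a value that is at most its mean. -/
theorem exists_mul_le_integral {e : ℝ → ℝ} (he : Continuous e) {a b : ℝ} (hab : a < b) :
    ∃ s ∈ Icc a b, (b - a) * e s ≤ ∫ x in a..b, e x := by
  obtain ⟨s, hs, hmin⟩ := (isCompact_Icc (a := a) (b := b)).exists_isMinOn ⟨a, le_rfl, hab.le⟩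
    he.continuousOn
  refine ⟨s, hs, ?_⟩
  have := intervalIntegral.integral_mono_on (μ := MeasureTheory.volume) hab.le
    ((continuous_const (y := e s)).intervalIntegrable a b) (he.intervalIntegrable a b)
    fun x hx => hmin hx
  simpa using this

/-- A positive second derivative would make the point a local minimum as well; then w would be
locally constant and its second derivative zero. -/
theorem IsLocalMax.deriv_deriv_nonpos {w : ℝ → ℝ} {x : ℝ} (h : IsLocalMax w x)
    (hc : ContinuousAt w x) : deriv (deriv w) x ≤ 0 := by
  by_contra! hpos
  have h1 := isLocalMin_of_deriv_deriv_pos hpos h.deriv_eq_zero hc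
  have h2 : w =ᶠ[𝓝 x] fun _ => w x := by
    filter_upwards [h, h1] with y hy hy' using le_antisymm hy hy'
  have h3 : deriv w =ᶠ[𝓝 x] fun _ => 0 := by
    filter_upwards [h2.eventuallyEq_nhds] with y hy
    rw [hy.deriv_eq, deriv_const]
  rw [h3.deriv_eq, deriv_const] at hpos
  exact lt_irrefl _ hpos

end Growth

/-! ### Bounding the radius of a profile -/

/-- The properties of the radius `ψ`, the norm `g` of the gradient and the function `f = Q` along a
Floer solution that imply a bound of the radius. -/
structure IsProfile (C c E B : ℝ) (ψ g f : ℝ × ℝ → ℝ) : Prop where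
  continuous_radius : Continuous ψ
  one_le : ∀ p, 1 ≤ ψ p
  continuous_grad : Continuous g
  grad_nonneg : ∀ p, 0 ≤ g p
  periodic_radius : ∀ s t, ψ (s, t + 1) = ψ (s, t)
  periodic : ∀ s t, f (s, t + 1) = f (s, t)
  deriv_fst : ∀ s t, 1 < ψ (s, t) →
    ∃ δ, HasDerivAt (fun σ => ψ (σ, t)) δ s ∧ |δ| ≤ C * (√(ψ (s, t)) * g (s, t))
  deriv_snd : ∀ s t, 1 < ψ (s, t) →
    ∃ δ, HasDerivAt (fun τ => ψ (s, τ)) δ t ∧ |δ| ≤ C * (√(ψ (s, t)) * g (s, t)) + C * ψ (s, t)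
  contDiffAt : ∀ p, 1 < ψ p → ContDiffAt ℝ 2 f p
  le : ∀ p, 1 < ψ p → c * ψ p ≤ f p
  ge : ∀ p, 1 < ψ p → f p ≤ C * ψ p
  laplacian : ∀ s t, 1 < ψ (s, t) → -(C * f (s, t)) ≤
    deriv (deriv fun σ => f (σ, t)) s + deriv (deriv fun τ => f (s, τ)) t
  good : ∀ s, (s ≤ 0 ∨ 1 ≤ s) → ∫ t in (0 : ℝ)..1, g (s, t) ^ 2 ≤ E → ∀ t, ψ (s, t) ≤ B
  energy : ∀ a b, a ≤ b → ∫ s in a..b, ∫ t in (0 : ℝ)..1, g (s, t) ^ 2 ≤ E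

/-- The radius along one loop is comparable to its value at one point. -/
theorem log_le_of_loop {C G : ℝ} (hC : 0 ≤ C) {w n : ℝ → ℝ} (hw : Continuous w) (hn : Continuous n)
    (hn0 : ∀ t, 0 ≤ n t) (hw1 : ∀ t, 1 ≤ w t)
    (hd : ∀ t, 1 < w t → ∃ δ, HasDerivAt w δ t ∧ |δ| ≤ C * (√(w t) * n t) + C * w t)
    (hG : ∫ t in (0 : ℝ)..1, n t ^ 2 ≤ G) {t t' : ℝ} (ht : t ∈ Icc (0 : ℝ) 1)
    (ht' : t' ∈ Icc (0 : ℝ) 1) : w t' ≤ w t * Real.exp (C * (2 + G)) := by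
  have hpos : ∀ t, 0 < w t := fun t => one_pos.trans_le (hw1 t)
  have hlog : Continuous fun t => Real.log (w t) := hw.log fun t => (hpos t).ne'
  have hk : Continuous fun t => C * (2 + n t ^ 2) := by fun_prop
  have hk0 : ∀ t, 0 ≤ C * (2 + n t ^ 2) := fun t => by positivity
  -- After division by w ≥ 1, both √w n / w ≤ n ≤ 1 + n² and w / w = 1 are integrable with a bound
  -- by the loop energy.
  have hdl : ∀ t, 0 < Real.log (w t) →
      ∃ δ, HasDerivAt (fun t => Real.log (w t)) δ t ∧ |δ| ≤ C * (2 + n t ^ 2) := fun t h => by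
    have h1 : 1 < w t := (Real.log_pos_iff (hpos t).le).1 h
    obtain ⟨δ, h2, h3⟩ := hd t h1
    refine ⟨δ / w t, h2.log (hpos t).ne', ?_⟩
    rw [abs_div, abs_of_pos (hpos t), div_le_iff₀ (hpos t)]
    refine h3.trans ?_
    have h4 : √(w t) ≤ w t := by
      rw [Real.sqrt_le_left (hpos t).le]
      nlinarith
    have h5 : √(w t) * n t ≤ w t * n t := mul_le_mul_of_nonneg_right h4 (hn0 t)
    have h6 : w t * n t ≤ w t * (1 + n t ^ 2) :=
      mul_le_mul_of_nonneg_left (by nlinarith [sq_nonneg (n t - 1)]) (hpos t).le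
    nlinarith
  have key : ∀ a b : ℝ, 0 ≤ a → a ≤ b → b ≤ 1 →
      |Real.log (w b) - Real.log (w a)| ≤ C * (2 + G) := fun a b ha hab hb => by
    refine (abs_sub_le_integral_of_hasDerivAt hab hlog hk hk0
      (fun t => Real.log_nonneg (hw1 t)) hdl).trans ?_
    have h1 : ∫ x in a..b, C * (2 + n x ^ 2) ≤ ∫ x in (0 : ℝ)..1, C * (2 + n x ^ 2) :=
      intervalIntegral.integral_mono_interval ha hab hb (Eventually.of_forall hk0)
        (hk.intervalIntegrable _ _)
    refine h1.trans ?_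
    rw [intervalIntegral.integral_const_mul, intervalIntegral.integral_add
      (_root_.intervalIntegrable_const) (Continuous.intervalIntegrable (u := fun t => n t ^ 2) (by fun_prop) _ _)]
    simp only [intervalIntegral.integral_const, sub_zero, one_smul]
    gcongr
  have h1 : Real.log (w t') - Real.log (w t) ≤ C * (2 + G) := by
    rcases le_total t t' with h | h
    · exact (le_abs_self _).trans (key t t' ht.1 h ht'.2)
    · have := key t' t ht'.1 h ht.2
      rw [abs_sub_comm] at this
      exact (le_abs_self _).trans this
  have h2 : Real.log (w t') ≤ Real.log (w t * Real.exp (C * (2 + G))) := by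
    rw [Real.log_mul (hpos t).ne' (Real.exp_pos _).ne', Real.log_exp]
    linarith
  exact (Real.log_le_log_iff (hpos _) (mul_pos (hpos _) (Real.exp_pos _))).1 h2

namespace IsProfile

variable {C c E B : ℝ} {ψ g f : ℝ × ℝ → ℝ} (h : IsProfile C c E B ψ g f) (hC : 0 < C)
include h

theorem continuous_loopEnergy : Continuous fun s => ∫ t in (0 : ℝ)..1, g (s, t) ^ 2 := by
  refine intervalIntegral.continuous_parametric_intervalIntegral_of_continuous' ?_ _ _
  exact h.continuous_grad.pow 2

theorem exists_small_loop {a η : ℝ} (hη : 0 < η) :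
    ∃ s ∈ Icc a (a + η), ∫ t in (0 : ℝ)..1, g (s, t) ^ 2 ≤ E / η := by
  obtain ⟨s, hs, h1⟩ := exists_mul_le_integral h.continuous_loopEnergy
    (show a < a + η by linarith)
  refine ⟨s, hs, ?_⟩
  have h2 := h1.trans (h.energy a (a + η) (by linarith))
  rw [le_div_iff₀ hη]
  linarith

theorem exists_good_loop (s : ℝ) : ∃ s₀, |s - s₀| ≤ 2 ∧ ∀ t, ψ (s₀, t) ≤ B := by
  -- The windows [s - 1, s], [s, s + 1] and [-1, 0], for s ≤ 0, s ≥ 1 and 0 < s < 1, avoid (0, 1),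
  -- have length one and are within distance 2 of s.
  obtain ⟨s₁, h1, h2⟩ := h.exists_small_loop (a := if s ≤ 0 then s - 1 else if 1 ≤ s then s else -1)
    one_pos
  rw [div_one] at h2
  refine ⟨s₁, ?_, h.good s₁ ?_ h2⟩
  · split_ifs at h1 <;> rw [abs_le] <;> constructor <;> linarith [h1.1, h1.2]
  · split_ifs at h1
    · left; linarith [h1.2]
    · right; linarith [h1.1]
    · left; linarith [h1.2]

theorem periodic_fract (s t : ℝ) : ψ (s, Int.fract t) = ψ (s, t) ∧ f (s, Int.fract t) = f (s, t) := by
  have h1 : Function.Periodic (fun t => ψ (s, t)) 1 := h.periodic_radius s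
  have h2 : Function.Periodic (fun t => f (s, t)) 1 := h.periodic s
  have e1 := h1.sub_int_mul_eq (x := t) ⌊t⌋
  have e2 := h2.sub_int_mul_eq (x := t) ⌊t⌋
  rw [mul_one, Int.self_sub_floor] at e1 e2
  exact ⟨e1, e2⟩

include hC

/-- The square root turns |∂_s ψ| ≤ C √ψ g into |∂_s √ψ| ≤ C g / 2, a bound without ψ that can be
integrated directly. Where ψ = 1 no derivative is needed, as √ψ is at its minimum. -/
theorem abs_sqrt_sub_le {a b : ℝ} (hab : a ≤ b) (t : ℝ) :
    |√(ψ (b, t)) - √(ψ (a, t))| ≤ ∫ s in a..b, C * (1 + g (s, t) ^ 2) := by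
  have hc1 : Continuous fun s => ψ (s, t) := h.continuous_radius.comp (by fun_prop)
  have hc2 : Continuous fun s => g (s, t) := h.continuous_grad.comp (by fun_prop)
  refine abs_sub_le_integral_of_hasDerivAt (w := fun s => √(ψ (s, t))) (m := 1) hab
    hc1.sqrt (continuous_const.mul (continuous_const.add (hc2.pow 2))) (fun s => by positivity) (fun s => ?_) fun s hs => ?_
  · rw [Real.one_le_sqrt]; exact h.one_le _
  · have h1 : 1 < ψ (s, t) := by
      rwa [Real.lt_sqrt zero_le_one, one_pow] at hs
    obtain ⟨δ, h2, h3⟩ := h.deriv_fst s t h1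
    have h4 : 0 < √(ψ (s, t)) := by positivity
    refine ⟨δ / (2 * √(ψ (s, t))), h2.sqrt (by positivity), ?_⟩
    rw [abs_div, abs_of_pos (show 0 < 2 * √(ψ (s, t)) by positivity), div_le_iff₀ (by positivity)]
    refine h3.trans ?_
    have h5 : g (s, t) ≤ 2 * (1 + g (s, t) ^ 2) := by nlinarith [sq_nonneg (g (s, t) - 1)]
    calc C * (√(ψ (s, t)) * g (s, t)) ≤ C * (√(ψ (s, t)) * (2 * (1 + g (s, t) ^ 2))) := by gcongr
      _ = _ := by ring

/-- Every loop contains a point of bounded radius. -/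
theorem exists_radius_le (s : ℝ) :
    ∃ t ∈ Icc (0 : ℝ) 1, ψ (s, t) ≤ (√B + C * (2 + E)) ^ 2 := by
  obtain ⟨s₀, h1, h2⟩ := h.exists_good_loop s
  have key : ∀ a b : ℝ, a ≤ b → b - a ≤ 2 → ∃ t ∈ Icc (0 : ℝ) 1,
      |√(ψ (b, t)) - √(ψ (a, t))| ≤ C * (2 + E) := fun a b hab hle => by
    have hc : Continuous fun p : ℝ × ℝ => g p ^ 2 := h.continuous_grad.pow 2
    -- By Fubini, the mean over t of ∫ g² ds is at most E, so some line t = const satisfies the same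
    -- bound.
    have hsw : ∫ t in (0 : ℝ)..1, ∫ s in a..b, g (s, t) ^ 2
        = ∫ s in a..b, ∫ t in (0 : ℝ)..1, g (s, t) ^ 2 := by
      rw [intervalIntegral.integral_of_le hab]
      simp_rw [intervalIntegral.integral_of_le hab]
      rw [MeasureTheory.intervalIntegral_integral_swap]
      rw [uIoc_of_le zero_le_one, MeasureTheory.Measure.prod_restrict]
      have h3 : MeasureTheory.IntegrableOn (fun p : ℝ × ℝ => g (p.2, p.1) ^ 2)
          (Icc (0 : ℝ) 1 ×ˢ Icc a b) :=
        (hc.comp (by fun_prop : Continuous fun p : ℝ × ℝ => (p.2, p.1))).continuousOn.integrableOn_compact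
          (isCompact_Icc.prod isCompact_Icc)
      exact h3.mono_set (prod_mono Ioc_subset_Icc_self Ioc_subset_Icc_self)
    have hcont : Continuous fun t => ∫ s in a..b, g (s, t) ^ 2 := by
      refine intervalIntegral.continuous_parametric_intervalIntegral_of_continuous' ?_ _ _
      exact hc.comp (by fun_prop : Continuous fun p : ℝ × ℝ => (p.2, p.1))
    obtain ⟨t, ht, h3⟩ := exists_mul_le_integral hcont one_pos
    refine ⟨t, ht, (h.abs_sqrt_sub_le hC hab t).trans ?_⟩
    rw [hsw, sub_zero, one_mul] at h3
    have h4 := h3.trans (h.energy a b hab)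
    have hc2 : Continuous fun s => g (s, t) := h.continuous_grad.comp (by fun_prop)
    rw [intervalIntegral.integral_const_mul, intervalIntegral.integral_add
      (_root_.intervalIntegrable_const) (Continuous.intervalIntegrable (u := fun s => g (s, t) ^ 2) (hc2.pow 2) _ _)]
    simp only [intervalIntegral.integral_const, smul_eq_mul, mul_one]
    gcongr
  obtain ⟨t, ht, h3⟩ : ∃ t ∈ Icc (0 : ℝ) 1, √(ψ (s, t)) - √(ψ (s₀, t)) ≤ C * (2 + E) := by
    rcases le_total s₀ s with h4 | h4
    · obtain ⟨t, ht, h5⟩ := key s₀ s h4 ((le_abs_self _).trans h1)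
      exact ⟨t, ht, (le_abs_self _).trans h5⟩
    · rw [abs_sub_comm] at h1
      obtain ⟨t, ht, h5⟩ := key s s₀ h4 ((le_abs_self _).trans h1)
      rw [abs_sub_comm] at h5
      exact ⟨t, ht, (le_abs_self _).trans h5⟩
  refine ⟨t, ht, ?_⟩
  have h4 : √(ψ (s₀, t)) ≤ √B := Real.sqrt_le_sqrt (h2 t)
  have h5 : √(ψ (s, t)) ≤ √B + C * (2 + E) := by linarith
  have h6 := h.one_le (s, t)
  calc ψ (s, t) = √(ψ (s, t)) ^ 2 := (Real.sq_sqrt (by linarith)).symm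
    _ ≤ _ := by gcongr

/-- One point of bounded radius exists on every loop; the energy of this loop controls the
oscillation of log ψ along it. -/
theorem radius_le_of_small_loop {s G : ℝ} (hG : ∫ t in (0 : ℝ)..1, g (s, t) ^ 2 ≤ G)
    (t : ℝ) : ψ (s, t) ≤ (√B + C * (2 + E)) ^ 2 * Real.exp (C * (2 + G)) := by
  obtain ⟨t₀, ht₀, h1⟩ := h.exists_radius_le hC s
  have h2 := log_le_of_loop hC.le (w := fun t => ψ (s, t)) (n := fun t => g (s, t))
    (h.continuous_radius.comp (by fun_prop)) (h.continuous_grad.comp (by fun_prop))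
    (fun t => h.grad_nonneg _) (fun t => h.one_le _) (h.deriv_snd s) hG ht₀
    (t' := Int.fract t) ⟨Int.fract_nonneg _, (Int.fract_lt_one _).le⟩
  rw [(h.periodic_fract s t).1] at h2
  exact h2.trans (by gcongr)

/-- The maximum principle on thin strips. -/
theorem le_of_strip {a b η A Λ : ℝ} (hηC : (C + 1) * (2 * η) ^ 2 ≤ 1) (hab : b - a ≤ 2 * η)
    (ha : ∀ t, ψ (a, t) ≤ A) (hb : ∀ t, ψ (b, t) ≤ A) (hΛ : C * max A 2 ≤ Λ)
    (hc : 0 < c) {s : ℝ} (hs : s ∈ Icc a b) (t : ℝ) : ψ (s, t) ≤ max 2 (2 * Λ / c) := by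
  have hΛ0 : 0 < Λ := lt_of_lt_of_le (by positivity) hΛ
  by_contra! hlt
  rw [max_lt_iff] at hlt
  -- The barrier. It lies between Λ and 2 Λ on the strip, because the strip is thin, and w'' = -2 (C
  -- + 1) Λ ≤ -(C + 1) w.
  set w : ℝ → ℝ := fun σ => Λ * (2 - (C + 1) * (σ - a) ^ 2) with hw
  have hw1 : ∀ σ ∈ Icc a b, Λ ≤ w σ := fun σ hσ => by
    have : (C + 1) * (σ - a) ^ 2 ≤ (C + 1) * (2 * η) ^ 2 := by
      gcongr
      · linarith [hσ.1]
      · linarith [hσ.2]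
    simp only [hw]
    nlinarith
  have hw2 : ∀ σ, w σ ≤ 2 * Λ := fun σ => by
    simp only [hw]
    nlinarith [mul_nonneg hΛ0.le (mul_nonneg (by linarith : (0 : ℝ) ≤ C + 1) (sq_nonneg (σ - a)))]
  have hwc : Continuous w := by fun_prop
  set K : Set (ℝ × ℝ) := (Icc a b ×ˢ Icc (0 : ℝ) 1) ∩ {p | 2 ≤ ψ p} with hKdef
  have hK : IsCompact K :=
    (isCompact_Icc.prod isCompact_Icc).inter_right (isClosed_le continuous_const h.continuous_radius)
  have hmem : (s, Int.fract t) ∈ K :=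
    ⟨⟨hs, Int.fract_nonneg _, (Int.fract_lt_one _).le⟩, by
      change 2 ≤ ψ (s, Int.fract t)
      rw [(h.periodic_fract s t).1]; exact hlt.1.le⟩
  have hquot : ContinuousOn (fun p : ℝ × ℝ => f p / w p.1) K := by
    intro p hp
    refine ContinuousAt.continuousWithinAt (ContinuousAt.div ?_ ?_ ?_)
    · exact (h.contDiffAt p (by linarith [show 2 ≤ ψ p from hp.2])).continuousAt
    · exact (hwc.comp continuous_fst).continuousAt
    · exact (hΛ0.trans_le (hw1 p.1 hp.1.1)).ne'
  obtain ⟨p₀, hp₀, hmax⟩ := hK.exists_isMaxOn ⟨_, hmem⟩ hquot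
  obtain ⟨s₀, t₀⟩ := p₀
  set μ := f (s₀, t₀) / w s₀ with hμ
  have hw0 : 0 < w s₀ := hΛ0.trans_le (hw1 s₀ hp₀.1.1)
  have hf0 : f (s₀, t₀) = μ * w s₀ := by rw [hμ]; field_simp
  -- At the point that violates the claim, f ≥ c ψ > 2 Λ ≥ w.
  have hμ1 : 1 < μ := by
    have h1 : f (s, Int.fract t) / w s ≤ μ := hmax hmem
    refine lt_of_lt_of_le ?_ h1
    rw [(h.periodic_fract s t).2, one_lt_div (hΛ0.trans_le (hw1 s hs))]
    have h2 := h.le (s, t) (by linarith)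
    have h3 := hlt.2
    rw [div_lt_iff₀ hc] at h3
    linarith [hw2 s]
  have hf1 : Λ < f (s₀, t₀) := by
    rw [hf0]
    nlinarith [hw1 s₀ hp₀.1.1]
  have hψ1 : 1 < ψ (s₀, t₀) := by linarith [show 2 ≤ ψ (s₀, t₀) from hp₀.2]
  -- From C ψ ≥ f > Λ ≥ C max A 2. So the maximum lies neither on the boundary loops, where ψ ≤ A,
  -- nor on the level ψ = 2.
  have hψ : max A 2 < ψ (s₀, t₀) := by
    have h1 := h.ge _ hψ1
    exact lt_of_mul_lt_mul_left (a := C) (by linarith) hC.le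
  rw [max_lt_iff] at hψ
  have has : a < s₀ := lt_of_le_of_ne hp₀.1.1.1 fun he => by
    subst he; exact absurd (ha t₀) (not_le.2 hψ.1)
  have hsb : s₀ < b := lt_of_le_of_ne hp₀.1.1.2 fun he => by
    subst he; exact absurd (hb t₀) (not_le.2 hψ.1)
  -- Periodicity moves nearby points back to t in [0, 1], so the maximum is local in the plane even
  -- if t₀ is 0 or 1.
  have hloc : ∀ᶠ p in 𝓝 (s₀, t₀), f p ≤ μ * w p.1 := by
    filter_upwards [h.continuous_radius.continuousAt.eventually (Ioi_mem_nhds hψ.2),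
      continuous_fst.continuousAt.eventually (Ioo_mem_nhds has hsb)] with p hp1 hp2
    have hp3 : p.1 ∈ Icc a b := ⟨hp2.1.le, hp2.2.le⟩
    have h1 : f (p.1, Int.fract p.2) / w p.1 ≤ μ :=
      hmax (show (p.1, Int.fract p.2) ∈ K from
        ⟨⟨hp3, Int.fract_nonneg _, (Int.fract_lt_one _).le⟩, by
        change 2 ≤ ψ (p.1, Int.fract p.2)
        rw [(h.periodic_fract p.1 p.2).1]; exact (show 2 < ψ p from hp1).le⟩)
    rwa [(h.periodic_fract p.1 p.2).2, div_le_iff₀ (hΛ0.trans_le (hw1 _ hp3))] at h1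
  have hfc := h.contDiffAt _ hψ1
  have hfs : ContDiffAt ℝ 2 (fun σ => f (σ, t₀)) s₀ :=
    ContDiffAt.comp s₀ hfc (contDiffAt_id.prodMk contDiffAt_const)
  have hft : ContDiffAt ℝ 2 (fun τ => f (s₀, τ)) t₀ :=
    ContDiffAt.comp t₀ hfc (contDiffAt_const.prodMk contDiffAt_id)
  have h1 : deriv (deriv fun τ => f (s₀, τ)) t₀ ≤ 0 := by
    refine IsLocalMax.deriv_deriv_nonpos ?_ hft.continuousAt
    have : Tendsto (fun τ : ℝ => (s₀, τ)) (𝓝 t₀) (𝓝 (s₀, t₀)) :=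
      Continuous.tendsto (by fun_prop) t₀
    filter_upwards [this.eventually hloc] with τ hτ
    rw [hf0]; exact hτ
  have h2 : deriv (deriv fun σ => f (σ, t₀) - μ * w σ) s₀ ≤ 0 := by
    refine IsLocalMax.deriv_deriv_nonpos ?_ (hfs.continuousAt.sub (by fun_prop))
    have : Tendsto (fun σ : ℝ => (σ, t₀)) (𝓝 s₀) (𝓝 (s₀, t₀)) :=
      Continuous.tendsto (by fun_prop) s₀
    filter_upwards [this.eventually hloc] with σ hσ
    linarith [show f (σ, t₀) ≤ μ * w σ from hσ]
  have hwd : ∀ σ, HasDerivAt (fun σ => μ * w σ) (-(2 * (C + 1) * μ * Λ) * (σ - a)) σ := fun σ => by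
    have h3 : HasDerivAt (fun σ : ℝ => (σ - a) ^ 2) (2 * (σ - a)) σ := by
      have h4 := ((hasDerivAt_id' σ).sub_const a).fun_pow 2
      simpa using h4
    have h4 := (((h3.const_mul (C + 1)).const_sub 2).const_mul Λ).const_mul μ
    exact h4.congr_deriv (by ring)
  have hev : (deriv fun σ => f (σ, t₀) - μ * w σ) =ᶠ[𝓝 s₀]
      fun σ => deriv (fun σ => f (σ, t₀)) σ - -(2 * (C + 1) * μ * Λ) * (σ - a) := by
    filter_upwards [hfs.eventually (by simp)] with σ hσ
    exact ((hσ.differentiableAt (by simp)).hasDerivAt.fun_sub (hwd σ)).deriv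
  have hfs' : DifferentiableAt ℝ (deriv fun σ => f (σ, t₀)) s₀ := by
    have := hfs.fderiv_right (m := 1) (by norm_num)
    have h3 : (deriv fun σ => f (σ, t₀)) = fun σ => fderiv ℝ (fun σ => f (σ, t₀)) σ 1 := rfl
    rw [h3]
    exact (this.differentiableAt (by simp)).clm_apply (differentiableAt_const _)
  have hlin : HasDerivAt (fun σ => -(2 * (C + 1) * μ * Λ) * (σ - a)) (-(2 * (C + 1) * μ * Λ)) s₀ := by
    simpa using ((hasDerivAt_id' s₀).sub_const a).const_mul (-(2 * (C + 1) * μ * Λ))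
  rw [hev.deriv_eq, (hfs'.hasDerivAt.fun_sub hlin).deriv] at h2
  have h3 := h.laplacian s₀ t₀ hψ1
  -- At the maximum Δf ≤ μ w'' = -2 (C + 1) μ Λ, and f = μ w ≤ 2 μ Λ. So Δf ≤ -(C + 1) f, which
  -- contradicts Δf ≥ -C f as f > 0.
  have h4 : (C + 1) * f (s₀, t₀) ≤ 2 * (C + 1) * μ * Λ := by
    rw [hf0]
    nlinarith [hw2 s₀, mul_pos (show (0 : ℝ) < C + 1 by linarith) (one_pos.trans hμ1)]
  nlinarith

end IsProfile

theorem IsProfile.exists_bound {C c E : ℝ} (B : ℝ) (hC : 0 < C) (hc : 0 < c) :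
    ∃ K : ℝ, ∀ ψ g f : ℝ × ℝ → ℝ, IsProfile C c E B ψ g f → ∀ p, ψ p ≤ K := by
  obtain ⟨η, hη, hηC⟩ : ∃ η : ℝ, 0 < η ∧ (C + 1) * (2 * η) ^ 2 ≤ 1 := by
    -- For this η, (C + 1) (2 η)² = 1 / (C + 1).
    refine ⟨1 / (2 * (C + 1)), by positivity, ?_⟩
    have : (C + 1) * (2 * (1 / (2 * (C + 1)))) ^ 2 = 1 / (C + 1) := by field_simp
    rw [this, div_le_one (by linarith)]
    linarith
  set A := (√B + C * (2 + E)) ^ 2 * Real.exp (C * (2 + E / η))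
  refine ⟨max 2 (2 * (C * max A 2) / c), fun ψ g f h p => ?_⟩
  -- One loop of energy at most E / η on each side of p, each within distance η. Both satisfy ψ ≤ A.
  obtain ⟨a, ha, ha'⟩ := h.exists_small_loop (a := p.1 - η) hη
  obtain ⟨b, hb, hb'⟩ := h.exists_small_loop (a := p.1) hη
  exact h.le_of_strip hC hηC (a := a) (b := b) (by linarith [ha.1, hb.2])
    (h.radius_le_of_small_loop hC ha') (h.radius_le_of_small_loop hC hb') le_rfl hc
    ⟨by linarith [ha.2], hb.1⟩ p.2

/-! ### Approximate solutions of an equation without one-periodic solutions -/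

section Gronwall

variable {F : Type*} [NormedAddCommGroup F] [NormedSpace ℝ F]

/-- Gronwall's inequality for two curves, one of which solves a differential equation up to an error
that is small after integration. -/
theorem norm_sub_le_of_integral_le [CompleteSpace F] {y z v w e : ℝ → F} {K ε : ℝ} (hK : 0 < K)
    (he : Continuous e)
    (hy : ∀ t ∈ Icc (0 : ℝ) 1, HasDerivAt y (v t + e t) t)
    (hz : ∀ t ∈ Icc (0 : ℝ) 1, HasDerivAt z (w t) t)
    (hvw : ∀ t ∈ Icc (0 : ℝ) 1, ‖v t - w t‖ ≤ K * ‖y t - z t‖)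
    (hε : ∀ t ∈ Icc (0 : ℝ) 1, ‖∫ τ in (0 : ℝ)..t, e τ‖ ≤ ε) :
    ‖y 1 - z 1‖ ≤ Real.exp K * (‖y 0 - z 0‖ + ε) := by
  have hI : ∀ t, HasDerivAt (fun t => ∫ τ in (0 : ℝ)..t, e τ) (e t) t := fun t =>
    (he.integral_hasStrictDerivAt 0 t).hasDerivAt
  have hD : ∀ t ∈ Icc (0 : ℝ) 1, HasDerivAt (fun t => y t - z t - ∫ τ in (0 : ℝ)..t, e τ)
      (v t - w t) t := fun t ht =>
    (((hy t ht).fun_sub (hz t ht)).fun_sub (hI t)).congr_deriv (by abel)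
  -- Gronwall is applied to y - z - ∫ e, whose derivative v - w does not contain e. Putting the
  -- integral back costs K ε in the differential inequality and ε at the end.
  have h1 := norm_le_gronwallBound_of_norm_deriv_right_le (δ := ‖y 0 - z 0‖) (K := K) (ε := K * ε)
    (fun t ht => (hD t ht).continuousAt.continuousWithinAt)
    (fun t ht => (hD t (Ico_subset_Icc_self ht)).hasDerivWithinAt) (by simp) (fun t ht => ?_) 1
    ⟨zero_le_one, le_rfl⟩
  · rw [gronwallBound_of_K_ne_0 hK.ne'] at h1
    simp only [sub_zero, mul_one, mul_div_cancel_left₀ _ hK.ne'] at h1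
    have h2 := hε 1 ⟨zero_le_one, le_rfl⟩
    have h3 := norm_add_le (y 1 - z 1 - ∫ τ in (0 : ℝ)..1, e τ) (∫ τ in (0 : ℝ)..1, e τ)
    rw [sub_add_cancel] at h3
    linarith
  · have ht' := Ico_subset_Icc_self ht
    have h3 := norm_add_le (y t - z t - ∫ τ in (0 : ℝ)..t, e τ) (∫ τ in (0 : ℝ)..t, e τ)
    rw [sub_add_cancel] at h3
    have h4 := hvw t ht'
    have h5 := hε t ht'
    nlinarith

/-- A loop in a compact space cannot be an approximate solution of a differential equation that has
no one-periodic solutions. -/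
theorem exists_le_integral_of_loop [CompleteSpace F] {S : Type*} [TopologicalSpace S]
    [CompactSpace S] {ι : S → F} (hι : Continuous ι) (hinj : Function.Injective ι) {V : ℝ → S → F}
    {K : ℝ} (hK : 0 < K)
    (hV : ∀ t ∈ Icc (0 : ℝ) 1, ∀ x y, ‖V t x - V t y‖ ≤ K * ‖ι x - ι y‖)
    (hsol : ∀ x, ∃ γ : ℝ → S, γ 0 = x ∧ γ 1 ≠ x ∧ ∀ t, HasDerivAt (fun t => ι (γ t)) (V t (γ t)) t) :
    ∃ m : ℝ, 0 < m ∧ ∀ (x : ℝ → S) (e : ℝ → F), x 1 = x 0 → Continuous e →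
      (∀ t ∈ Icc (0 : ℝ) 1, HasDerivAt (fun t => ι (x t)) (V t (x t) + e t) t) →
      ∃ t ∈ Icc (0 : ℝ) 1, m < ‖∫ τ in (0 : ℝ)..t, e τ‖ := by
  choose γ hγ0 hγ1 hγ using hsol
  -- With e = 0, Gronwall shows that the time-one map is Lipschitz, hence continuous, and so its
  -- displacement has a positive minimum `m` on the compact space.
  have hlip : ∀ x y, ‖ι (γ x 1) - ι (γ y 1)‖ ≤ Real.exp K * ‖ι x - ι y‖ := fun x y => by
    have := norm_sub_le_of_integral_le (e := fun _ => 0) (ε := 0) hK continuous_const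
      (fun t _ => by simpa using hγ x t) (fun t _ => hγ y t) (fun t ht => hV t ht _ _) (by simp)
    simpa [hγ0] using this
  have hc : Continuous fun x => ‖ι x - ι (γ x 1)‖ := by
    refine (hι.sub ?_).norm
    refine continuous_iff_continuousAt.2 fun x => ?_
    rw [ContinuousAt, tendsto_iff_norm_sub_tendsto_zero]
    refine squeeze_zero (fun _ => norm_nonneg _) (fun y => hlip y x) ?_
    have h1 : Tendsto (fun y => ι y - ι x) (𝓝 x) (𝓝 0) :=
      (hι.sub continuous_const).tendsto' x 0 (sub_self _)
    simpa using h1.norm.const_mul (Real.exp K)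
  obtain ⟨m, hm, hmin⟩ : ∃ m : ℝ, 0 < m ∧ ∀ x, m ≤ ‖ι x - ι (γ x 1)‖ := by
    rcases isEmpty_or_nonempty S with hS | hS
    · exact ⟨1, one_pos, fun x => hS.elim x⟩
    · obtain ⟨x₀, h⟩ := hc.exists_forall_le' (univ_nonempty.some) (by simp)
      exact ⟨_, norm_pos_iff.2 (sub_ne_zero.2 fun h => hγ1 x₀ (hinj h).symm), h⟩
  -- If the error stayed within this bound, the loop would end within m / 2 of the time-one image of
  -- its starting point, but it ends at the starting point itself.
  refine ⟨m / (2 * Real.exp K), by positivity, fun x e hx he hxd => ?_⟩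
  by_contra! hle
  have h1 := norm_sub_le_of_integral_le hK he hxd (fun t _ => hγ (x 0) t) (fun t ht => hV t ht _ _) hle
  have h2 := hmin (x 0)
  rw [hγ0, hx, sub_self, norm_zero, zero_add] at h1
  have h3 : Real.exp K * (m / (2 * Real.exp K)) = m / 2 := by field_simp
  linarith

end Gronwall

/-! ### Lipschitz bounds with respect to a Euclidean embedding -/

section Lipschitz

/-- A local comparison of continuous functions holds globally on compact sets. -/
theorem exists_le_mul_of_isCompact {Z F G : Type*} [TopologicalSpace Z] [NormedAddCommGroup F]
    [NormedAddCommGroup G] {K : Set Z} (hK : IsCompact K) {a : Z → F} {b : Z → G}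
    (h : ∀ z ∈ K, a =O[𝓝 z] b) : ∃ C : ℝ, 0 < C ∧ ∀ z ∈ K, ‖a z‖ ≤ C * ‖b z‖ := by
  refine hK.induction_on (p := fun s => ∃ C : ℝ, 0 < C ∧ ∀ z ∈ s, ‖a z‖ ≤ C * ‖b z‖)
    ⟨1, one_pos, by simp⟩ ?_ ?_ ?_
  · rintro s t hst ⟨C, hC, h1⟩
    exact ⟨C, hC, fun z hz => h1 z (hst hz)⟩
  · rintro s t ⟨C, hC, h1⟩ ⟨C', hC', h2⟩
    refine ⟨C + C', by positivity, ?_⟩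
    rintro z (hz | hz)
    · exact (h1 z hz).trans (by nlinarith [norm_nonneg (b z)])
    · exact (h2 z hz).trans (by nlinarith [norm_nonneg (b z)])
  · intro z hz
    obtain ⟨C, hC, h1⟩ := (h z hz).exists_pos
    exact ⟨_, mem_nhdsWithin_of_mem_nhds h1.bound, C, hC, fun y hy => hy⟩

variable {k : ℕ} {S : Type*} [TopologicalSpace S] [ChartedSpace (EuclideanSpace ℝ (Fin k)) S]
  [IsManifold (𝓡 k) ∞ S]
  {F : Type*} [NormedAddCommGroup F] [NormedSpace ℝ F]
  {G : Type*} [NormedAddCommGroup G] [NormedSpace ℝ G]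

/-- Smooth families of functions are locally Lipschitz with respect to an immersion. -/
theorem isBigO_sub_of_immersion {ι : S → F} {V : ℝ × S → G} {t₀ : ℝ} {x₀ : S}
    (hι : ContMDiffAt (𝓡 k) 𝓘(ℝ, F) ∞ ι x₀)
    (himm : Function.Injective (mfderiv (𝓡 k) 𝓘(ℝ, F) ι x₀))
    (hV : ContMDiffAt (𝓘(ℝ, ℝ).prod (𝓡 k)) 𝓘(ℝ, G) ∞ V (t₀, x₀)) :
    (fun z : ℝ × S × S => V (z.1, z.2.1) - V (z.1, z.2.2))
      =O[𝓝 (t₀, x₀, x₀)] fun z => ι z.2.1 - ι z.2.2 := by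
  set φ := extChartAt (𝓡 k) x₀ with hφ
  have hsymm : ContMDiffAt 𝓘(ℝ, EuclideanSpace ℝ (Fin k)) (𝓡 k) ∞ φ.symm (φ x₀) :=
    (contMDiffOn_extChartAt_symm x₀).contMDiffAt (extChartAt_target_mem_nhds x₀)
  have hx₀ : φ.symm (φ x₀) = x₀ := extChartAt_to_inv (I := 𝓡 k) x₀
  have hι' : ContDiffAt ℝ ∞ (ι ∘ φ.symm) (φ x₀) :=
    (ContMDiffAt.comp (φ x₀) (by rwa [hx₀]) hsymm).contDiffAt
  have hV' : ContDiffAt ℝ ∞ (fun p : ℝ × EuclideanSpace ℝ (Fin k) => V (p.1, φ.symm p.2))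
      (t₀, φ x₀) := by
    have h1 : ContMDiffAt 𝓘(ℝ, ℝ × EuclideanSpace ℝ (Fin k)) (𝓘(ℝ, ℝ).prod (𝓡 k)) ∞
        (fun p : ℝ × EuclideanSpace ℝ (Fin k) => ((p.1, φ.symm p.2) : ℝ × S)) (t₀, φ x₀) :=
      (contDiffAt_fst.contMDiffAt).prodMk
        (ContMDiffAt.comp (t₀, φ x₀) hsymm contDiffAt_snd.contMDiffAt)
    exact (ContMDiffAt.comp (t₀, φ x₀) (by simpa only [hx₀] using hV) h1).contDiffAt
  have hιs := hι'.hasStrictFDerivAt (by simp)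
  have hVs := hV'.hasStrictFDerivAt (by simp)
  have hinj : Function.Injective (fderiv ℝ (ι ∘ φ.symm) (φ x₀)) := by
    have h1 : fderivWithin ℝ (ι ∘ φ.symm) (range (𝓡 k)) (φ x₀) = fderiv ℝ (ι ∘ φ.symm) (φ x₀) := by
      rw [modelWithCornersSelf_coe, range_id, fderivWithin_univ]
    have h2 : mfderiv (𝓡 k) 𝓘(ℝ, F) ι x₀ = fderiv ℝ (ι ∘ φ.symm) (φ x₀) :=
      (hι.mdifferentiableAt (by simp)).mfderiv.trans h1
    rwa [h2] at himm
  -- An injective linear map on a finite-dimensional space is antilipschitz. By strict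
  -- differentiability, differences of chart coordinates are then bounded by differences of ι near
  -- the point.
  obtain ⟨c, -, hc⟩ := (fderiv ℝ (ι ∘ φ.symm) (φ x₀)).toLinearMap.exists_antilipschitzWith
    (LinearMap.ker_eq_bot.2 hinj)
  have h1 := (hιs.isTheta_sub (hc.isUniformInducing
    (fderiv ℝ (ι ∘ φ.symm) (φ x₀)).uniformContinuous).isInducing).2
  have h2 := hVs.isBigO_sub
  have hcont : Tendsto φ (𝓝 x₀) (𝓝 (φ x₀)) := continuousAt_extChartAt x₀
  have hf1 : Tendsto (fun z : ℝ × S × S => z.1) (𝓝 (t₀, x₀, x₀)) (𝓝 t₀) :=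
    Continuous.tendsto' (by fun_prop) _ _ rfl
  have hf2 : Tendsto (fun z : ℝ × S × S => z.2.1) (𝓝 (t₀, x₀, x₀)) (𝓝 x₀) :=
    Continuous.tendsto' (by fun_prop) _ _ rfl
  have hf3 : Tendsto (fun z : ℝ × S × S => z.2.2) (𝓝 (t₀, x₀, x₀)) (𝓝 x₀) :=
    Continuous.tendsto' (by fun_prop) _ _ rfl
  have h3 := h1.comp_tendsto (((hcont.comp hf2).prodMk_nhds (hcont.comp hf3)))
  have h4 := h2.comp_tendsto ((hf1.prodMk_nhds (hcont.comp hf2)).prodMk_nhds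
    (hf1.prodMk_nhds (hcont.comp hf3)))
  have hs2 := hf2.eventually (extChartAt_source_mem_nhds (I := 𝓡 k) x₀)
  have hs3 := hf3.eventually (extChartAt_source_mem_nhds (I := 𝓡 k) x₀)
  have h5 : (fun z : ℝ × S × S => V (z.1, z.2.1) - V (z.1, z.2.2))
      =O[𝓝 (t₀, x₀, x₀)] fun z => φ z.2.1 - φ z.2.2 := by
    have h6 : (fun z : ℝ × S × S => ((0 : ℝ), φ z.2.1 - φ z.2.2)) =O[𝓝 (t₀, x₀, x₀)]
        fun z => φ z.2.1 - φ z.2.2 :=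
      Asymptotics.IsBigO.of_bound 1 (Eventually.of_forall fun z => by simp [Prod.norm_def])
    refine (h4.congr' ?_ ?_).trans h6
    · filter_upwards [hs2, hs3] with z hz2 hz3
      simp only [Function.comp_apply, hφ, (extChartAt (𝓡 k) x₀).left_inv hz2,
        (extChartAt (𝓡 k) x₀).left_inv hz3]
    · exact Eventually.of_forall fun z => by simp
  refine h5.trans (h3.congr' EventuallyEq.rfl ?_)
  filter_upwards [hs2, hs3] with z hz2 hz3
  simp only [Function.comp_apply, hφ, (extChartAt (𝓡 k) x₀).left_inv hz2,
    (extChartAt (𝓡 k) x₀).left_inv hz3]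

/-- Smooth families of functions are Lipschitz with respect to an embedding. -/
theorem exists_lipschitz_of_embedding [CompactSpace S] {ι : S → F} {V : ℝ × S → G}
    (hι : ContMDiff (𝓡 k) 𝓘(ℝ, F) ∞ ι) (hinj : Function.Injective ι)
    (himm : ∀ x, Function.Injective (mfderiv (𝓡 k) 𝓘(ℝ, F) ι x))
    (hV : ContMDiff (𝓘(ℝ, ℝ).prod (𝓡 k)) 𝓘(ℝ, G) ∞ V) :
    ∃ K : ℝ, 0 < K ∧ ∀ t ∈ Icc (0 : ℝ) 1, ∀ x y, ‖V (t, x) - V (t, y)‖ ≤ K * ‖ι x - ι y‖ := by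
  have hK : IsCompact (Icc (0 : ℝ) 1 ×ˢ (univ : Set (S × S))) := isCompact_Icc.prod isCompact_univ
  have hloc : ∀ z ∈ Icc (0 : ℝ) 1 ×ˢ (univ : Set (S × S)),
      (fun z : ℝ × S × S => V (z.1, z.2.1) - V (z.1, z.2.2))
        =O[𝓝 z] fun z => ι z.2.1 - ι z.2.2 := by
    rintro ⟨t, x, y⟩ -
    -- On the diagonal the immersion property is needed; away from it ι x - ι y is bounded below by
    -- injectivity.
    by_cases hxy : x = y
    · subst hxy
      exact isBigO_sub_of_immersion (hι x) (himm x) (hV (t, x))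
    · have h1 : Tendsto (fun z : ℝ × S × S => V (z.1, z.2.1) - V (z.1, z.2.2)) (𝓝 (t, x, y))
          (𝓝 (V (t, x) - V (t, y))) :=
        Continuous.tendsto' ((hV.continuous.comp (by fun_prop)).sub
          (hV.continuous.comp (by fun_prop))) _ _ rfl
      have h2 : Tendsto (fun z : ℝ × S × S => ι z.2.1 - ι z.2.2) (𝓝 (t, x, y)) (𝓝 (ι x - ι y)) :=
        Continuous.tendsto' ((hι.continuous.comp (by fun_prop)).sub
          (hι.continuous.comp (by fun_prop))) _ _ rfl
      have h3 : ι x - ι y ≠ 0 := sub_ne_zero.2 fun h => hxy (hinj h)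
      exact (h1.isBigO_one ℝ).trans ((Asymptotics.isBigO_const_left_iff_pos_le_norm one_ne_zero).2
        ⟨‖ι x - ι y‖ / 2, by positivity, h2.norm.eventually_const_le (by
          have := norm_pos_iff.2 h3; linarith)⟩)
  obtain ⟨C, hC, h⟩ := exists_le_mul_of_isCompact hK hloc
  exact ⟨C, hC, fun t ht x y => h (t, x, y) ⟨ht, mem_univ _⟩⟩

end Lipschitz

/-! ### The radius as a continuous function on M -/

namespace ModelledAtInfinity

variable {k d : ℕ} {S M : Type*}
  [TopologicalSpace S] [ChartedSpace (EuclideanSpace ℝ (Fin k)) S] [IsManifold (𝓡 k) ∞ S]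
  [TopologicalSpace M] [ChartedSpace (EuclideanSpace ℝ (Fin d)) M] [IsManifold (𝓡 d) ∞ M]
  {α : OneForm k S} {Ω : BilinField d M} {D : ModelledAtInfinity α Ω}

section Radius

open Classical in
/-- The radius, extended by one to all of `M`. -/
def cutRadius (D : ModelledAtInfinity α Ω) (z : M) : ℝ :=
  if z ∈ D.core then 1 else max (D.radius z) 1

theorem one_le_cutRadius (D : ModelledAtInfinity α Ω) (z : M) : 1 ≤ D.cutRadius z := by
  unfold cutRadius
  split_ifs
  · exact le_rfl
  · exact le_max_right _ _

theorem one_lt_cutRadius {z : M} : 1 < D.cutRadius z ↔ z ∈ D.endSet 1 := by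
  unfold cutRadius
  split_ifs with h
  · exact ⟨fun h1 => absurd h1 (lt_irrefl _), fun h1 => absurd h h1.1⟩
  · rw [lt_max_iff]
    exact ⟨fun h1 => ⟨h, h1.resolve_right (lt_irrefl _)⟩, fun h1 => Or.inl h1.2⟩

theorem cutRadius_eq {z : M} (hz : z ∈ D.endSet 1) : D.cutRadius z = D.radius z := by
  unfold cutRadius
  rw [if_neg hz.1]
  exact max_eq_left hz.2.le

/-- The point is continuity at the core: the sublevel set r ≤ 1 is a neighbourhood of the core, so
the function is constantly one there. -/
theorem continuous_cutRadius (D : ModelledAtInfinity α Ω) : Continuous D.cutRadius := by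
  refine continuous_iff_continuousAt.2 fun z => ?_
  by_cases hz : z ∈ D.core
  · have h1 : D.cutRadius =ᶠ[𝓝 z] fun _ => 1 := by
      filter_upwards [mem_interior_iff_mem_nhds.1 (D.core_subset_interior 1 D.rM_lt_one hz)]
        with z' hz'
      refine le_antisymm (not_lt.1 fun h2 => ?_) (D.one_le_cutRadius z')
      have h3 := one_lt_cutRadius.1 h2
      exact hz'.elim h3.1 (not_le.2 h3.2)
    exact h1.continuousAt
  · have h1 : D.cutRadius =ᶠ[𝓝 z] fun z => max (D.radius z) 1 := by
      filter_upwards [D.isOpen_compl_core.mem_nhds hz] with z' hz'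
      exact if_neg hz'
    have h2 : ContinuousAt (fun z => max (D.radius z) 1) z :=
      (D.contMDiffAt_radius hz).continuousAt.max continuousAt_const
    exact h2.congr_of_eventuallyEq h1

end Radius

section Floer

variable {H : ℝ → ℝ → M → ℝ} {J : ℝ → ℝ → EndField d M} {h q : ℝ → ℝ → S → ℝ} {E : ℝ}
  {u : ℝ × ℝ → M}

theorem hasDerivAt_line {f : ℝ × ℝ → ℝ} {s t : ℝ} (hf : DifferentiableAt ℝ f (s, t)) :
    HasDerivAt (fun σ => f (σ, t)) (fderiv ℝ f (s, t) (1, 0)) s ∧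
    HasDerivAt (fun τ => f (s, τ)) (fderiv ℝ f (s, t) (0, 1)) t :=
  ⟨hf.hasFDerivAt.comp_hasDerivAt_of_eq s
      (HasDerivAt.prodMk (hasDerivAt_id' s) (hasDerivAt_const s t)) rfl,
    hf.hasFDerivAt.comp_hasDerivAt_of_eq t
      (HasDerivAt.prodMk (hasDerivAt_const t s) (hasDerivAt_id' t)) rfl⟩

/-- The second partial derivatives, as derivatives along lines. -/
theorem deriv_deriv_line {f : ℝ × ℝ → ℝ} {s t : ℝ} (hf : ContDiffAt ℝ 2 f (s, t)) :
    deriv (deriv fun σ => f (σ, t)) s = fderiv ℝ (fun p => fderiv ℝ f p (1, 0)) (s, t) (1, 0) ∧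
    deriv (deriv fun τ => f (s, τ)) t = fderiv ℝ (fun p => fderiv ℝ f p (0, 1)) (s, t) (0, 1) := by
  have hev : ∀ᶠ p in 𝓝 (s, t), DifferentiableAt ℝ f p := by
    filter_upwards [hf.eventually (by simp)] with p hp using hp.differentiableAt (by simp)
  have hd (e : ℝ × ℝ) : DifferentiableAt ℝ (fun p => fderiv ℝ f p e) (s, t) :=
    ((hf.fderiv_right (m := 1) (by norm_num)).differentiableAt (by simp)).clm_apply
      (differentiableAt_const _)
  have e1 : (deriv fun σ => f (σ, t)) =ᶠ[𝓝 s] fun σ => fderiv ℝ f (σ, t) (1, 0) := by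
    have : Tendsto (fun σ : ℝ => (σ, t)) (𝓝 s) (𝓝 (s, t)) :=
      Continuous.tendsto (by fun_prop) s
    filter_upwards [this.eventually hev] with σ hσ using (hasDerivAt_line hσ).1.deriv
  have e2 : (deriv fun τ => f (s, τ)) =ᶠ[𝓝 t] fun τ => fderiv ℝ f (s, τ) (0, 1) := by
    have : Tendsto (fun τ : ℝ => (s, τ)) (𝓝 t) (𝓝 (s, t)) :=
      Continuous.tendsto (by fun_prop) t
    filter_upwards [this.eventually hev] with τ hτ using (hasDerivAt_line hτ).2.deriv
  rw [e1.deriv_eq, e2.deriv_eq]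
  exact ⟨(hasDerivAt_line (hd (1, 0))).1.deriv, (hasDerivAt_line (hd (0, 1))).2.deriv⟩

variable (hα : IsContactForm α) (hΩ : IsSymplecticForm Ω) (hJ : D.IsContinuationAcs J)
  (hG : D.EndGeometry H J h q)
include hα hΩ hJ hG

/-- Bounds for the derivatives of the radius along Floer solutions, in the directions of the
coordinates. -/
theorem exists_hasDerivAt_cutRadius [CompactSpace S] : ∃ C : ℝ, 0 < C ∧ ∀ E u,
    IsFloerSolution Ω H J E u → ∀ s t, 1 < D.cutRadius (u (s, t)) →
      (∃ δ, HasDerivAt (fun σ => D.cutRadius (u (σ, t))) δ s ∧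
        |δ| ≤ C * (√(D.cutRadius (u (s, t))) * gradNorm Ω J u (s, t))) ∧
      (∃ δ, HasDerivAt (fun τ => D.cutRadius (u (s, τ))) δ t ∧
        |δ| ≤ C * (√(D.cutRadius (u (s, t))) * gradNorm Ω J u (s, t))
          + C * D.cutRadius (u (s, t))) := by
  obtain ⟨C, hC, hb⟩ := exists_fderiv_radius_le hα hΩ hJ hG
  refine ⟨C, hC, fun E u hu s t hst => ?_⟩
  have hz := one_lt_cutRadius.1 hst
  have hev : ∀ᶠ p in 𝓝 (s, t), D.cutRadius (u p) = D.radius (u p) := by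
    filter_upwards [hu.smooth.continuous.continuousAt.eventually
      (D.isOpen_endSet_one.mem_nhds hz)] with p hp using cutRadius_eq hp
  have hd : HasFDerivAt (fun p => D.cutRadius (u p))
      (fderiv ℝ (fun p => D.radius (u p)) (s, t)) (s, t) :=
    (((contDiffAt_radius_comp hu.smooth hz.1).differentiableAt (by simp)).hasFDerivAt).congr_of_eventuallyEq
      hev
  obtain ⟨h1, h2⟩ := hasDerivAt_line hd.differentiableAt
  rw [hd.fderiv] at h1 h2
  obtain ⟨b1, b2⟩ := hb E u hu (s, t) hz
  rw [cutRadius_eq hz]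
  exact ⟨⟨_, h1, b1⟩, ⟨_, h2, b2⟩⟩

end Floer

end ModelledAtInfinity

/-! ### Loops of large radius follow the contact flow -/

/-- The differential of a map to a vector space, on the model space. -/
def vecDiffAt {k : ℕ} {S F : Type*} [TopologicalSpace S] [ChartedSpace (EuclideanSpace ℝ (Fin k)) S]
    [NormedAddCommGroup F] [NormedSpace ℝ F] (ι : S → F) (x : S) :
    EuclideanSpace ℝ (Fin k) →L[ℝ] F :=
  mfderiv (𝓡 k) 𝓘(ℝ, F) ι x

/-- Without a solution through x, `flow` returns x itself, so a flow that moves x comes from an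
actual solution. -/
theorem exists_isSolution_of_flow_ne {k : ℕ} {S : Type*} [TopologicalSpace S]
    [ChartedSpace (EuclideanSpace ℝ (Fin k)) S] {X : ℝ → (x : S) → TangentSpace (𝓡 k) x} {t : ℝ}
    {x : S} (h : flow X t x ≠ x) : ∃ γ : ℝ → S, IsSolution X γ ∧ γ 0 = x ∧ γ t ≠ x := by
  unfold flow at h
  split_ifs at h with hex
  · exact ⟨hex.choose, hex.choose_spec.1, hex.choose_spec.2, h⟩
  · exact absurd rfl h

theorem IsSolution.hasDerivAt {k : ℕ} {S F : Type*} [TopologicalSpace S]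
    [ChartedSpace (EuclideanSpace ℝ (Fin k)) S] [NormedAddCommGroup F] [NormedSpace ℝ F]
    {X : ℝ → (x : S) → TangentSpace (𝓡 k) x} {γ : ℝ → S} (hγ : IsSolution X γ) {ι : S → F}
    (hι : ContMDiff (𝓡 k) 𝓘(ℝ, F) ∞ ι) (t : ℝ) :
    HasDerivAt (fun t => ι (γ t)) (vecDiffAt ι (γ t) (X t (γ t))) t := by
  have h1 := ((hι (γ t)).mdifferentiableAt (by simp)).hasMFDerivAt.comp t (hγ t)
  have h2 : HasFDerivAt (fun t => ι (γ t)) ((vecDiffAt ι (γ t)).comp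
      ((1 : ℝ →L[ℝ] ℝ).smulRight (X t (γ t) : EuclideanSpace ℝ (Fin k)))) t := h1.hasFDerivAt
  refine h2.hasDerivAt.congr_deriv ?_
  change vecDiffAt ι (γ t) ((1 : ℝ) • (X t (γ t) : EuclideanSpace ℝ (Fin k))) = _
  rw [one_smul]

theorem norm_le_sum_abs {n : ℕ} (v : EuclideanSpace ℝ (Fin n)) : ‖v‖ ≤ ∑ i, |v i| := by
  conv_lhs => rw [← (EuclideanSpace.basisFun (Fin n) ℝ).sum_repr v]
  refine (norm_sum_le _ _).trans (Finset.sum_le_sum fun i _ => ?_)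
  simp [norm_smul]

namespace ModelledAtInfinity

variable {k d : ℕ} {S M : Type*}
  [TopologicalSpace S] [ChartedSpace (EuclideanSpace ℝ (Fin k)) S] [IsManifold (𝓡 k) ∞ S]
  [TopologicalSpace M] [ChartedSpace (EuclideanSpace ℝ (Fin d)) M] [IsManifold (𝓡 d) ∞ M]
  {α : OneForm k S} {Ω : BilinField d M} {D : ModelledAtInfinity α Ω}
  {H : ℝ → ℝ → M → ℝ} {J : ℝ → ℝ → EndField d M} {h q : ℝ → ℝ → S → ℝ} {E : ℝ}
  {u : ℝ × ℝ → M}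

section ContactVelocity

variable {F : Type*} [NormedAddCommGroup F] [NormedSpace ℝ F] {ι : S → F}

/-- Contact vector fields of smooth families of functions are smooth. -/
theorem contMDiff_vecDiffAt_contactAt (hα : IsContactForm α) (hΩ : IsSymplecticForm Ω)
    (D : ModelledAtInfinity α Ω) (hι : ContMDiff (𝓡 k) 𝓘(ℝ, F) ∞ ι) (hh : SmoothFamily k h) :
    ContMDiff (paramModel k) 𝓘(ℝ, F) ∞
      fun p : ℝ × ℝ × S => vecDiffAt ι p.2.2 (contactAt α (h p.1 p.2.1) p.2.2) := by
  have hr : D.rM < 2 := by linarith [D.rM_lt_one]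
  intro p₀
  have hz (x : S) := D.lift_notMem_core hr x
  have hιb (x : S) : ContMDiffAt (𝓡 d) 𝓘(ℝ, F) ∞ (fun z => ι (D.base z)) (D.lift x 2) :=
    (hι _).comp _ (D.contMDiffAt_base (hz x))
  have h1 := contMDiffAt_mfderiv_apply_real (IP := paramModel k) (P := ℝ × ℝ × S) (N := M)
    (IN := 𝓡 d) (f := fun _ z => ι (D.base z)) (b := fun p => D.lift p.2.2 2)
    (X := fun p => hamField Ω (D.homog (h p.1 p.2.1)) (D.lift p.2.2 2))
    (p₀ := p₀) (ContMDiffAt.comp (p₀, D.lift p₀.2.2 2) (g := fun z => ι (D.base z)) (hιb p₀.2.2)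
      contMDiffAt_snd) (contMDiff_hamField_lift hΩ hh p₀)
  refine h1.congr_of_eventuallyEq (Eventually.of_forall fun p => ?_)
  have hhm : MDifferentiableAt (𝓡 k) 𝓘(ℝ, ℝ) (h p.1 p.2.1) p.2.2 :=
    ((hh.slice p.1 p.2.1) _).mdifferentiableAt (by simp)
  have h2 := (D.dbase_dradius_hamAt hα hΩ (hz p.2.2) (D.base_lift hr p.2.2)
    (H := D.homog (h p.1 p.2.1)) (h := h p.1 p.2.1) fun v =>
      D.diffAt_homogeneous (hz p.2.2) (D.base_lift hr p.2.2) hhm v).1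
  have h3 := mfderiv_comp (D.lift p.2.2 2) ((hι _).mdifferentiableAt (by simp))
    ((D.contMDiffAt_base (hz p.2.2)).mdifferentiableAt (by simp))
  have h4 : vecDiffAt ι (D.base (D.lift p.2.2 2))
      (D.dbase (D.lift p.2.2 2) (hamAt Ω (D.homog (h p.1 p.2.1)) (D.lift p.2.2 2)))
      = vecDiffAt ι p.2.2 (contactAt α (h p.1 p.2.1) p.2.2) := by
    rw [h2, D.base_lift hr]
  exact h4.symm.trans (DFunLike.congr_fun h3 _).symm

end ContactVelocity

variable (hα : IsContactForm α) (hΩ : IsSymplecticForm Ω) (hJ : D.IsContinuationAcs J)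
  (hG : D.EndGeometry H J h q)
include hα hΩ hJ hG

/-- Along Floer solutions, the projection to `S` of `J ∂_s u` is small where the radius is large. -/
theorem exists_diffAt_dbase_le [CompactSpace S] {φ : S → ℝ} (hφ : ContMDiff (𝓡 k) 𝓘(ℝ, ℝ) ∞ φ) :
    ∃ C : ℝ, 0 < C ∧ ∀ E u, IsFloerSolution Ω H J E u → ∀ p, u p ∈ D.endSet 1 →
      √(D.radius (u p)) * |diffAt φ (D.base (u p)) (D.dbase (u p)
        (endAt (J p.1 p.2) (u p) (planeDiff u p (1, 0))))| ≤ C * gradNorm Ω J u p := by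
  have hφs : SmoothFamily k fun _ _ => φ :=
    hφ.comp (contMDiff_snd.comp contMDiff_snd)
  obtain ⟨C₁, hC₁, hb₁⟩ := exists_diffAt_homog_planeDiff_le hα hΩ hJ hG hφs (Tame.const _)
  obtain ⟨C₂, hC₂, hb₂⟩ := exists_diffAt_homog_planeDiff_le hα hΩ hJ hG (φ := fun _ _ _ => 1)
    contMDiff_const (Tame.const _)
  obtain ⟨C₃, hC₃, hb₃⟩ := (Tame.const φ).exists_bound hφs.continuous
  refine ⟨C₁ + C₂ * C₃, by positivity, fun E u hu p hp => ?_⟩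
  have hR := D.radius_pos hp.1
  set v := endAt (J p.1 p.2) (u p) (planeDiff u p (1, 0))
  have h1 := (hb₁ E u hu p hp).2.1
  have h2 := (hb₂ E u hu p hp).2.1
  have h3 := hb₃ 0 0 (D.base (u p))
  have e2 : diffAt (D.homog fun _ => 1) (u p) v = D.dradius (u p) v := by
    have : D.homog (fun _ => (1 : ℝ)) = D.radius := funext fun z => mul_one _
    rw [this]
    rfl
  -- Hence r dφ is d(r φ) - φ dr. Both terms are of order √r g, and dividing by √r leaves the claim.
  have e1 : diffAt (D.homog φ) (u p) v = D.dradius (u p) v * φ (D.base (u p))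
      + D.radius (u p) * diffAt φ (D.base (u p)) (D.dbase (u p) v) :=
    D.diffAt_homogeneous hp.1 rfl ((hφ _).mdifferentiableAt (by simp)) v
  rw [e2] at h2
  set g := gradNorm Ω J u p
  have hg : 0 ≤ g := Real.sqrt_nonneg _
  have hs : 0 < √(D.radius (u p)) := Real.sqrt_pos.2 hR
  have hss : √(D.radius (u p)) * √(D.radius (u p)) = D.radius (u p) := Real.mul_self_sqrt hR.le
  have h4 : D.radius (u p) * |diffAt φ (D.base (u p)) (D.dbase (u p) v)|
      ≤ C₁ * (√(D.radius (u p)) * g) + C₂ * (√(D.radius (u p)) * g) * C₃ := by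
    rw [← abs_of_pos hR, ← abs_mul, abs_of_pos hR]
    have e3 : D.radius (u p) * diffAt φ (D.base (u p)) (D.dbase (u p) v)
        = diffAt (D.homog φ) (u p) v - D.dradius (u p) v * φ (D.base (u p)) := by rw [e1]; ring
    rw [e3]
    refine (abs_sub _ _).trans (add_le_add h1 ?_)
    rw [abs_mul]
    gcongr
  refine le_of_mul_le_mul_left ?_ hs
  calc √(D.radius (u p)) * (√(D.radius (u p)) * |diffAt φ (D.base (u p)) (D.dbase (u p) v)|)
      = D.radius (u p) * |diffAt φ (D.base (u p)) (D.dbase (u p) v)| := by rw [← mul_assoc, hss]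
    _ ≤ _ := h4
    _ = √(D.radius (u p)) * ((C₁ + C₂ * C₃) * g) := by ring

theorem exists_vecDiffAt_dbase_le [CompactSpace S] {n : ℕ} {ι : S → EuclideanSpace ℝ (Fin n)}
    (hι : ContMDiff (𝓡 k) 𝓘(ℝ, EuclideanSpace ℝ (Fin n)) ∞ ι) :
    ∃ C : ℝ, 0 < C ∧ ∀ E u, IsFloerSolution Ω H J E u → ∀ p, u p ∈ D.endSet 1 →
      √(D.radius (u p)) * ‖vecDiffAt ι (D.base (u p)) (D.dbase (u p)
        (endAt (J p.1 p.2) (u p) (planeDiff u p (1, 0))))‖ ≤ C * gradNorm Ω J u p := by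
  have hφ : ∀ i, ContMDiff (𝓡 k) 𝓘(ℝ, ℝ) ∞ fun x => ι x i := fun i =>
    (EuclideanSpace.proj (𝕜 := ℝ) i).contMDiff.comp hι
  choose C hC hb using fun i => exists_diffAt_dbase_le hα hΩ hJ hG (hφ i)
  refine ⟨∑ i, C i + 1, add_pos_of_nonneg_of_pos (Finset.sum_nonneg fun i _ => (hC i).le) one_pos,
    fun E u hu p hp => ?_⟩
  set v := endAt (J p.1 p.2) (u p) (planeDiff u p (1, 0))
  have hcoord : ∀ i, vecDiffAt ι (D.base (u p)) (D.dbase (u p) v) i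
      = diffAt (fun x => ι x i) (D.base (u p)) (D.dbase (u p) v) := fun i => by
    have h1 := mfderiv_comp (D.base (u p))
      ((EuclideanSpace.proj (𝕜 := ℝ) i).contMDiff (n := ∞).mdifferentiableAt (by simp))
      ((hι (D.base (u p))).mdifferentiableAt (by simp))
    rw [mfderiv_eq_fderiv, ContinuousLinearMap.fderiv] at h1
    exact (DFunLike.congr_fun h1 (D.dbase (u p) v)).symm
  have hg : 0 ≤ gradNorm Ω J u p := Real.sqrt_nonneg _
  calc √(D.radius (u p)) * ‖vecDiffAt ι (D.base (u p)) (D.dbase (u p) v)‖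
      ≤ √(D.radius (u p)) * ∑ i, |vecDiffAt ι (D.base (u p)) (D.dbase (u p) v) i| :=
        mul_le_mul_of_nonneg_left (norm_le_sum_abs _) (Real.sqrt_nonneg _)
    _ = ∑ i, √(D.radius (u p)) * |diffAt (fun x => ι x i) (D.base (u p)) (D.dbase (u p) v)| := by
        rw [Finset.mul_sum]
        exact Finset.sum_congr rfl fun i _ => by rw [hcoord]
    _ ≤ ∑ i, C i * gradNorm Ω J u p := Finset.sum_le_sum fun i _ => hb i E u hu p hp
    _ = (∑ i, C i) * gradNorm Ω J u p := by rw [Finset.sum_mul]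
    _ ≤ _ := by gcongr; linarith

/-- The projection to `S` of a loop of a Floer solution is an approximate solution of the contact
flow. -/
theorem hasDerivAt_embedding_base {F : Type*} [NormedAddCommGroup F] [NormedSpace ℝ F] {ι : S → F}
    (hι : ContMDiff (𝓡 k) 𝓘(ℝ, F) ∞ ι) (hu : IsFloerSolution Ω H J E u) {s t : ℝ}
    (hp : u (s, t) ∈ D.endSet 1) :
    HasDerivAt (fun τ => ι (D.base (u (s, τ))))
      (vecDiffAt ι (D.base (u (s, t))) (contactAt α (h s t) (D.base (u (s, t))))
        + vecDiffAt ι (D.base (u (s, t))) (D.dbase (u (s, t))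
          (endAt (J s t) (u (s, t)) (planeDiff u (s, t) (1, 0))))) t := by
  have hb := contMDiffAt_base_comp hu.smooth hp.1
  have hd : HasFDerivAt (fun p => ι (D.base (u p)))
      ((vecDiffAt ι (D.base (u (s, t)))).comp ((D.dbase (u (s, t))).comp (planeDiff u (s, t))))
      (s, t) := by
    have h1 := (((hι _).mdifferentiableAt (by simp)).hasMFDerivAt (x := D.base (u (s, t)))).comp
      (s, t) (((D.contMDiffAt_base hp.1).mdifferentiableAt (by simp)).hasMFDerivAt.comp (s, t)
      ((hu.smooth (s, t)).mdifferentiableAt (by simp)).hasMFDerivAt)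
    exact h1.hasFDerivAt
  have h2 := hd.comp_hasDerivAt_of_eq t
      (HasDerivAt.prodMk (hasDerivAt_const t s) (hasDerivAt_id' t)) rfl
  refine h2.congr_deriv ?_
  have hhm : MDifferentiableAt (𝓡 k) 𝓘(ℝ, ℝ) (h s t) (D.base (u (s, t))) :=
    ((hG.smooth_h.slice s t) _).mdifferentiableAt (by simp)
  have h3 : D.dbase (u (s, t)) (hamAt Ω (H s t) (u (s, t)))
      = contactAt α (h s t) (D.base (u (s, t))) :=
    (D.dbase_dradius_hamAt hα hΩ hp.1 rfl (h := h s t) fun v => by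
      rw [hG.diffAt_ham s t hp]
      exact D.diffAt_homogeneous hp.1 rfl hhm v).1
  have h4 := endAt_planeDiff hJ hu (s, t)
  rw [h4, map_sub, h3, ← map_add, add_sub_cancel]
  rfl

/-- Loops of Floer solutions along which the gradient is bounded in mean square stay in a bounded
set, if the contact flow has no fixed points. -/
theorem exists_cutRadius_le_of_loop [T2Space S] [CompactSpace S] (hE : 0 ≤ E) {σ : ℝ}
    (hfix : ∀ x : S, flow (fun t => contactField α (h σ t)) 1 x ≠ x) :
    ∃ B : ℝ, ∀ E' u, IsFloerSolution Ω H J E' u → ∀ s, h s = h σ →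
      ∫ t in (0 : ℝ)..1, gradNorm Ω J u (s, t) ^ 2 ≤ E → ∀ t, D.cutRadius (u (s, t)) ≤ B := by
  -- The embedding stands in for a metric on S and lets Gronwall's inequality be used in a vector
  -- space.
  obtain ⟨n, ι, hι, hemb, himm⟩ := exists_embedding_euclidean_of_compact (I := 𝓡 k) (M := S)
  set V : ℝ × S → EuclideanSpace ℝ (Fin n) := fun p =>
    vecDiffAt ι p.2 (contactAt α (h σ p.1) p.2) with hVdef
  have hV : ContMDiff (𝓘(ℝ, ℝ).prod (𝓡 k)) 𝓘(ℝ, EuclideanSpace ℝ (Fin n)) ∞ V :=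
    ContMDiff.comp (f := fun p : ℝ × S => ((σ, p.1, p.2) : ℝ × ℝ × S))
      (contMDiff_vecDiffAt_contactAt hα hΩ D hι hG.smooth_h)
      (contMDiff_const.prodMk (contMDiff_fst.prodMk contMDiff_snd))
  obtain ⟨K, hK, hlip⟩ := exists_lipschitz_of_embedding hι hemb.injective himm hV
  obtain ⟨m, hm, hsep⟩ := exists_le_integral_of_loop hι.continuous hemb.injective
    (V := fun t x => V (t, x)) hK hlip fun x => by
      obtain ⟨γ, h1, h2, h3⟩ := exists_isSolution_of_flow_ne (hfix x)
      exact ⟨γ, h2, h3, fun t => h1.hasDerivAt hι t⟩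
  obtain ⟨C, hC, hb⟩ := exists_vecDiffAt_dbase_le hα hΩ hJ hG hι
  obtain ⟨C', hC', hd⟩ := exists_hasDerivAt_cutRadius hα hΩ hJ hG
  -- Chosen so that C (1 + E) / √R ≤ m: if r > R along the loop, the integrated error is too small
  -- for the loop to close.
  set R := (C * (1 + E) / m + 1) ^ 2 with hR
  have hR1 : 1 ≤ R := by
    have : 0 ≤ C * (1 + E) / m := by positivity
    rw [hR]; nlinarith
  have hRs : √R = C * (1 + E) / m + 1 := Real.sqrt_sq (by positivity)
  refine ⟨R * Real.exp (C' * (2 + E)), fun E' u hu s hs hint t => ?_⟩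
  by_contra! hlt
  have hcu := hu.smooth.continuous
  have hcg := continuous_gradNorm hΩ hJ hu
  have hper : ∀ τ, u (s, Int.fract τ) = u (s, τ) := fun τ => by
    have h1 : Function.Periodic (fun τ => u (s, τ)) 1 := hu.periodic s
    have h2 := h1.sub_int_mul_eq (x := τ) ⌊τ⌋
    rwa [mul_one, Int.self_sub_floor] at h2
  -- Large radius at one point gives radius above R on the whole loop; the exponential factor in the
  -- bound pays for this.
  have hlarge : ∀ τ, R < D.cutRadius (u (s, τ)) := fun τ => by
    have h1 := log_le_of_loop hC'.le (w := fun τ => D.cutRadius (u (s, τ)))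
      (n := fun τ => gradNorm Ω J u (s, τ))
      (D.continuous_cutRadius.comp (hcu.comp (by fun_prop)))
      (hcg.comp (by fun_prop)) (fun _ => Real.sqrt_nonneg _) (fun _ => D.one_le_cutRadius _)
      (fun τ hτ => (hd E' u hu s τ hτ).2) hint
      (t := Int.fract τ) (t' := Int.fract t) ⟨Int.fract_nonneg _, (Int.fract_lt_one _).le⟩
      ⟨Int.fract_nonneg _, (Int.fract_lt_one _).le⟩
    rw [hper, hper] at h1
    exact lt_of_mul_lt_mul_right (hlt.trans_le h1) (Real.exp_pos _).le
  have hend : ∀ τ, u (s, τ) ∈ D.endSet 1 := fun τ => one_lt_cutRadius.1 (hR1.trans_lt (hlarge τ))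
  set e : ℝ → EuclideanSpace ℝ (Fin n) := fun τ => vecDiffAt ι (D.base (u (s, τ)))
    (D.dbase (u (s, τ)) (endAt (J s τ) (u (s, τ)) (planeDiff u (s, τ) (1, 0)))) with hedef
  have hder : ∀ τ, HasDerivAt (fun τ => ι (D.base (u (s, τ)))) (V (τ, D.base (u (s, τ))) + e τ) τ :=
    fun τ => by
      have := hasDerivAt_embedding_base hα hΩ hJ hG hι hu (hend τ)
      rwa [hs] at this
  have hx : Continuous fun τ => D.base (u (s, τ)) := continuous_iff_continuousAt.2 fun τ =>
    ((D.contMDiffAt_base (hend τ).1).continuousAt).comp (f := fun τ => u (s, τ))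
      (hcu.comp (by fun_prop : Continuous fun τ : ℝ => (s, τ))).continuousAt
  have hsm : ContDiff ℝ ∞ fun τ => ι (D.base (u (s, τ))) := contDiff_iff_contDiffAt.2 fun τ => by
    have h1 : ContMDiffAt 𝓘(ℝ, ℝ) 𝓘(ℝ, ℝ × ℝ) ∞ (fun τ : ℝ => (s, τ)) τ :=
      (contDiffAt_const.prodMk contDiffAt_id).contMDiffAt
    have h2 : ContMDiffAt 𝓘(ℝ, ℝ × ℝ) (𝓡 k) ∞ (fun p => D.base (u p)) (s, τ) :=
      contMDiffAt_base_comp hu.smooth (hend τ).1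
    exact ((hι _).comp τ (ContMDiffAt.comp τ h2 h1)).contDiffAt
  -- `e` is the difference between the velocity of the projected loop and the contact velocity, and
  -- both are continuous.
  have he : Continuous e := by
    have h1 : e = fun τ => deriv (fun τ => ι (D.base (u (s, τ)))) τ - V (τ, D.base (u (s, τ))) := by
      funext τ
      rw [(hder τ).deriv, add_sub_cancel_left]
    rw [h1]
    exact (hsm.continuous_deriv (by simp)).sub (hV.continuous.comp (continuous_id.prodMk hx))
  obtain ⟨τ, hτ, hτm⟩ := hsep (fun τ => D.base (u (s, τ))) e
    (by simpa using congrArg D.base (hu.periodic s 0)) he fun τ _ => hder τ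
  refine absurd hτm (not_lt.2 ?_)
  have hRpos : 0 < √R := by rw [hRs]; positivity
  have hle : ∀ τ, ‖e τ‖ ≤ C / √R * (1 + gradNorm Ω J u (s, τ) ^ 2) := fun τ => by
    have h1 := hb E' u hu (s, τ) (hend τ)
    have h2 : √R ≤ √(D.radius (u (s, τ))) := by
      refine Real.sqrt_le_sqrt ?_
      rw [← cutRadius_eq (hend τ)]
      exact (hlarge τ).le
    have h3 : √R * ‖e τ‖ ≤ C * gradNorm Ω J u (s, τ) :=
      (mul_le_mul_of_nonneg_right h2 (norm_nonneg _)).trans h1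
    have h4 : gradNorm Ω J u (s, τ) ≤ 1 + gradNorm Ω J u (s, τ) ^ 2 := by
      nlinarith [sq_nonneg (gradNorm Ω J u (s, τ) - 1)]
    rw [div_mul_eq_mul_div, le_div_iff₀ hRpos, mul_comm]
    exact h3.trans (mul_le_mul_of_nonneg_left h4 hC.le)
  have hcg1 : Continuous fun τ => gradNorm Ω J u (s, τ) := hcg.comp (by fun_prop)
  have hc2 : Continuous fun τ => C / √R * (1 + gradNorm Ω J u (s, τ) ^ 2) :=
    continuous_const.mul (continuous_const.add (hcg1.pow 2))
  calc ‖∫ x in (0 : ℝ)..τ, e x‖ ≤ ∫ x in (0 : ℝ)..τ, C / √R * (1 + gradNorm Ω J u (s, x) ^ 2) :=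
        intervalIntegral.norm_integral_le_of_norm_le hτ.1 (Eventually.of_forall fun x _ => hle x)
          (hc2.intervalIntegrable _ _)
    _ ≤ ∫ x in (0 : ℝ)..1, C / √R * (1 + gradNorm Ω J u (s, x) ^ 2) :=
        intervalIntegral.integral_mono_interval le_rfl hτ.1 hτ.2
          (Eventually.of_forall fun x => by positivity) (hc2.intervalIntegrable _ _)
    _ ≤ C / √R * (1 + E) := by
        rw [intervalIntegral.integral_const_mul, intervalIntegral.integral_add
          (_root_.intervalIntegrable_const) (Continuous.intervalIntegrable
            (u := fun τ => gradNorm Ω J u (s, τ) ^ 2) (hcg1.pow 2) _ _)]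
        simp only [intervalIntegral.integral_const, sub_zero, one_smul]
        gcongr
    _ ≤ m := by
        rw [div_mul_eq_mul_div, div_le_iff₀ hRpos, hRs]
        have : m * (C * (1 + E) / m + 1) = C * (1 + E) + m := by field_simp
        linarith

end ModelledAtInfinity

/-! ### Floer solutions give profiles -/

namespace ModelledAtInfinity

variable {k d : ℕ} {S M : Type*}
  [TopologicalSpace S] [ChartedSpace (EuclideanSpace ℝ (Fin k)) S] [IsManifold (𝓡 k) ∞ S]
  [TopologicalSpace M] [ChartedSpace (EuclideanSpace ℝ (Fin d)) M] [IsManifold (𝓡 d) ∞ M]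
  {α : OneForm k S} {Ω : BilinField d M} {D : ModelledAtInfinity α Ω}
  {H : ℝ → ℝ → M → ℝ} {J : ℝ → ℝ → EndField d M} {E : ℝ} {u : ℝ × ℝ → M}

theorem integral_gradNorm_sq_le (hΩ : IsSymplecticForm Ω) (hJ : D.IsContinuationAcs J) (hE : 0 ≤ E)
    (hu : IsFloerSolution Ω H J E u) {a b : ℝ} (hab : a ≤ b) :
    ∫ s in a..b, ∫ t in (0 : ℝ)..1, gradNorm Ω J u (s, t) ^ 2 ≤ E := by
  have hc : Continuous fun p => gradNorm Ω J u p ^ 2 := (continuous_gradNorm hΩ hJ hu).pow 2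
  have hin (s : ℝ) : ENNReal.ofReal (∫ t in (0 : ℝ)..1, gradNorm Ω J u (s, t) ^ 2)
      = ∫⁻ t in Ioc (0 : ℝ) 1, ENNReal.ofReal (gradNorm Ω J u (s, t) ^ 2) := by
    rw [intervalIntegral.integral_of_le zero_le_one]
    exact MeasureTheory.ofReal_integral_eq_lintegral_ofReal
      ((hc.comp (by fun_prop : Continuous fun t : ℝ => (s, t))).integrableOn_Ioc)
      (Eventually.of_forall fun t => sq_nonneg _)
  have hout : Continuous fun s => ∫ t in (0 : ℝ)..1, gradNorm Ω J u (s, t) ^ 2 :=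
    intervalIntegral.continuous_parametric_intervalIntegral_of_continuous' hc _ _
  rw [← ENNReal.ofReal_le_ofReal_iff hE]
  refine le_trans ?_ hu.energy_le
  rw [intervalIntegral.integral_of_le hab, MeasureTheory.ofReal_integral_eq_lintegral_ofReal
    hout.integrableOn_Ioc (Eventually.of_forall fun s =>
      intervalIntegral.integral_nonneg zero_le_one fun t _ => sq_nonneg _)]
  refine (MeasureTheory.setLIntegral_le_lintegral _ _).trans (le_of_eq ?_)
  unfold energy
  refine MeasureTheory.lintegral_congr fun s => ?_
  rw [hin s]
  refine MeasureTheory.lintegral_congr fun t => ?_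
  rw [gradNorm_sq hJ]
  rfl

variable [T2Space S] [CompactSpace S] (hα : IsContactForm α) (hΩ : IsSymplecticForm Ω)
  (hH : D.IsContinuationHam H) (hJ : D.IsContinuationAcs J)
include hα hΩ hH hJ

/-- For these s the Hamiltonian is H⁰ or H¹, whose contact isotopies have no fixed points; so two
applications of the loop estimate suffice. -/
theorem exists_cutRadius_le_of_good_loop (hE : 0 ≤ E) :
    ∃ B : ℝ, ∀ E' u, IsFloerSolution Ω H J E' u → ∀ s, (s ≤ 0 ∨ 1 ≤ s) →
      ∫ t in (0 : ℝ)..1, gradNorm Ω J u (s, t) ^ 2 ≤ E → ∀ t, D.cutRadius (u (s, t)) ≤ B := by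
  have hG := D.endGeometry hα hΩ hH hJ
  have hfix {σ : ℝ} (hσ : D.MemHamNondeg (H σ)) (x : S) :
      flow (fun t => contactField α (D.slopeAt (H σ t))) 1 x ≠ x := by
    obtain ⟨h, hh⟩ := hσ.memHam.slope
    have h1 := hσ.no_fixed h hh x
    rwa [hh.eq_slopeAt] at h1
  obtain ⟨B₀, hB₀⟩ := exists_cutRadius_le_of_loop hα hΩ hJ hG hE (hfix hH.nondeg_zero)
  obtain ⟨B₁, hB₁⟩ := exists_cutRadius_le_of_loop hα hΩ hJ hG hE (hfix hH.nondeg_one)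
  refine ⟨max B₀ B₁, fun E' u hu s hs hint t => ?_⟩
  rcases hs with hs | hs
  · exact (hB₀ E' u hu s (by rw [hH.eq_of_nonpos s hs]) hint t).trans (le_max_left _ _)
  · exact (hB₁ E' u hu s (by rw [hH.eq_of_one_le s hs]) hint t).trans (le_max_right _ _)

/-- The constants are obtained before u is introduced and depend only on E, H and J, which makes the
final bound uniform. -/
theorem exists_isProfile (hE : 0 ≤ E) : ∃ C c B : ℝ, 0 < C ∧ 0 < c ∧
    ∀ u, IsFloerSolution Ω H J E u → IsProfile C c E B (fun p => D.cutRadius (u p))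
      (gradNorm Ω J u) (D.homogAlong (fun s t => D.twistAt (J s t)) u) := by
  have hG := D.endGeometry hα hΩ hH hJ
  set q : ℝ → ℝ → S → ℝ := fun s t => D.twistAt (J s t)
  obtain ⟨B, hB⟩ := exists_cutRadius_le_of_good_loop hα hΩ hH hJ hE
  obtain ⟨C₁, hC₁, hd⟩ := exists_hasDerivAt_cutRadius hα hΩ hJ hG
  obtain ⟨C₂, hC₂, hl⟩ := exists_laplacian_ge hα hΩ hJ hG
  obtain ⟨C₃, hC₃, hq⟩ := hG.tame_q.exists_bound hG.smooth_q.continuous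
  -- A uniform upper bound of 1 / q is a uniform positive lower bound of q. It gives r ≤ C₄ Q, which
  -- turns ΔQ ≥ -C₂ r into ΔQ ≥ -C₂ C₄ Q.
  obtain ⟨C₄, hC₄, hq'⟩ := (hG.tame_q.map fun f x => (f x)⁻¹).exists_bound
    (hG.smooth_q.continuous.inv₀ fun p => (hG.q_pos _ _ _).ne')
  have hqc : ∀ s t x, C₄⁻¹ ≤ q s t x := fun s t x =>
    inv_le_of_inv_le₀ (hG.q_pos s t x) ((le_abs_self _).trans (hq' s t x))
  refine ⟨C₁ + C₂ * C₄ + C₃, C₄⁻¹, B, by positivity, by positivity, fun u hu => ?_⟩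
  have hcu := hu.smooth.continuous
  have hle : C₁ ≤ C₁ + C₂ * C₄ + C₃ := by linarith [mul_pos hC₂ hC₄]
  have hpos : ∀ p, 0 ≤ D.cutRadius (u p) := fun p => zero_le_one.trans (D.one_le_cutRadius _)
  have hgn : ∀ p, 0 ≤ gradNorm Ω J u p := fun p => Real.sqrt_nonneg _
  have hf : ∀ p, 1 < D.cutRadius (u p) →
      D.homogAlong q u p = D.cutRadius (u p) * q p.1 p.2 (D.base (u p)) := fun p hp => by
    rw [cutRadius_eq (one_lt_cutRadius.1 hp)]
    rfl
  have hfge : ∀ p, 1 < D.cutRadius (u p) → C₄⁻¹ * D.cutRadius (u p) ≤ D.homogAlong q u p :=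
    fun p hp => by
      rw [hf p hp, mul_comm]
      exact mul_le_mul_of_nonneg_left (hqc _ _ _) (hpos p)
  have hsm : ∀ p, 1 < D.cutRadius (u p) → ContDiffAt ℝ 2 (D.homogAlong q u) p := fun p hp =>
    (contDiffAt_homogAlong hu.smooth (one_lt_cutRadius.1 hp).1 hG.smooth_q).of_le two_le_infty
  refine ⟨D.continuous_cutRadius.comp hcu, fun p => D.one_le_cutRadius _,
    continuous_gradNorm hΩ hJ hu, hgn, fun s t => by rw [hu.periodic], fun s t => ?_,
    fun s t hst => ?_, fun s t hst => ?_, hsm, hfge, fun p hp => ?_, fun s t hst => ?_,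
    hB E u hu, fun a b hab => integral_gradNorm_sq_le hΩ hJ hE hu hab⟩
  · simp only [homogAlong, hu.periodic, hG.tame_q.periodic s t]
  · obtain ⟨δ, h1, h2⟩ := (hd E u hu s t hst).1
    exact ⟨δ, h1, h2.trans (mul_le_mul_of_nonneg_right hle (mul_nonneg (Real.sqrt_nonneg _) (hgn _)))⟩
  · obtain ⟨δ, h1, h2⟩ := (hd E u hu s t hst).2
    exact ⟨δ, h1, h2.trans (add_le_add
      (mul_le_mul_of_nonneg_right hle (mul_nonneg (Real.sqrt_nonneg _) (hgn _)))
      (mul_le_mul_of_nonneg_right hle (hpos _)))⟩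
  · rw [hf p hp, mul_comm]
    refine mul_le_mul_of_nonneg_right (((le_abs_self _).trans (hq _ _ _)).trans ?_) (hpos p)
    linarith [mul_pos hC₂ hC₄]
  · have h1 := hl E u hu (s, t) (one_lt_cutRadius.1 hst)
    obtain ⟨h2, h3⟩ := deriv_deriv_line (hsm _ hst)
    rw [h2, h3]
    refine le_trans (neg_le_neg ?_) h1
    rw [← cutRadius_eq (one_lt_cutRadius.1 hst)]
    have h4 := hfge _ hst
    rw [inv_mul_le_iff₀ hC₄] at h4
    have h5 : 0 ≤ D.homogAlong q u (s, t) :=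
      nonneg_of_mul_nonneg_right ((hpos _).trans h4) hC₄
    calc C₂ * D.cutRadius (u (s, t)) ≤ C₂ * (C₄ * D.homogAlong q u (s, t)) := by gcongr
      _ = C₂ * C₄ * D.homogAlong q u (s, t) := by ring
      _ ≤ _ := mul_le_mul_of_nonneg_right (by linarith) h5

end ModelledAtInfinity

end FloerMax

end

/-! ### The extended maximum principle -/

open FloerMax in
theorem theorem3 (m : ℕ)
    {S : Type*} [TopologicalSpace S] [ChartedSpace (EuclideanSpace ℝ (Fin (2 * m + 1))) S]
    [IsManifold (𝓡 (2 * m + 1)) ∞ S] [T2Space S] [CompactSpace S]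
    {M : Type*} [TopologicalSpace M] [ChartedSpace (EuclideanSpace ℝ (Fin (2 * m + 2))) M]
    [IsManifold (𝓡 (2 * m + 2)) ∞ M] [T2Space M] [SecondCountableTopology M]
    [ConnectedSpace M] [NoncompactSpace M]
    (α : OneForm (2 * m + 1) S) (hα : IsContactForm α)
    (Ω : BilinField (2 * m + 2) M) (hΩ : IsSymplecticForm Ω)
    (D : ModelledAtInfinity α Ω)
    (H : ℝ → ℝ → M → ℝ) (hH : D.IsContinuationHam H)
    (J : ℝ → ℝ → EndField (2 * m + 2) M) (hJ : D.IsContinuationAcs J)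
    (E : ℝ) (hE : 0 ≤ E) :
    ∃ r₀ : ℝ, 0 < r₀ ∧ ∀ u : ℝ × ℝ → M, IsFloerSolution Ω H J E u →
      range u ∩ D.endSet r₀ = ∅ := by
  obtain ⟨C, c, B, hC, hc, hprofile⟩ := ModelledAtInfinity.exists_isProfile hα hΩ hH hJ hE
  obtain ⟨K, hK⟩ := IsProfile.exists_bound (E := E) B hC hc
  -- The maximum with 1 ensures that r₀ is positive and that the bounded function agrees with the
  -- radius beyond r₀.
  refine ⟨max K 1, by positivity, fun u hu => ?_⟩
  rw [eq_empty_iff_forall_notMem]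
  rintro _ ⟨⟨p, rfl⟩, hp⟩
  have h1 := hK _ _ _ (hprofile u hu) p
  rw [ModelledAtInfinity.cutRadius_eq (D.endSet_anti (le_max_right K 1) hp)] at h1
  exact absurd hp.2 (not_lt.2 (h1.trans (le_max_left _ _)))
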